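/- Let $p:X\to M$ be a smooth principal $\mathbb T^n$-bundle over a smooth (finite-dimensional) manifold, let $K^1,\dots,K^n$ be the fundamental vector fields of the standard basis of $\mathfrak t=\mathrm{Lie}\,\mathbb T^n\cong\mathbb R^n$ (circle coordinates of period $1$), let $\Theta=(\Theta_I)_{I=1}^n$ be a principal connection (smooth $\mathbb T^n$-invariant $1$-forms on $X$ with $\imath(K^I)\Theta_J=\delta^I_J$), and let $H$ be a smooth $\mathbb T^n$-invariant $3$-form on $X$ (for instance a closed one). The $H$-twisted Courant bracket on sections of $TX\oplus T^*X$ is $$[(v_1,\rho_1),(v_2,\rho_2)]_H=\Bigl([v_1,v_2],\ \mathcal L(v_1)\rho_2-\mathcal L(v_2)\rho_1-\tfrac12 d\bigl(\imath(v_1)\rho_2-\imath(v_2)\rho_1\bigr)+\imath(v_1)\imath(v_2)H\Bigr).$$ Repeated torus indices are summed. Then there are smooth forms $F_I\in\Omega^2(M)$ with $d\Theta_I=p^*F_I$, and smooth forms $H_3\in\Omega^3(M)$, $H_2^I\in\Omega^2(M)$, $H_1^{IJ}\in\Omega^1(M)$, $H_0^{IJK}\in\Omega^0(M)$, totally antisymmetric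 in the torus indices, with $$H=p^*H_3+p^*H_2^I\wedge\Theta_I+\tfrac12p^*H_1^{IJ}\wedge\Theta_I\wedge\Theta_J+\tfrac16 p^*H_0^{IJK}\,\Theta_I\wedge\Theta_J\wedge\Theta_K,$$ such that the following holds. (a) The linear map sending $(v_M,f;\rho_M,\phi)$ to $(v_M^{\mathrm{hor}}+f_IK^I,\ p^*\rho_M+\phi^I\Theta_I)$, where $v_M^{\mathrm{hor}}$ is the horizontal lift of $v_M$ and functions on $M$ are pulled back to $X$, is an isomorphism from the space of smooth sections of $TM\oplus T^*M\oplus\mathfrak t\oplus\mathfrak t^*$ onto the space of smooth $\mathbb T^n$-invariant sections of $TX\oplus T^*X$. (b) Invariant sections are closed under $[\cdot,\cdot]_H$, and under this isomorphism the bracket becomes $$[(v_M,f;\rho_M,\phi),(w_M,g;\lambda_M,\eta)]_H=\Bigl([(v_M,f),(w_M,g)];\ \mathcal L_{(v_M,f)}(\lambda_M,\eta)-\mathcal L_{(w_M,g)}(\rho_M,\phi)-\tfrac12 d\bigl(\imath(v_M,f)(\lambda_M,\eta)-\imath(w_M,g)(\rho_M,\phi)\bigr)+\imath(v_M,f)\,\imath(w_M,g)H\Bigr),$$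 where $$\imath(v_M,f)(\lambda_M,\eta)=\imath(v_M)\lambda_M+\eta^If_I,\qquad d h=(dh,0)\ \text{ for a function } h \text{ on } M,$$ $$\mathcal L_{(v_M,f)}(\lambda_M,\eta)=\bigl(\mathcal L(v_M)\lambda_M+\eta^I(\imath(v_M)F_I+df_I),\ \mathcal L(v_M)\eta\bigr),$$ $$[(v_M,f),(w_M,g)]=\bigl([v_M,w_M],\ \imath(v_M)\imath(w_M)F+\mathcal L(v_M)g-\mathcal L(w_M)f\bigr),$$ and $\imath(v_M,f)\,\imath(w_M,g)H$ has $T^*M$-component $$\imath(v_M)\imath(w_M)H_3+g_I\,\imath(v_M)H_2^I-f_I\,\imath(w_M)H_2^I-f_Ig_J\,H_1^{IJ}$$ and $\mathfrak t^*$-component (index $K$) $$\imath(v_M)\imath(w_M)H_2^K-g_I\,\imath(v_M)H_1^{IK}+f_I\,\imath(w_M)H_1^{IK}-f_Ig_J\,H_0^{IJK}.$$ -/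

import Mathlib

open scoped Manifold ContDiff

namespace TorusReduction

noncomputable section

/-! ### Vector fields and differential forms on a manifold modelled on `E`

In Mathlib `TangentSpace 𝓘(ℝ, E) x` is by definition `E` (a tangent vector at `x` is read in the
preferred chart at `x`), so a `k`-form is a family of alternating `k`-linear forms on `E`. -/

section Calculus

variable {E : Type*} [NormedAddCommGroup E] [NormedSpace ℝ E]
variable {M : Type*} [TopologicalSpace M] [ChartedSpace E M]
variable {E' : Type*} [NormedAddCommGroup E'] [NormedSpace ℝ E']
variable {N : Type*} [TopologicalSpace N] [ChartedSpace E' N]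
variable {k : ℕ}

/-- (Not necessarily smooth) vector fields on `M`. -/
abbrev VField (E : Type*) [NormedAddCommGroup E] [NormedSpace ℝ E]
    (M : Type*) [TopologicalSpace M] [ChartedSpace E M] : Type _ :=
  (x : M) → TangentSpace 𝓘(ℝ, E) x

/-- (Not necessarily smooth) differential `k`-forms on `M`. -/
abbrev DForm (E : Type*) [NormedAddCommGroup E] [NormedSpace ℝ E]
    (M : Type*) (k : ℕ) : Type _ :=
  M → E [⋀^Fin k]→L[ℝ] ℝ

/-- Smoothness of a vector field: it is a smooth section of the tangent bundle. -/
def VField.IsSmooth [IsManifold 𝓘(ℝ, E) ∞ M] (v : VField E M) : Prop :=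
  ContMDiff 𝓘(ℝ, E) 𝓘(ℝ, E).tangent ∞ fun x ↦ (⟨x, v x⟩ : TangentBundle 𝓘(ℝ, E) M)

/-- Smoothness of a function. -/
def IsSmoothFun (E : Type*) [NormedAddCommGroup E] [NormedSpace ℝ E]
    {M : Type*} [TopologicalSpace M] [ChartedSpace E M] (h : M → ℝ) : Prop :=
  ContMDiff 𝓘(ℝ, E) 𝓘(ℝ, ℝ) ∞ h

/-- The derivative of a map between manifolds at a point. -/
def tangentMapAt (f : M → N) (x : M) : E →L[ℝ] E' :=
  mfderiv 𝓘(ℝ, E) 𝓘(ℝ, E') f x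

/-- The pullback `f^* η`. -/
def pull (f : M → N) (η : DForm E' N k) : DForm E M k :=
  fun x ↦ (η (f x)).compContinuousLinearMap (tangentMapAt f x)

/-- The coordinate representation of `η` in the preferred chart at `x₀`
(meaningful on the target of that chart). -/
def inChart (x₀ : M) (η : DForm E M k) : DForm E E k :=
  pull (extChartAt 𝓘(ℝ, E) x₀).symm η

/-- Smoothness of a differential form: its coordinate representations are smooth. -/
def DForm.IsSmooth (η : DForm E M k) : Prop :=
  ∀ x₀ : M, ContDiffOn ℝ ∞ (inChart x₀ η) (extChartAt 𝓘(ℝ, E) x₀).target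

/-- The exterior derivative, computed at `x` in the preferred chart at `x`. -/
def d (η : DForm E M k) : DForm E M (k + 1) :=
  fun x ↦ pull (extChartAt 𝓘(ℝ, E) x) (extDeriv (inChart x η)) x

/-- A function as a `0`-form. -/
def ofFun (h : M → ℝ) : DForm E M 0 :=
  fun x ↦ ContinuousAlternatingMap.constOfIsEmpty ℝ E (Fin 0) (h x)

/-- A `0`-form as a function. -/
def toFun (α : DForm E M 0) : M → ℝ :=
  fun x ↦ α x Fin.elim0

/-- The contraction `(ι(v) η)(u₁, …, uₖ) = η(v, u₁, …, uₖ)`. -/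
def contr (v : VField E M) (η : DForm E M (k + 1)) : DForm E M k :=
  fun x ↦ (η x).curryLeft (v x)

/-- The Lie derivative of a form of positive degree, `L(v) η = d ι(v) η + ι(v) d η`. -/
def lieForm (v : VField E M) (η : DForm E M (k + 1)) : DForm E M (k + 1) :=
  d (contr v η) + contr v (d η)

/-- The Lie derivative of a function, `L(v) h = dh(v)`. -/
def lieFun (v : VField E M) (h : M → ℝ) : M → ℝ :=
  fun x ↦ mfderiv 𝓘(ℝ, E) 𝓘(ℝ, ℝ) h x (v x)

/-- The wedge product `η ∧ θ` of a `k`-form and a `1`-form,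
`(η ∧ θ)(u₀, …, uₖ) = (-1)ᵏ ∑ᵢ (-1)ⁱ θ(uᵢ) η(u₀, …, ûᵢ, …, uₖ)`. -/
def wedge (η : DForm E M k) (θ : DForm E M 1) : DForm E M (k + 1) :=
  fun x ↦ (-1 : ℝ) ^ k • ContinuousAlternatingMap.alternatizeUncurryFin
    (((ContinuousAlternatingMap.ofSubsingleton ℝ E ℝ (0 : Fin 1)).symm (θ x)).smulRight (η x))

/-- Multiplication of a form by a function. -/
def fmul (h : M → ℝ) (η : DForm E M k) : DForm E M k :=
  fun x ↦ h x • η x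

/-- (Not necessarily smooth) sections `(v, ρ)` of `TM ⊕ T^*M`. -/
abbrev GenSec (E : Type*) [NormedAddCommGroup E] [NormedSpace ℝ E]
    (M : Type*) [TopologicalSpace M] [ChartedSpace E M] : Type _ :=
  VField E M × DForm E M 1

/-- The Courant bracket on sections of `TM ⊕ T^*M` twisted by the `3`-form `H`. -/
def courantBracket (H : DForm E M 3) (a b : GenSec E M) : GenSec E M :=
  (VectorField.mlieBracket 𝓘(ℝ, E) a.1 b.1,
    lieForm a.1 b.2 - lieForm b.1 a.2
      - (1 / 2 : ℝ) • d (contr a.1 b.2 - contr b.1 a.2)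
      + contr a.1 (contr b.1 H))

lemma VField.IsSmooth.add [IsManifold 𝓘(ℝ, E) ∞ M] {v w : VField E M}
    (hv : VField.IsSmooth v) (hw : VField.IsSmooth w) : VField.IsSmooth (v + w) :=
  ContMDiff.add_section hv hw

lemma VField.IsSmooth.zero [IsManifold 𝓘(ℝ, E) ∞ M] : VField.IsSmooth (0 : VField E M) :=
  Bundle.contMDiff_zeroSection ℝ (TangentSpace 𝓘(ℝ, E) : M → Type _)

lemma VField.IsSmooth.smul [IsManifold 𝓘(ℝ, E) ∞ M] {v : VField E M} (c : ℝ)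
    (hv : VField.IsSmooth v) : VField.IsSmooth (c • v) :=
  ContMDiff.const_smul_section (a := c) hv

lemma IsSmoothFun.smul {h : M → ℝ} (c : ℝ) (hh : IsSmoothFun E h) : IsSmoothFun E (c • h) :=
  (contDiff_const_smul c).contMDiff.comp hh

lemma DForm.IsSmooth.add {α β : DForm E M k} (hα : DForm.IsSmooth α) (hβ : DForm.IsSmooth β) :
    DForm.IsSmooth (α + β) :=
  fun x₀ ↦ (hα x₀).add (hβ x₀)

lemma DForm.IsSmooth.zero : DForm.IsSmooth (0 : DForm E M k) :=
  fun _ ↦ contDiffOn_const (c := (0 : E [⋀^Fin k]→L[ℝ] ℝ))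

lemma DForm.IsSmooth.smul {α : DForm E M k} (c : ℝ) (hα : DForm.IsSmooth α) :
    DForm.IsSmooth (c • α) :=
  fun x₀ ↦ (hα x₀).const_smul c

end Calculus

/-! ### Principal torus bundles and connections -/

section Bundle

/-- The torus `𝕋ⁿ`. -/
abbrev Torus (n : ℕ) : Type := Fin n → Circle

/-- The model with corners of the manifold `𝕋ⁿ`. -/
abbrev torusModel (n : ℕ) := ModelWithCorners.pi fun _ : Fin n ↦ 𝓡 1

variable {n : ℕ}
variable {E : Type*} [NormedAddCommGroup E] [NormedSpace ℝ E]
variable {M : Type*} [TopologicalSpace M] [ChartedSpace E M]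
variable {E' : Type*} [NormedAddCommGroup E'] [NormedSpace ℝ E']
variable {X : Type*} [TopologicalSpace X] [ChartedSpace E' X]
variable [MulAction (Torus n) X]

/-- `p : X → M` is a smooth principal `𝕋ⁿ`-bundle: `p` and the action are smooth, and over a
neighbourhood `U` of each point of `M` there is an equivariant diffeomorphism
`U × 𝕋ⁿ ≃ p⁻¹(U)` over `U`. -/
structure IsPrincipalTorusBundle (n : ℕ) (E E' : Type*)
    [NormedAddCommGroup E] [NormedSpace ℝ E] [NormedAddCommGroup E'] [NormedSpace ℝ E']
    {M X : Type*} [TopologicalSpace M] [ChartedSpace E M] [TopologicalSpace X]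
    [ChartedSpace E' X] [MulAction (Torus n) X] (p : X → M) : Prop where
  smooth_proj : ContMDiff 𝓘(ℝ, E') 𝓘(ℝ, E) ∞ p
  smooth_action : ContMDiffSMul (torusModel n) 𝓘(ℝ, E') ∞ (Torus n) X
  locally_trivial : ∀ m : M, ∃ (U : Set M) (φ : OpenPartialHomeomorph (M × Torus n) X),
    m ∈ U ∧ φ.source = U ×ˢ Set.univ ∧ φ.target = p ⁻¹' U ∧
    ContMDiffOn (𝓘(ℝ, E).prod (torusModel n)) 𝓘(ℝ, E') ∞ φ φ.source ∧
    ContMDiffOn 𝓘(ℝ, E') (𝓘(ℝ, E).prod (torusModel n)) ∞ φ.symm φ.target ∧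
    ∀ y ∈ U, ∀ t : Torus n, p (φ (y, t)) = y ∧ ∀ s : Torus n, φ (y, s * t) = s • φ (y, t)

/-- The fundamental vector field `K_I = ∂/∂θ_I`, where `θ_I` has period `1`: the velocity at
`s = 0` of `s ↦ exp(2πi s e_I) • x`. -/
def fundField (n : ℕ) {E' : Type*} [NormedAddCommGroup E'] [NormedSpace ℝ E']
    {X : Type*} [TopologicalSpace X] [ChartedSpace E' X] [MulAction (Torus n) X]
    (i : Fin n) : VField E' X :=
  fun x ↦ tangentMapAt (E := ℝ) (E' := E')
    (fun s : ℝ ↦ (Pi.mulSingle i (Circle.exp (2 * Real.pi * s)) : Torus n) • x) 0 1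

/-- `𝕋ⁿ`-invariance of a vector field: `t_* v = v` for all `t`. -/
def InvField (n : ℕ) [MulAction (Torus n) X] (v : VField E' X) : Prop :=
  ∀ (t : Torus n) (x : X), tangentMapAt (E := E') (E' := E') (fun y : X ↦ t • y) x (v x) = v (t • x)

/-- `𝕋ⁿ`-invariance of a form: `t^* η = η` for all `t`. -/
def InvForm (n : ℕ) [MulAction (Torus n) X] {k : ℕ} (η : DForm E' X k) : Prop :=
  ∀ t : Torus n, pull (fun y : X ↦ t • y) η = η

/-- A principal connection, given by its component `1`-forms `Θ_I`. -/
structure IsConnection (Θ : Fin n → DForm E' X 1) : Prop where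
  smooth : ∀ i, DForm.IsSmooth (Θ i)
  vertical : ∀ i j (x : X), Θ j x (fun _ ↦ fundField n i x) = if i = j then 1 else 0
  invariant : ∀ i, InvForm n (Θ i)

/-- The `ℝ`-vector space of smooth `𝕋ⁿ`-invariant sections of `TX ⊕ T^*X`. -/
def invSections (n : ℕ) (E' : Type*) [NormedAddCommGroup E'] [NormedSpace ℝ E']
    (X : Type*) [TopologicalSpace X] [ChartedSpace E' X] [IsManifold 𝓘(ℝ, E') ∞ X]
    [MulAction (Torus n) X] : Submodule ℝ (GenSec E' X) where
  carrier := {a | VField.IsSmooth a.1 ∧ InvField n a.1 ∧ DForm.IsSmooth a.2 ∧ InvForm n a.2}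
  add_mem' := by
    rintro a b ⟨h1, h2, h3, h4⟩ ⟨k1, k2, k3, k4⟩
    refine ⟨h1.add k1, fun t x ↦ ?_, h3.add k3, fun t ↦ ?_⟩
    · exact (ContinuousLinearMap.map_add _ _ _).trans (congrArg₂ (· + ·) (h2 t x) (k2 t x))
    · exact congrArg₂ (· + ·) (h4 t) (k4 t)
  zero_mem' := ⟨VField.IsSmooth.zero, fun _ _ ↦ ContinuousLinearMap.map_zero _,
    DForm.IsSmooth.zero, fun _ ↦ rfl⟩
  smul_mem' := by
    rintro c a ⟨h1, h2, h3, h4⟩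
    refine ⟨h1.smul c, fun t x ↦ ?_, h3.smul c, fun t ↦ ?_⟩
    · exact (ContinuousLinearMap.map_smul _ _ _).trans (congrArg (c • ·) (h2 t x))
    · exact congrArg (c • ·) (h4 t)

end Bundle

/-! ### The reduced objects on the base -/

section Reduced

variable {n : ℕ}
variable {E : Type*} [NormedAddCommGroup E] [NormedSpace ℝ E]
variable {M : Type*} [TopologicalSpace M] [ChartedSpace E M]
variable {E' : Type*} [NormedAddCommGroup E'] [NormedSpace ℝ E']
variable {X : Type*} [TopologicalSpace X] [ChartedSpace E' X]

/-- Sections `(v_M, f)` of `TM ⊕ 𝔱`. -/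
abbrev RedVec (n : ℕ) (E : Type*) [NormedAddCommGroup E] [NormedSpace ℝ E]
    (M : Type*) [TopologicalSpace M] [ChartedSpace E M] : Type _ :=
  VField E M × (Fin n → M → ℝ)

/-- Sections `(ρ_M, φ)` of `T^*M ⊕ 𝔱^*`. -/
abbrev RedCovec (n : ℕ) (E : Type*) [NormedAddCommGroup E] [NormedSpace ℝ E]
    (M : Type*) : Type _ :=
  DForm E M 1 × (Fin n → M → ℝ)

/-- Sections `(v_M, f; ρ_M, φ)` of `TM ⊕ 𝔱 ⊕ T^*M ⊕ 𝔱^*`. -/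
abbrev RedSec (n : ℕ) (E : Type*) [NormedAddCommGroup E] [NormedSpace ℝ E]
    (M : Type*) [TopologicalSpace M] [ChartedSpace E M] : Type _ :=
  RedVec n E M × RedCovec n E M

/-- The `ℝ`-vector space of smooth sections of `TM ⊕ T^*M ⊕ 𝔱 ⊕ 𝔱^*`. -/
def redSections (n : ℕ) (E : Type*) [NormedAddCommGroup E] [NormedSpace ℝ E]
    (M : Type*) [TopologicalSpace M] [ChartedSpace E M] [IsManifold 𝓘(ℝ, E) ∞ M] :
    Submodule ℝ (RedSec n E M) where
  carrier := {s | VField.IsSmooth s.1.1 ∧ (∀ i, IsSmoothFun E (s.1.2 i)) ∧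
    DForm.IsSmooth s.2.1 ∧ ∀ i, IsSmoothFun E (s.2.2 i)}
  add_mem' := fun ⟨h1, h2, h3, h4⟩ ⟨k1, k2, k3, k4⟩ ↦
    ⟨h1.add k1, fun i ↦ ContMDiff.add (h2 i) (k2 i), h3.add k3,
      fun i ↦ ContMDiff.add (h4 i) (k4 i)⟩
  zero_mem' := ⟨VField.IsSmooth.zero, fun _ ↦ contMDiff_const, DForm.IsSmooth.zero,
    fun _ ↦ contMDiff_const⟩
  smul_mem' := fun c _ ⟨h1, h2, h3, h4⟩ ↦
    ⟨h1.smul c, fun i ↦ IsSmoothFun.smul c (h2 i), h3.smul c,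
      fun i ↦ IsSmoothFun.smul c (h4 i)⟩

/-- Forms `H_j` on `M` of degree `j`, with `3 - j` torus indices. -/
structure Flux (n : ℕ) (E : Type*) [NormedAddCommGroup E] [NormedSpace ℝ E] (M : Type*) where
  H3 : DForm E M 3
  H2 : Fin n → DForm E M 2
  H1 : Fin n → Fin n → DForm E M 1
  H0 : Fin n → Fin n → Fin n → M → ℝ

/-- The `H_j` are smooth and totally antisymmetric in the torus indices. -/
structure Flux.IsAdmissible (h : Flux n E M) : Prop where
  smooth3 : DForm.IsSmooth h.H3
  smooth2 : ∀ i, DForm.IsSmooth (h.H2 i)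
  smooth1 : ∀ i j, DForm.IsSmooth (h.H1 i j)
  smooth0 : ∀ i j k, IsSmoothFun E (h.H0 i j k)
  antisymm1 : ∀ i j, h.H1 i j = -h.H1 j i
  antisymm0_left : ∀ i j k, h.H0 i j k = -h.H0 j i k
  antisymm0_right : ∀ i j k, h.H0 i j k = -h.H0 i k j

/-- `p^*H₃ + p^*H₂^I ∧ Θ_I + ½ p^*H₁^{IJ} ∧ Θ_I ∧ Θ_J + ⅙ p^*H₀^{IJK} Θ_I ∧ Θ_J ∧ Θ_K`. -/
def Flux.total (h : Flux n E M) (p : X → M) (Θ : Fin n → DForm E' X 1) : DForm E' X 3 :=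
  pull p h.H3
    + ∑ i, wedge (pull p (h.H2 i)) (Θ i)
    + (1 / 2 : ℝ) • ∑ i, ∑ j, wedge (wedge (pull p (h.H1 i j)) (Θ i)) (Θ j)
    + (1 / 6 : ℝ) • ∑ i, ∑ j, ∑ k,
        wedge (wedge (wedge (ofFun fun x ↦ h.H0 i j k (p x)) (Θ i)) (Θ j)) (Θ k)

/-- `ι(v_M, f) (λ_M, η) = ι(v_M) λ_M + ⟨η, f⟩`. -/
def redContr (a : RedVec n E M) (b : RedCovec n E M) : DForm E M 0 :=
  contr a.1 b.1 + ofFun (∑ i, b.2 i * a.2 i)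

/-- The reduced differential of an invariant function, `d h = (d h, 0)`. -/
def redD (h : DForm E M 0) : RedCovec n E M :=
  (d h, 0)

/-- `L_(v_M, f) (λ_M, η) = (L(v_M) λ_M + ⟨η, ι(v_M) F + df⟩, L(v_M) η)`. -/
def redLie (F : Fin n → DForm E M 2) (a : RedVec n E M) (b : RedCovec n E M) :
    RedCovec n E M :=
  (lieForm a.1 b.1 + ∑ i, fmul (b.2 i) (contr a.1 (F i) + d (ofFun (a.2 i))),
    fun i ↦ lieFun a.1 (b.2 i))

/-- `[(v_M, f), (w_M, g)] = ([v_M, w_M], ι(v_M) ι(w_M) F + L(v_M) g - L(w_M) f)`. -/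
def redLieBracket (F : Fin n → DForm E M 2) (a b : RedVec n E M) : RedVec n E M :=
  (VectorField.mlieBracket 𝓘(ℝ, E) a.1 b.1,
    fun i ↦ toFun (contr a.1 (contr b.1 (F i))) + lieFun a.1 (b.2 i) - lieFun b.1 (a.2 i))

/-- Components `(α, β^I, γ^{IJ})` on the base of an invariant `2`-form
`α + β^I ∧ Θ_I + ½ γ^{IJ} Θ_I ∧ Θ_J`. -/
abbrev RedTwo (n : ℕ) (E : Type*) [NormedAddCommGroup E] [NormedSpace ℝ E] (M : Type*) : Type _ :=
  DForm E M 2 × (Fin n → DForm E M 1) × (Fin n → Fin n → M → ℝ)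

/-- `ι(v_M, f) H = (ι(v_M) H₃ + ⟨H₂, f⟩, ι(v_M) H₂ - ⟨H₁, f⟩, ι(v_M) H₁ + ⟨H₀, f⟩)`. -/
def redContrFlux (a : RedVec n E M) (h : Flux n E M) : RedTwo n E M :=
  (contr a.1 h.H3 + ∑ i, fmul (a.2 i) (h.H2 i),
    fun j ↦ contr a.1 (h.H2 j) - ∑ i, fmul (a.2 i) (h.H1 i j),
    fun j k ↦ toFun (contr a.1 (h.H1 j k)) + ∑ i, a.2 i * h.H0 i j k)

/-- `ι(v_M, f) (α, β, γ) = (ι(v_M) α - ⟨β, f⟩, ι(v_M) β + ⟨γ, f⟩)`. -/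
def redContrTwo (a : RedVec n E M) (b : RedTwo n E M) : RedCovec n E M :=
  (contr a.1 b.1 - ∑ i, fmul (a.2 i) (b.2.1 i),
    fun j ↦ toFun (contr a.1 (b.2.1 j)) + ∑ i, a.2 i * b.2.2 i j)

/-- The reduced Courant bracket on sections of `TM ⊕ T^*M ⊕ 𝔱 ⊕ 𝔱^*`. -/
def reducedBracket (F : Fin n → DForm E M 2) (h : Flux n E M) (s t : RedSec n E M) :
    RedSec n E M :=
  (redLieBracket F s.1 t.1,
    redLie F s.1 t.2 - redLie F t.1 s.2
      - (1 / 2 : ℝ) • redD (redContr s.1 t.2 - redContr t.1 s.2)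
      + redContrTwo s.1 (redContrFlux t.1 h))

/-- `u` is a horizontal lift of `v` with respect to `Θ`. -/
def IsHorizontalLift (p : X → M) (Θ : Fin n → DForm E' X 1) (v : VField E M)
    (u : VField E' X) : Prop :=
  ∀ x : X, tangentMapAt (E := E') (E' := E) p x (u x) = v (p x) ∧ ∀ i, Θ i x (fun _ ↦ u x) = 0

/-- `a = (v, ρ)` is the section of `TX ⊕ T^*X` with components `s = (v_M, f; ρ_M, φ)`:
`v = v_M + ⟨K, f⟩`, with `v_M` lifted horizontally, and `ρ = p^*ρ_M + ⟨φ, Θ⟩`. -/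
def HasComponents [MulAction (Torus n) X] (p : X → M) (Θ : Fin n → DForm E' X 1) (s : RedSec n E M)
    (a : GenSec E' X) : Prop :=
  (∃ u : VField E' X, IsHorizontalLift p Θ s.1.1 u ∧
    a.1 = fun x ↦ u x + ∑ i, s.1.2 i (p x) • fundField n i x) ∧
  a.2 = pull p s.2.1 + ∑ i, fmul (fun x ↦ s.2.2 i (p x)) (Θ i)

end Reduced

end

end TorusReduction

open scoped Manifold ContDiff

/-! The connection splits each tangent space of `X`: `frame`, the map `u ↦ (Dp u, Θ u)`, identifies
`T_x X` with `T_{p x} M ⊕ ℝⁿ`. It is onto because a local section supplies the base directions and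
the `K_I` the vertical ones, and bijective because a local trivialisation bounds the dimension
(`frame_bijective`). By invariance of `p` and `Θ` it is unchanged along orbits (`frame_smul`), so
invariant data on `X` are data on `M`. Smoothness passes up because the frame is a smooth invertible
matrix in charts (`isSmooth_of_frame`), and down through smooth local sections. This gives the
isomorphism (`exists_liftEquiv`).

Smooth invariant forms of positive degree killed by every `K_I` descend to `M`
(`exists_form_descent`). For an invariant `H`, triple contraction with the fundamental fields gives
`H₀`. After subtracting its cubic term, double contraction gives `H₁`; after subtracting that term
too, single contraction gives `H₂`, and what finally remains is horizontal (`exists_threeForm_eq`).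
The curvature descends because `dΘ_J` is horizontal: along the flow of `K_I` the form `Θ_J` pulls
back to `δ_IJ ds` plus a form independent of `s`, and `ds` is closed (`pull_orbitMap_connection`,
`d_connection_fundField`).

The bracket is then computed in the frame. Its `TM` part is naturality of the Lie bracket under `p`.
Its `𝔱` part is Cartan's formula for `dΘ_I(v, w)` solved for `Θ_I([v, w])`, which is where `F`
enters (`IsLift.frame_mlieBracket`). The form part follows from `L = dι + ιd`, the Leibniz rule and
`dΘ_I = p^*F_I` (`IsLift.lieForm_eq`), together with two contractions of the polynomial expression
for `H` (`IsLift.contr_contr_total`). Uniqueness of components (`IsLift.unique_components`)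
identifies the result with the reduced bracket. -/

namespace TorusReduction

noncomputable section

/-! ### Smooth families of alternating forms on a vector space. -/

section Alternating

variable {E : Type*} [NormedAddCommGroup E] [NormedSpace ℝ E]
variable {G : Type*} [NormedAddCommGroup G] [NormedSpace ℝ G]
variable {k : ℕ} {r : ℕ∞ω}

/-- Currying off the first argument turns evaluation into repeated application of a smooth family of
linear maps, so induction on the degree applies. -/
lemma contDiffAt_alternating_apply {α : G → E [⋀^Fin k]→L[ℝ] ℝ} {v : Fin k → G → E} {x : G}
    (hα : ContDiffAt ℝ r α x) (hv : ∀ i, ContDiffAt ℝ r (v i) x) :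
    ContDiffAt ℝ r (fun y ↦ α y (fun i ↦ v i y)) x := by
  induction k with
  | zero =>
    have h : (fun y ↦ α y (fun i ↦ v i y)) = fun y ↦
        (ContinuousAlternatingMap.constOfIsEmptyLIE ℝ E ℝ (Fin 0)).symm (α y) := by
      funext y
      simp only [ContinuousAlternatingMap.constOfIsEmptyLIE]
      exact congrArg (α y) (Subsingleton.elim _ _)
    rw [h]
    exact (LinearIsometryEquiv.contDiff _).contDiffAt.comp x hα
  | succ k ih =>
    have h0 : ContDiff ℝ r (ContinuousAlternatingMap.curryLeft (𝕜 := ℝ) (E := E) (F := ℝ)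
        (n := k)) :=
      ContinuousLinearMap.contDiff (𝕜 := ℝ) (E := E [⋀^Fin (k + 1)]→L[ℝ] ℝ)
        (F := E →L[ℝ] E [⋀^Fin k]→L[ℝ] ℝ)
        ContinuousAlternatingMap.curryLeftLI.toContinuousLinearMap
    have h1 : ContDiffAt ℝ r (fun y ↦ ContinuousAlternatingMap.curryLeft (α y)) x :=
      h0.contDiffAt.comp x hα
    have h2 := ih (h1.clm_apply (hv 0)) (fun i ↦ hv i.succ)
    refine h2.congr_of_eventuallyEq (Filter.Eventually.of_forall fun y ↦ ?_)
    simp only [ContinuousAlternatingMap.curryLeft_apply_apply]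
    congr 1
    funext i
    refine Fin.cases ?_ (fun j ↦ ?_) i <;> simp

lemma contDiffAt_clm_of_forall_apply {F : Type*} [NormedAddCommGroup F] [NormedSpace ℝ F]
    [FiniteDimensional ℝ E] {f : G → E →L[ℝ] F} {x : G}
    (h : ∀ v, ContDiffAt ℝ r (fun y ↦ f y v) x) : ContDiffAt ℝ r f x := by
  let e := (ContinuousLinearEquiv.ofFinrankEq (𝕜 := ℝ) (E := E)
    (F := Fin (Module.finrank ℝ E) → ℝ) (by simp)).arrowCongr (1 : F ≃L[ℝ] F)
  let e' := e.trans (ContinuousLinearEquiv.piRing (𝕜 := ℝ) (Fin (Module.finrank ℝ E)))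
  rw [← Function.id_comp f, ← e'.symm_comp_self]
  exact e'.symm.contDiff.contDiffAt.comp x (contDiffAt_pi.2 fun i ↦ h _)

/-- In finite dimension a form is determined linearly by its values on fixed vectors. This is the
criterion by which smoothness of forms is checked below. -/
lemma contDiffAt_alternating_iff [FiniteDimensional ℝ E] {α : G → E [⋀^Fin k]→L[ℝ] ℝ} {x : G} :
    ContDiffAt ℝ r α x ↔ ∀ v : Fin k → E, ContDiffAt ℝ r (fun y ↦ α y v) x := by
  refine ⟨fun h v ↦ contDiffAt_alternating_apply h fun _ ↦ contDiffAt_const, fun h ↦ ?_⟩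
  induction k with
  | zero =>
    have h1 : α = fun y ↦
        (ContinuousAlternatingMap.constOfIsEmptyLIE ℝ E ℝ (Fin 0)) (α y Fin.elim0) := by
      funext y
      ext v
      exact congrArg (α y) (Subsingleton.elim _ _)
    rw [h1]
    exact (LinearIsometryEquiv.contDiff _).contDiffAt.comp x (h _)
  | succ k ih =>
    -- Alternatizing the curried form counts each of the `k + 1` slots once, so it returns `(k + 1)
    -- α`.
    have h1 : α = fun y ↦ ((k + 1 : ℝ)⁻¹) •
        ContinuousAlternatingMap.alternatizeUncurryFinCLM ℝ E ℝ
          (ContinuousAlternatingMap.curryLeft (α y)) := by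
      funext y
      rw [ContinuousAlternatingMap.alternatizeUncurryFinCLM_apply,
        ContinuousAlternatingMap.alternatizeUncurryFin_curryLeft, ← Nat.cast_smul_eq_nsmul ℝ,
        smul_smul]
      push_cast
      rw [inv_mul_cancel₀ (by positivity), one_smul]
    have h0 : ContDiff ℝ r (ContinuousAlternatingMap.alternatizeUncurryFinCLM ℝ E ℝ (n := k)) :=
      ContinuousLinearMap.contDiff (𝕜 := ℝ) (E := E →L[ℝ] E [⋀^Fin k]→L[ℝ] ℝ)
        (F := E [⋀^Fin (k + 1)]→L[ℝ] ℝ) _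
    rw [h1]
    refine ContDiffAt.const_smul _ (h0.contDiffAt.comp x ?_)
    refine contDiffAt_clm_of_forall_apply fun u ↦ ih fun v ↦ ?_
    exact h (Matrix.vecCons u v)

end Alternating

/-! ### Pullbacks and coordinate representations. -/

section Maps

variable {E : Type*} [NormedAddCommGroup E] [NormedSpace ℝ E]
variable {M : Type*} [TopologicalSpace M] [ChartedSpace E M]
variable {E' : Type*} [NormedAddCommGroup E'] [NormedSpace ℝ E']
variable {N : Type*} [TopologicalSpace N] [ChartedSpace E' N]
variable {E'' : Type*} [NormedAddCommGroup E''] [NormedSpace ℝ E'']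
variable {P : Type*} [TopologicalSpace P] [ChartedSpace E'' P]
variable {k : ℕ}

lemma tangentMapAt_comp {g : N → P} {f : M → N} {x : M}
    (hg : MDifferentiableAt 𝓘(ℝ, E') 𝓘(ℝ, E'') g (f x))
    (hf : MDifferentiableAt 𝓘(ℝ, E) 𝓘(ℝ, E') f x) :
    tangentMapAt (E := E) (E' := E'') (g ∘ f) x
      = (tangentMapAt (E := E') (E' := E'') g (f x)).comp (tangentMapAt (E := E) (E' := E') f x) :=
  mfderiv_comp x hg hf

lemma tangentMapAt_congr {f g : M → N} {x : M} (h : f =ᶠ[nhds x] g) :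
    tangentMapAt (E := E) (E' := E') f x = tangentMapAt (E := E) (E' := E') g x :=
  h.mfderiv_eq

lemma tangentMapAt_eq_fderiv {f : E → E'} {x : E} :
    tangentMapAt (E := E) (E' := E') f x = fderiv ℝ f x :=
  mfderiv_eq_fderiv

lemma tangentMapAt_id {x : M} :
    tangentMapAt (E := E) (E' := E) (fun y : M ↦ y) x = ContinuousLinearMap.id ℝ E :=
  mfderiv_id

lemma pull_congr {f g : M → N} {x : M} (h : f =ᶠ[nhds x] g) (η : DForm E' N k) :
    pull (E := E) f η x = pull g η x := by
  simp only [pull, tangentMapAt_congr (E := E) (E' := E') h]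
  rw [h.eq_of_nhds]

lemma pull_pull_apply {g : N → P} {f : M → N} {x : M}
    (hg : MDifferentiableAt 𝓘(ℝ, E') 𝓘(ℝ, E'') g (f x))
    (hf : MDifferentiableAt 𝓘(ℝ, E) 𝓘(ℝ, E') f x) (η : DForm E'' P k) :
    pull (E := E) f (pull (E := E') g η) x = pull (g ∘ f) η x := by
  simp only [pull, tangentMapAt_comp hg hf]
  rfl

lemma pull_of_eventuallyEq_id {f : M → M} {x : M} (h : f =ᶠ[nhds x] fun y ↦ y) (η : DForm E M k) :
    pull (E := E) f η x = η x := by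
  rw [pull_congr h]
  simp only [pull, tangentMapAt_id]
  ext v
  rfl

lemma pull_germ {f : M → N} {x : M} {η θ : DForm E' N k} (h : η (f x) = θ (f x)) :
    pull (E := E) f η x = pull f θ x := by
  simp only [pull, h]

lemma inChart_self (x : E) (η : DForm E E k) : inChart x η = η := by
  funext y
  refine pull_of_eventuallyEq_id (Filter.Eventually.of_forall fun y ↦ ?_) η
  simp only [extChartAt_model_space_eq_id]
  rfl

variable [IsManifold 𝓘(ℝ, E) ∞ M] [IsManifold 𝓘(ℝ, E') ∞ N]

lemma extChartAt_symm_smoothAt (x : M) {z : E} (hz : z ∈ (extChartAt 𝓘(ℝ, E) x).target) :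
    ContMDiffAt 𝓘(ℝ, E) 𝓘(ℝ, E) ∞ (extChartAt 𝓘(ℝ, E) x).symm z :=
  (contMDiffOn_extChartAt_symm x).contMDiffAt (extChartAt_target_mem_nhds' hz)

lemma extChartAt_smoothAt (x : M) {y : M} (hy : y ∈ (extChartAt 𝓘(ℝ, E) x).source) :
    ContMDiffAt 𝓘(ℝ, E) 𝓘(ℝ, E) ∞ (extChartAt 𝓘(ℝ, E) x) y :=
  contMDiffAt_extChartAt' (by rwa [extChartAt_source] at hy)

omit [IsManifold 𝓘(ℝ, E) ∞ M] in
lemma extChartAt_symm_comp_eventuallyEq (x : M) {y : M} (hy : y ∈ (extChartAt 𝓘(ℝ, E) x).source) :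
    (extChartAt 𝓘(ℝ, E) x).symm ∘ extChartAt 𝓘(ℝ, E) x =ᶠ[nhds y] fun y ↦ y := by
  filter_upwards [extChartAt_source_mem_nhds' hy] with w hw
  exact (extChartAt 𝓘(ℝ, E) x).left_inv hw

lemma pull_extChartAt_inChart (x : M) {y : M} (hy : y ∈ (extChartAt 𝓘(ℝ, E) x).source)
    (η : DForm E M k) : pull (extChartAt 𝓘(ℝ, E) x) (inChart x η) y = η y := by
  rw [inChart, pull_pull_apply]
  · exact pull_of_eventuallyEq_id (extChartAt_symm_comp_eventuallyEq x hy) η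
  · exact (extChartAt_symm_smoothAt x ((extChartAt 𝓘(ℝ, E) x).map_source hy)).mdifferentiableAt
      (by simp)
  · exact (extChartAt_smoothAt x hy).mdifferentiableAt (by simp)

/-- The expression of `f` in the preferred charts at `x` and `f x`. -/
def localRep (E E' : Type*) [NormedAddCommGroup E] [NormedSpace ℝ E]
    [NormedAddCommGroup E'] [NormedSpace ℝ E']
    {M : Type*} [TopologicalSpace M] [ChartedSpace E M]
    {N : Type*} [TopologicalSpace N] [ChartedSpace E' N] (f : M → N) (x : M) : E → E' :=
  extChartAt 𝓘(ℝ, E') (f x) ∘ f ∘ (extChartAt 𝓘(ℝ, E) x).symm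

omit [IsManifold 𝓘(ℝ, E) ∞ M] [IsManifold 𝓘(ℝ, E') ∞ N] in
lemma localRep_contDiffAt {f : M → N} {x : M} (hf : ContMDiffAt 𝓘(ℝ, E) 𝓘(ℝ, E') ∞ f x) :
    ContDiffAt ℝ ∞ (localRep E E' f x) (extChartAt 𝓘(ℝ, E) x x) := by
  have h := (contMDiffAt_iff.1 hf).2
  simpa only [localRep, modelWithCornersSelf_coe, Set.range_id, contDiffWithinAt_univ] using h

omit [IsManifold 𝓘(ℝ, E) ∞ M] in
lemma eventually_comp_symm {x : M} {q : M → Prop} (h : ∀ᶠ y in nhds x, q y) :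
    ∀ᶠ z in nhds (extChartAt 𝓘(ℝ, E) x x), z ∈ (extChartAt 𝓘(ℝ, E) x).target ∧
      q ((extChartAt 𝓘(ℝ, E) x).symm z) := by
  refine Filter.Eventually.and (extChartAt_target_mem_nhds x) ?_
  have hc := continuousAt_extChartAt_symm (I := 𝓘(ℝ, E)) x
  rw [ContinuousAt, extChartAt_to_inv] at hc
  exact hc h

/-- Near `x` the map stays in the preferred chart at `f x`, so inserting that chart and its inverse
changes nothing. Global pullback thereby becomes pullback between vector spaces. -/
lemma inChart_pull_eventuallyEq {f : M → N} {x : M} (hf : ContMDiffAt 𝓘(ℝ, E) 𝓘(ℝ, E') ∞ f x)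
    (η : DForm E' N k) :
    inChart x (pull (E := E) f η) =ᶠ[nhds (extChartAt 𝓘(ℝ, E) x x)]
      pull (localRep E E' f x) (inChart (f x) η) := by
  -- Order `∞` at a point gives only each finite order on a neighbourhood; order `1` is enough here.
  have h1 : ∀ᶠ y in nhds x, ContMDiffAt 𝓘(ℝ, E) 𝓘(ℝ, E') 1 f y ∧
      f y ∈ (extChartAt 𝓘(ℝ, E') (f x)).source :=
    ((contMDiffAt_iff_contMDiffAt_nhds (by simp)).1 (hf.of_le (by simp))).and (hf.continuousAt (extChartAt_source_mem_nhds (f x)))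
  filter_upwards [eventually_comp_symm h1] with z hz
  obtain ⟨hz, hfz, hsz⟩ := hz
  have hs := (extChartAt_symm_smoothAt x hz).mdifferentiableAt (by simp)
  have hf' := hfz.mdifferentiableAt (by simp)
  have he := (extChartAt_smoothAt (f x) hsz).mdifferentiableAt (by simp)
  have hs' := (extChartAt_symm_smoothAt (f x)
    ((extChartAt 𝓘(ℝ, E') (f x)).map_source hsz)).mdifferentiableAt (by simp)
  rw [inChart, pull_pull_apply hf' hs, inChart, pull_pull_apply (f := localRep E E' f x) hs' (he.comp z (hf'.comp z hs))]
  refine pull_congr ?_ η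
  have hc : Filter.Tendsto (f ∘ (extChartAt 𝓘(ℝ, E) x).symm) (nhds z)
      (nhds (f ((extChartAt 𝓘(ℝ, E) x).symm z))) := (hf'.comp z hs).continuousAt
  filter_upwards [hc.eventually (extChartAt_symm_comp_eventuallyEq (f x) hsz)] with w hw
  exact hw.symm

end Maps

/-! ### Pointwise smoothness of forms. -/

section Smoothness

variable {E : Type*} [NormedAddCommGroup E] [NormedSpace ℝ E]
variable {M : Type*} [TopologicalSpace M] [ChartedSpace E M] [IsManifold 𝓘(ℝ, E) ∞ M]
variable {E' : Type*} [NormedAddCommGroup E'] [NormedSpace ℝ E']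
variable {N : Type*} [TopologicalSpace N] [ChartedSpace E' N] [IsManifold 𝓘(ℝ, E') ∞ N]
variable {k : ℕ}

/-- Smoothness of a form near a point. -/
def DForm.SmoothAt (η : DForm E M k) (x : M) : Prop :=
  ContDiffAt ℝ ∞ (inChart x η) (extChartAt 𝓘(ℝ, E) x x)

omit [IsManifold 𝓘(ℝ, E) ∞ M] in
lemma DForm.IsSmooth.smoothAt {η : DForm E M k} (h : DForm.IsSmooth η) (x : M) :
    DForm.SmoothAt η x :=
  (h x).contDiffAt (extChartAt_target_mem_nhds x)

omit [IsManifold 𝓘(ℝ, E) ∞ M] in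
lemma DForm.SmoothAt.congr {η θ : DForm E M k} {x : M} (h : DForm.SmoothAt η x)
    (he : θ =ᶠ[nhds x] η) : DForm.SmoothAt θ x := by
  refine ContDiffAt.congr_of_eventuallyEq h ?_
  filter_upwards [eventually_comp_symm he] with z hz
  exact pull_germ hz.2

lemma DForm.SmoothAt.pull [FiniteDimensional ℝ E] {f : M → N} {x : M} {η : DForm E' N k}
    (hη : DForm.SmoothAt η (f x)) (hf : ContMDiffAt 𝓘(ℝ, E) 𝓘(ℝ, E') ∞ f x) :
    DForm.SmoothAt (pull (E := E) f η) x := by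
  refine ContDiffAt.congr_of_eventuallyEq ?_ (inChart_pull_eventuallyEq hf η)
  have hg := localRep_contDiffAt hf
  refine contDiffAt_alternating_iff.2 fun v ↦ ?_
  have hx : localRep E E' f x (extChartAt 𝓘(ℝ, E) x x) = extChartAt 𝓘(ℝ, E') (f x) (f x) := by
    simp [localRep]
  have h1 : ContDiffAt ℝ ∞ (inChart (f x) η ∘ localRep E E' f x) (extChartAt 𝓘(ℝ, E) x x) :=
    ContDiffAt.comp _ (by rw [hx]; exact hη) hg
  have h2 : ContDiffAt ℝ ∞ (fderiv ℝ (localRep E E' f x)) (extChartAt 𝓘(ℝ, E) x x) :=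
    hg.fderiv_right (by simp)
  refine (contDiffAt_alternating_apply h1 fun i ↦
    h2.clm_apply (contDiffAt_const (c := v i))).congr_of_eventuallyEq
      (Filter.Eventually.of_forall fun z ↦ ?_)
  simp only [TorusReduction.pull, tangentMapAt_eq_fderiv]
  rfl

/-- It suffices to test each point in its own preferred chart: pulling back along the inverse of
another chart absorbs the change of coordinates. -/
lemma DForm.isSmooth_iff [FiniteDimensional ℝ E] {η : DForm E M k} :
    DForm.IsSmooth η ↔ ∀ x, DForm.SmoothAt η x := by
  refine ⟨fun h x ↦ h.smoothAt x, fun h x₀ z hz ↦ ContDiffAt.contDiffWithinAt ?_⟩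
  have h1 := (h ((extChartAt 𝓘(ℝ, E) x₀).symm z)).pull (extChartAt_symm_smoothAt x₀ hz)
  rwa [DForm.SmoothAt, inChart_self] at h1

lemma DForm.IsSmooth.pull [FiniteDimensional ℝ E] [FiniteDimensional ℝ E']
    {f : M → N} {η : DForm E' N k}
    (hη : DForm.IsSmooth η) (hf : ContMDiff 𝓘(ℝ, E) 𝓘(ℝ, E') ∞ f) :
    DForm.IsSmooth (pull (E := E) f η) :=
  DForm.isSmooth_iff.2 fun x ↦ (hη.smoothAt (f x)).pull (hf x)

end Smoothness

/-! ### The exterior derivative on a manifold. -/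

section ExteriorDerivative

variable {E : Type*} [NormedAddCommGroup E] [NormedSpace ℝ E]
variable {M : Type*} [TopologicalSpace M] [ChartedSpace E M]
variable {E' : Type*} [NormedAddCommGroup E'] [NormedSpace ℝ E']
variable {N : Type*} [TopologicalSpace N] [ChartedSpace E' N]
variable {k : ℕ}

lemma d_congr {η θ : DForm E M k} {x : M} (h : η =ᶠ[nhds x] θ) : d η x = d θ x := by
  have h1 : inChart x η =ᶠ[nhds (extChartAt 𝓘(ℝ, E) x x)] inChart x θ := by
    filter_upwards [eventually_comp_symm h] with z hz
    exact pull_germ hz.2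
  simp only [d, pull, h1.extDeriv_eq]

lemma d_model (η : DForm E E k) (x : E) : d η x = extDeriv η x := by
  simp only [d, inChart_self]
  refine pull_of_eventuallyEq_id (Filter.Eventually.of_forall fun y ↦ ?_) _
  simp only [extChartAt_model_space_eq_id]
  rfl

lemma inChart_add (x : M) (η θ : DForm E M k) :
    inChart x (η + θ) = inChart x η + inChart x θ := rfl

lemma inChart_smul (x : M) (c : ℝ) (η : DForm E M k) :
    inChart x (c • η) = c • inChart x η := rfl

lemma inChart_fmul (x : M) (h : M → ℝ) (η : DForm E M k) :
    inChart x (fmul h η) = fun z ↦ h ((extChartAt 𝓘(ℝ, E) x).symm z) • inChart x η z := rfl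

lemma inChart_ofFun (x : M) (h : M → ℝ) :
    inChart (E := E) x (ofFun h) =
      fun z ↦ ContinuousAlternatingMap.constOfIsEmpty ℝ E (Fin 0)
        (h ((extChartAt 𝓘(ℝ, E) x).symm z)) := rfl

lemma DForm.SmoothAt.differentiableAt {η : DForm E M k} {x : M} (h : DForm.SmoothAt η x) :
    DifferentiableAt ℝ (inChart x η) (extChartAt 𝓘(ℝ, E) x x) :=
  ContDiffAt.differentiableAt h (by simp)

variable [IsManifold 𝓘(ℝ, E) ∞ M] [IsManifold 𝓘(ℝ, E') ∞ N]

lemma tangentMapAt_extChartAt_self (x : M) :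
    tangentMapAt (E := E) (E' := E) (extChartAt 𝓘(ℝ, E) x) x = ContinuousLinearMap.id ℝ E := by
  have : IsManifold 𝓘(ℝ, E) 1 M := IsManifold.of_le (n := ∞) (by simp)
  exact mfderiv_extChartAt_self

/-- The preferred chart at `x` has identity derivative at `x`, so no Jacobian appears. -/
lemma d_apply (η : DForm E M k) (x : M) :
    d η x = extDeriv (inChart x η) (extChartAt 𝓘(ℝ, E) x x) := by
  simp only [d, pull, tangentMapAt_extChartAt_self]
  rfl

lemma inChart_apply_self (η : DForm E M k) (x : M) :
    inChart x η (extChartAt 𝓘(ℝ, E) x x) = η x := by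
  rw [← pull_extChartAt_inChart x (mem_extChartAt_source x) η]
  simp only [pull, tangentMapAt_extChartAt_self]
  rfl

lemma d_add {η θ : DForm E M k} {x : M} (hη : DForm.SmoothAt η x) (hθ : DForm.SmoothAt θ x) :
    d (η + θ) x = d η x + d θ x := by
  simp only [d_apply, inChart_add]
  exact extDeriv_add hη.differentiableAt hθ.differentiableAt

lemma d_smul (c : ℝ) (η : DForm E M k) : d (c • η) = c • d η := by
  funext x
  simp only [d_apply, inChart_smul, Pi.smul_apply]
  exact extDeriv_smul c _

omit [IsManifold 𝓘(ℝ, E) ∞ M] [IsManifold 𝓘(ℝ, E') ∞ N] in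
lemma fderiv_localRep {f : M → N} {x : M} (hf : MDifferentiableAt 𝓘(ℝ, E) 𝓘(ℝ, E') f x) :
    fderiv ℝ (localRep E E' f x) (extChartAt 𝓘(ℝ, E) x x) =
      tangentMapAt (E := E) (E' := E') f x := by
  simp only [tangentMapAt, mfderiv, modelWithCornersSelf_coe, Set.range_id, fderivWithin_univ]
  exact (if_pos hf).symm

/-- The exterior derivative commutes with pullbacks. -/
lemma d_pull {f : M → N} {x : M} {η : DForm E' N k} (hη : DForm.SmoothAt η (f x))
    (hf : ContMDiffAt 𝓘(ℝ, E) 𝓘(ℝ, E') ∞ f x) :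
    d (pull (E := E) f η) x = pull f (d η) x := by
  have hg := localRep_contDiffAt hf
  have hx : localRep E E' f x (extChartAt 𝓘(ℝ, E) x x) = extChartAt 𝓘(ℝ, E') (f x) (f x) := by
    simp [localRep]
  rw [d_apply, (inChart_pull_eventuallyEq hf η).extDeriv_eq]
  have h1 := extDeriv_pullback (hx.symm ▸ hη.differentiableAt) hg
    (by simp only [minSmoothness_of_isRCLikeNormedField]; exact WithTop.coe_le_coe.2 le_top)
  simp only [← tangentMapAt_eq_fderiv] at h1
  refine h1.trans ?_
  rw [hx, ← d_apply, tangentMapAt_eq_fderiv,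
    fderiv_localRep (hf.mdifferentiableAt (by simp))]
  rfl

/-- The definition of `d` changes chart from point to point. Naturality under the inverse of one
chart makes it the flat derivative throughout that chart, which is what smoothness of `d η`
requires. -/
lemma inChart_d {η : DForm E M k} (hη : DForm.IsSmooth η) (x : M) {z : E}
    (hz : z ∈ (extChartAt 𝓘(ℝ, E) x).target) :
    inChart x (d η) z = extDeriv (inChart x η) z := by
  rw [inChart, ← d_pull (hη.smoothAt _) (extChartAt_symm_smoothAt x hz), d_model]
  rfl

lemma DForm.IsSmooth.d {η : DForm E M k} (hη : DForm.IsSmooth η) : DForm.IsSmooth (d η) := by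
  intro x z hz
  have h0 : ContDiff ℝ ∞ (ContinuousAlternatingMap.alternatizeUncurryFinCLM ℝ E ℝ (n := k)) :=
    ContinuousLinearMap.contDiff (𝕜 := ℝ) (E := E →L[ℝ] E [⋀^Fin k]→L[ℝ] ℝ)
      (F := E [⋀^Fin (k + 1)]→L[ℝ] ℝ) _
  have h1 : ContDiffAt ℝ ∞ (fderiv ℝ (inChart x η)) z :=
    ((hη x).contDiffAt (extChartAt_target_mem_nhds' hz)).fderiv_right (by simp)
  refine ((h0.contDiffAt.comp z h1).congr_of_eventuallyEq ?_).contDiffWithinAt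
  filter_upwards [extChartAt_target_mem_nhds' hz] with w hw
  exact inChart_d hη x hw

lemma isSmooth_ofFun [FiniteDimensional ℝ E] {h : M → ℝ} (hh : IsSmoothFun E h) :
    DForm.IsSmooth (ofFun h : DForm E M 0) := by
  intro x z hz
  refine ContDiffAt.contDiffWithinAt (contDiffAt_alternating_iff.2 fun v ↦ ?_)
  exact (hh.contMDiffAt.comp z (extChartAt_symm_smoothAt x hz)).contDiffAt

lemma DForm.IsSmooth.fmul [FiniteDimensional ℝ E] {h : M → ℝ} {η : DForm E M k}
    (hh : IsSmoothFun E h) (hη : DForm.IsSmooth η) : DForm.IsSmooth (fmul h η) := by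
  intro x z hz
  refine ContDiffAt.contDiffWithinAt ?_
  rw [inChart_fmul]
  refine ContDiffAt.fun_smul ?_ ((hη x).contDiffAt (extChartAt_target_mem_nhds' hz))
  exact (hh.contMDiffAt.comp z (extChartAt_symm_smoothAt x hz)).contDiffAt

omit [IsManifold 𝓘(ℝ, E) ∞ M] in
lemma DForm.IsSmooth.neg {η : DForm E M k} (hη : DForm.IsSmooth η) : DForm.IsSmooth (-η) := by
  exact neg_one_smul ℝ η ▸ hη.smul (-1)

omit [IsManifold 𝓘(ℝ, E) ∞ M] in
lemma DForm.IsSmooth.sub {η θ : DForm E M k} (hη : DForm.IsSmooth η) (hθ : DForm.IsSmooth θ) :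
    DForm.IsSmooth (η - θ) := by
  simpa [sub_eq_add_neg] using hη.add hθ.neg

omit [IsManifold 𝓘(ℝ, E) ∞ M] in
lemma DForm.IsSmooth.sum {ι : Type*} {s : Finset ι} {η : ι → DForm E M k}
    (h : ∀ i ∈ s, DForm.IsSmooth (η i)) : DForm.IsSmooth (∑ i ∈ s, η i) :=
  Finset.sum_induction _ DForm.IsSmooth (fun _ _ ↦ DForm.IsSmooth.add) DForm.IsSmooth.zero h

lemma d_sum {ι : Type*} {s : Finset ι} {η : ι → DForm E M k}
    (h : ∀ i, DForm.IsSmooth (η i)) : d (∑ i ∈ s, η i) = ∑ i ∈ s, d (η i) := by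
  classical
  induction s using Finset.induction_on with
  | empty => simpa using d_smul (0 : ℝ) (0 : DForm E M k)
  | insert a s ha ih =>
    rw [Finset.sum_insert ha, Finset.sum_insert ha, ← ih]
    funext x
    exact d_add ((h a).smoothAt x) ((DForm.IsSmooth.sum fun i _ ↦ h i).smoothAt x)

omit [IsManifold 𝓘(ℝ, E) ∞ M] in
lemma tangentMapAt_fun_eq_fderiv {h : M → ℝ} {x : M}
    (hh : MDifferentiableAt 𝓘(ℝ, E) 𝓘(ℝ, ℝ) h x) :
    tangentMapAt (E := E) (E' := ℝ) h x =
      fderiv ℝ (h ∘ (extChartAt 𝓘(ℝ, E) x).symm) (extChartAt 𝓘(ℝ, E) x x) := by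
  rw [← fderiv_localRep hh]
  rfl

lemma d_ofFun_apply {h : M → ℝ} {x : M} (hh : MDifferentiableAt 𝓘(ℝ, E) 𝓘(ℝ, ℝ) h x) (u : Fin 1 → E) :
    d (ofFun h) x u = tangentMapAt (E := E) (E' := ℝ) h x (u 0) := by
  rw [d_apply, inChart_ofFun, extDeriv_constOfIsEmpty, tangentMapAt_fun_eq_fderiv hh]
  rfl

omit [IsManifold 𝓘(ℝ, E) ∞ M] in
lemma tangentMapAt_mul {g h : M → ℝ} {x : M} (hg : MDifferentiableAt 𝓘(ℝ, E) 𝓘(ℝ, ℝ) g x)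
    (hh : MDifferentiableAt 𝓘(ℝ, E) 𝓘(ℝ, ℝ) h x) :
    tangentMapAt (E := E) (E' := ℝ) (g * h) x =
      g x • tangentMapAt (E := E) (E' := ℝ) h x + h x • tangentMapAt (E := E) (E' := ℝ) g x :=
  (hg.hasMFDerivAt.mul hh.hasMFDerivAt).mfderiv

lemma d_ofFun_mul {g h : M → ℝ} (hg : IsSmoothFun E g) (hh : IsSmoothFun E h) :
    d (ofFun (g * h)) = fmul g (d (ofFun h : DForm E M 0)) + fmul h (d (ofFun g)) := by
  funext x
  have hg' := hg.contMDiffAt (x := x).mdifferentiableAt (by simp)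
  have hh' := hh.contMDiffAt (x := x).mdifferentiableAt (by simp)
  ext u
  simp only [fmul, Pi.add_apply, ContinuousAlternatingMap.add_apply,
    ContinuousAlternatingMap.smul_apply, d_ofFun_apply (hg'.mul hh'), d_ofFun_apply hg',
    d_ofFun_apply hh', tangentMapAt_mul hg' hh']
  rfl

lemma d_fmul_apply {h : M → ℝ} {η : DForm E M 1} {x : M}
    (hh : MDifferentiableAt 𝓘(ℝ, E) 𝓘(ℝ, ℝ) h x) (hη : DForm.SmoothAt η x) (u v : E) :
    d (fmul h η) x ![u, v] = h x * d η x ![u, v]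
      + tangentMapAt (E := E) (E' := ℝ) h x u * η x (fun _ ↦ v)
      - tangentMapAt (E := E) (E' := ℝ) h x v * η x (fun _ ↦ u) := by
  have h1 : DifferentiableAt ℝ (fun z ↦ h ((extChartAt 𝓘(ℝ, E) x).symm z))
      (extChartAt 𝓘(ℝ, E) x x) := by
    have := (mdifferentiableAt_iff _ _).1 hh
    rw [modelWithCornersSelf_coe, Set.range_id, differentiableWithinAt_univ] at this
    exact this.2
  rw [d_apply, d_apply, inChart_fmul, extDeriv, extDeriv, fderiv_fun_smul h1 hη.differentiableAt,
    tangentMapAt_fun_eq_fderiv hh, ContinuousAlternatingMap.alternatizeUncurryFin_add,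
    ContinuousAlternatingMap.alternatizeUncurryFin_smul, ← inChart_apply_self η x]
  simp only [ContinuousAlternatingMap.add_apply, ContinuousAlternatingMap.smul_apply,
    ContinuousAlternatingMap.alternatizeUncurryFin_apply]
  rw [Fin.sum_univ_two, Fin.sum_univ_two]
  have e0 : Fin.removeNth 0 ![u, v] = fun _ ↦ v := by
    funext i; fin_cases i; rfl
  have e1 : Fin.removeNth 1 ![u, v] = fun _ ↦ u := by
    funext i; fin_cases i; rfl
  rw [e0, e1, extChartAt_to_inv]
  simp only [ContinuousLinearMap.smulRight_apply, ContinuousAlternatingMap.smul_apply, smul_eq_mul,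
    Fin.val_zero, Fin.val_one, pow_zero, pow_one, Matrix.cons_val_zero, Matrix.cons_val_one,
    Function.comp_def]
  ring

end ExteriorDerivative

/-! ### Vector fields in charts and Cartan's formula. -/

section Fields

variable {E : Type*} [NormedAddCommGroup E] [NormedSpace ℝ E]
variable {M : Type*} [TopologicalSpace M] [ChartedSpace E M]
variable {k : ℕ}

lemma contr_apply (v : VField E M) (η : DForm E M (k + 1)) (x : M) (u : Fin k → E) :
    contr v η x u = η x (Matrix.vecCons (v x : E) u) := rfl

lemma contr_apply_one (v : VField E M) (η : DForm E M 1) (x : M) (u : Fin 0 → E) :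
    contr v η x u = η x (fun _ ↦ v x) := by
  rw [contr_apply]
  congr 1
  funext i
  fin_cases i
  rfl

lemma contr_contr_apply (v w : VField E M) (η : DForm E M 2) (x : M) (u : Fin 0 → E) :
    contr v (contr w η) x u = η x ![w x, v x] := by
  rw [contr_apply, contr_apply, Subsingleton.elim u Matrix.vecEmpty]

/-- The coordinate representation of a vector field in the preferred chart at `x₀`. -/
def fieldInChart (x₀ : M) (v : VField E M) : E → E :=
  fun z ↦ tangentMapAt (E := E) (E' := E) (extChartAt 𝓘(ℝ, E) x₀)
    ((extChartAt 𝓘(ℝ, E) x₀).symm z) (v ((extChartAt 𝓘(ℝ, E) x₀).symm z))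

variable [IsManifold 𝓘(ℝ, E) ∞ M]

/-- Smoothness of a vector field at a point. -/
def VField.SmoothAt (v : VField E M) (x : M) : Prop :=
  ContMDiffAt 𝓘(ℝ, E) 𝓘(ℝ, E).tangent ∞ (fun y ↦ (⟨y, v y⟩ : TangentBundle 𝓘(ℝ, E) M)) x

lemma contMDiffAt_iff_comp_symm {F : Type*} [NormedAddCommGroup F] [NormedSpace ℝ F] {f : M → F}
    {x : M} : ContMDiffAt 𝓘(ℝ, E) 𝓘(ℝ, F) ∞ f x ↔
      ContDiffAt ℝ ∞ (f ∘ (extChartAt 𝓘(ℝ, E) x).symm) (extChartAt 𝓘(ℝ, E) x x) := by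
  constructor
  · intro h
    exact (h.comp_of_eq (extChartAt_symm_smoothAt x (mem_extChartAt_target x))
      (extChartAt_to_inv x)).contDiffAt
  · intro h
    refine (h.contMDiffAt.comp x
      (extChartAt_smoothAt x (mem_extChartAt_source (I := 𝓘(ℝ, E)) x))).congr_of_eventuallyEq ?_
    filter_upwards [extChartAt_symm_comp_eventuallyEq (E := E) x (mem_extChartAt_source x)] with y hy
    exact (congrArg f hy).symm

/-- The tangent bundle trivialisation at `x` is the derivative of the preferred chart at `x`. -/
lemma VField.smoothAt_iff {v : VField E M} {x : M} :
    VField.SmoothAt v x ↔ ContDiffAt ℝ ∞ (fieldInChart x v) (extChartAt 𝓘(ℝ, E) x x) := by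
  have hI : IsManifold 𝓘(ℝ, E) 1 M := IsManifold.of_le (n := ∞) (by simp)
  have h1 : VField.SmoothAt v x ↔ ContMDiffAt 𝓘(ℝ, E) 𝓘(ℝ, E) ∞
      (fun y ↦ tangentMapAt (E := E) (E' := E) (extChartAt 𝓘(ℝ, E) x) y (v y)) x := by
    refine (Bundle.contMDiffAt_section x).trans (Filter.EventuallyEq.contMDiffAt_iff ?_)
    filter_upwards [extChartAt_source_mem_nhds (I := 𝓘(ℝ, E)) x] with y hy
    rw [extChartAt_source] at hy
    rw [tangentMapAt, ← TangentBundle.continuousLinearMapAt_trivializationAt (I := 𝓘(ℝ, E)) hy]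
    refine Eq.symm ?_
    have h2 : y ∈ (trivializationAt E (TangentSpace 𝓘(ℝ, E)) x).baseSet := by simpa using hy
    exact congrFun ((trivializationAt E (TangentSpace 𝓘(ℝ, E)) x).coe_linearMapAt_of_mem (R := ℝ)
      h2) (v y)
  rw [h1, contMDiffAt_iff_comp_symm]
  rfl

lemma fieldInChart_apply_self (v : VField E M) (x : M) :
    fieldInChart x v (extChartAt 𝓘(ℝ, E) x x) = v x := by
  rw [fieldInChart, extChartAt_to_inv, tangentMapAt_extChartAt_self]
  rfl

lemma tangentMapAt_symm_fieldInChart (v : VField E M) (x : M) {z : E}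
    (hz : z ∈ (extChartAt 𝓘(ℝ, E) x).target) :
    tangentMapAt (E := E) (E' := E) (extChartAt 𝓘(ℝ, E) x).symm z (fieldInChart x v z) =
      v ((extChartAt 𝓘(ℝ, E) x).symm z) := by
  have hs : (extChartAt 𝓘(ℝ, E) x).symm z ∈ (extChartAt 𝓘(ℝ, E) x).source :=
    (extChartAt 𝓘(ℝ, E) x).map_target hz
  have h1 := tangentMapAt_comp (E := E) (E' := E) (E'' := E)
    (g := (extChartAt 𝓘(ℝ, E) x).symm) (f := extChartAt 𝓘(ℝ, E) x)
    (x := (extChartAt 𝓘(ℝ, E) x).symm z)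
    (by
      rw [(extChartAt 𝓘(ℝ, E) x).right_inv hz]
      exact (extChartAt_symm_smoothAt x hz).mdifferentiableAt (by simp))
    ((extChartAt_smoothAt x hs).mdifferentiableAt (by simp))
  rw [tangentMapAt_congr (extChartAt_symm_comp_eventuallyEq x hs), tangentMapAt_id,
    (extChartAt 𝓘(ℝ, E) x).right_inv hz] at h1
  exact (DFunLike.congr_fun h1 (v ((extChartAt 𝓘(ℝ, E) x).symm z))).symm

/-- The manifold bracket is defined by pulling fields back along the inverse chart, which agrees
with pushing them along the chart since the two derivatives are mutually inverse. The remaining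
outer derivative is the identity at `x`. -/
lemma mlieBracket_eq_lieBracket (v w : VField E M) (x : M) :
    @Eq E (VectorField.mlieBracket 𝓘(ℝ, E) v w x)
      (VectorField.lieBracket ℝ (fieldInChart x v) (fieldInChart x w)
        (extChartAt 𝓘(ℝ, E) x x)) := by
  have hI : IsManifold 𝓘(ℝ, E) 1 M := IsManifold.of_le (n := ∞) (by simp)
  have h1 : ∀ u : VField E M, VectorField.mpullbackWithin 𝓘(ℝ, E) 𝓘(ℝ, E)
      (extChartAt 𝓘(ℝ, E) x).symm u (Set.range 𝓘(ℝ, E)) =ᶠ[nhds (extChartAt 𝓘(ℝ, E) x x)]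
        fieldInChart x u := by
    intro u
    filter_upwards [extChartAt_target_mem_nhds (I := 𝓘(ℝ, E)) x] with z hz
    have h2 := ContinuousLinearMap.inverse_eq
      (mfderivWithin_extChartAt_symm_comp_mfderiv_extChartAt hz)
      (mfderiv_extChartAt_comp_mfderivWithin_extChartAt_symm hz)
    rw [VectorField.mpullbackWithin_apply, h2]
    rfl
  have h3 : (tangentMapAt (E := E) (E' := E) (extChartAt 𝓘(ℝ, E) x) x).inverse =
      ContinuousLinearMap.id ℝ E := by
    rw [tangentMapAt_extChartAt_self]
    exact ContinuousLinearMap.inverse_id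
  let V : VField E M → E → E := fun u ↦ VectorField.mpullbackWithin 𝓘(ℝ, E) 𝓘(ℝ, E)
      (extChartAt 𝓘(ℝ, E) x).symm u (Set.range 𝓘(ℝ, E))
  have h4 : @Eq E (VectorField.mlieBracket 𝓘(ℝ, E) v w x)
      ((tangentMapAt (E := E) (E' := E) (extChartAt 𝓘(ℝ, E) x) x).inverse
        (VectorField.lieBracketWithin ℝ (V v) (V w)
          ((extChartAt 𝓘(ℝ, E) x).symm ⁻¹' Set.univ ∩ Set.range 𝓘(ℝ, E))
          (extChartAt 𝓘(ℝ, E) x x))) := rfl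
  refine h4.trans ?_
  rw [h3, modelWithCornersSelf_coe, Set.range_id, Set.preimage_univ, Set.inter_univ,
    VectorField.lieBracketWithin_univ]
  exact Filter.EventuallyEq.lieBracket_vectorField_eq (h1 v) (h1 w)

lemma apply_field_comp_symm (η : DForm E M 1) (v : VField E M) (x : M) {z : E}
    (hz : z ∈ (extChartAt 𝓘(ℝ, E) x).target) :
    η ((extChartAt 𝓘(ℝ, E) x).symm z) (fun _ ↦ v ((extChartAt 𝓘(ℝ, E) x).symm z)) =
      inChart x η z (fun _ ↦ fieldInChart x v z) := by
  rw [← tangentMapAt_symm_fieldInChart v x hz]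
  rfl

lemma tangentMapAt_apply_field {η : DForm E M 1} {v : VField E M} {x : M}
    (hη : DForm.SmoothAt η x) (hv : VField.SmoothAt v x) :
    tangentMapAt (E := E) (E' := ℝ) (fun y ↦ η y (fun _ ↦ v y)) x =
      fderiv ℝ (fun z ↦ inChart x η z (fun _ ↦ fieldInChart x v z)) (extChartAt 𝓘(ℝ, E) x x) := by
  have h1 : ((fun y ↦ η y (fun _ ↦ v y)) ∘ (extChartAt 𝓘(ℝ, E) x).symm)
      =ᶠ[nhds (extChartAt 𝓘(ℝ, E) x x)]
        fun z ↦ inChart x η z (fun _ ↦ fieldInChart x v z) := by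
    filter_upwards [extChartAt_target_mem_nhds (I := 𝓘(ℝ, E)) x] with z hz
    exact apply_field_comp_symm η v x hz
  rw [tangentMapAt_fun_eq_fderiv, h1.fderiv_eq]
  refine ContMDiffAt.mdifferentiableAt (n := ∞) (contMDiffAt_iff_comp_symm.2 ?_) (by simp)
  exact (contDiffAt_alternating_apply hη fun _ ↦ VField.smoothAt_iff.1 hv).congr_of_eventuallyEq h1

/-- Cartan's formula for the exterior derivative of a `1`-form. -/
lemma d_apply_fields {η : DForm E M 1} {v w : VField E M} {x : M}
    (hη : DForm.SmoothAt η x) (hv : VField.SmoothAt v x) (hw : VField.SmoothAt w x) :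
    d η x ![v x, w x] =
      tangentMapAt (E := E) (E' := ℝ) (fun y ↦ η y (fun _ ↦ w y)) x (v x)
      - tangentMapAt (E := E) (E' := ℝ) (fun y ↦ η y (fun _ ↦ v y)) x (w x)
      - η x (fun _ ↦ VectorField.mlieBracket 𝓘(ℝ, E) v w x) := by
  have h1 := extDeriv_apply_vectorField (V := ![fieldInChart x v, fieldInChart x w])
    hη.differentiableAt (fun i ↦ by
      fin_cases i
      · exact (VField.smoothAt_iff.1 hv).differentiableAt (by simp)
      · exact (VField.smoothAt_iff.1 hw).differentiableAt (by simp))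
  have e0 : ∀ a b : E, Fin.removeNth 0 ![a, b] = fun _ ↦ b := by
    intro a b; funext i; fin_cases i; rfl
  have e1 : ∀ a b : E, Fin.removeNth 1 ![a, b] = fun _ ↦ a := by
    intro a b; funext i; fin_cases i; rfl
  have e2 : ∀ z, (fun i ↦ ![fieldInChart x v, fieldInChart x w] i z) =
      ![fieldInChart x v z, fieldInChart x w z] := by
    intro z; funext i; fin_cases i <;> rfl
  simp only [e2] at h1
  rw [Fin.sum_univ_two] at h1
  simp only [e0, e1] at h1
  have h2 : Finset.Ici (0 : Fin 1) = {0} := rfl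
  rw [Fin.sum_univ_one, h2, Finset.sum_singleton] at h1
  have e3 : ∀ a b : E, Matrix.vecCons a (Fin.removeNth 0 (fun _ : Fin 1 ↦ b)) = fun _ ↦ a := by
    intro a b; funext i; fin_cases i; rfl
  simp only [e0, e3, Fin.val_zero, Fin.val_one, pow_zero, pow_one, one_smul, neg_one_smul, add_zero,
    Matrix.cons_val_zero, Matrix.cons_val_one, Fin.castSucc_zero, Fin.succ_zero_eq_one,
    ← sub_eq_add_neg] at h1
  rw [tangentMapAt_apply_field hη hv, tangentMapAt_apply_field hη hw, d_apply,
    ← inChart_apply_self η x]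
  rw [← mlieBracket_eq_lieBracket, fieldInChart_apply_self, fieldInChart_apply_self] at h1
  exact h1

end Fields

/-! ### Pointwise algebra of forms. -/

section PointwiseAlgebra

variable {E : Type*} [NormedAddCommGroup E] [NormedSpace ℝ E] {M : Type*} {k : ℕ}

lemma wedge_apply (η : DForm E M k) (θ : DForm E M 1) (x : M) (u : Fin (k + 1) → E) :
    wedge η θ x u =
      (-1) ^ k * ∑ i : Fin (k + 1), (-1) ^ (i : ℕ) * (θ x (fun _ ↦ u i) * η x (i.removeNth u)) := by
  simp only [wedge, ContinuousAlternatingMap.smul_apply, smul_eq_mul,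
    ContinuousAlternatingMap.alternatizeUncurryFin_apply]
  congr 1
  refine Finset.sum_congr rfl fun i _ ↦ ?_
  rw [zsmul_eq_mul]
  push_cast
  rfl

lemma form_sum_apply {ι : Type*} (s : Finset ι) (η : ι → DForm E M k) (x : M) (u : Fin k → E) :
    (∑ i ∈ s, η i) x u = ∑ i ∈ s, η i x u := by
  classical
  induction s using Finset.induction_on with
  | empty => rfl
  | insert a s ha ih => rw [Finset.sum_insert ha, Finset.sum_insert ha, ← ih]; rfl

lemma form_add_apply (η θ : DForm E M k) (x : M) (u : Fin k → E) :
    (η + θ) x u = η x u + θ x u := rfl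

lemma form_sub_apply (η θ : DForm E M k) (x : M) (u : Fin k → E) :
    (η - θ) x u = η x u - θ x u := rfl

lemma form_neg_apply (η : DForm E M k) (x : M) (u : Fin k → E) :
    (-η) x u = -η x u := rfl

lemma form_smul_apply (c : ℝ) (η : DForm E M k) (x : M) (u : Fin k → E) :
    (c • η) x u = c * η x u := rfl

lemma fmul_apply (h : M → ℝ) (η : DForm E M k) (x : M) (u : Fin k → E) :
    fmul h η x u = h x * η x u := rfl

lemma wedge_fmul (h : M → ℝ) (η : DForm E M k) (θ : DForm E M 1) :
    wedge (fmul h η) θ = fmul h (wedge η θ) := by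
  funext x
  ext u
  rw [fmul_apply, wedge_apply, wedge_apply]
  simp only [fmul_apply, Finset.mul_sum]
  exact Finset.sum_congr rfl fun i _ ↦ by ring

lemma wedge_add (η η' : DForm E M k) (θ : DForm E M 1) :
    wedge (η + η') θ = wedge η θ + wedge η' θ := by
  funext x
  ext u
  rw [Pi.add_apply, ContinuousAlternatingMap.add_apply, wedge_apply, wedge_apply, wedge_apply,
    ← mul_add, ← Finset.sum_add_distrib]
  simp only [Pi.add_apply, ContinuousAlternatingMap.add_apply, mul_add]

lemma wedge_smul (c : ℝ) (η : DForm E M k) (θ : DForm E M 1) :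
    wedge (c • η) θ = c • wedge η θ := wedge_fmul (fun _ ↦ c) η θ

lemma wedge_neg (η : DForm E M k) (θ : DForm E M 1) : wedge (-η) θ = -wedge η θ := by
  funext x
  ext u
  simp only [form_neg_apply, wedge_apply, mul_neg, Finset.sum_neg_distrib]

lemma wedge_zero (θ : DForm E M 1) : wedge (0 : DForm E M k) θ = 0 := by
  funext x
  ext u
  rw [wedge_apply]
  simp

lemma wedge_sum {ι : Type*} (s : Finset ι) (η : ι → DForm E M k) (θ : DForm E M 1) :
    wedge (∑ i ∈ s, η i) θ = ∑ i ∈ s, wedge (η i) θ := by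
  classical
  induction s using Finset.induction_on with
  | empty => exact wedge_zero θ
  | insert a s ha ih => rw [Finset.sum_insert ha, Finset.sum_insert ha, wedge_add, ih]

lemma wedge_ofFun (h : M → ℝ) (θ : DForm E M 1) : wedge (ofFun h) θ = fmul h θ := by
  funext x
  ext u
  rw [wedge_apply, fmul_apply, Fin.sum_univ_one]
  have : (fun _ : Fin 1 ↦ u 0) = u := by
    funext i; fin_cases i; rfl
  rw [this]
  simp [ofFun, mul_comm]

end PointwiseAlgebra

/-! ### Contraction of polynomials in the connection forms. -/

section Algebra

variable {E : Type*} [NormedAddCommGroup E] [NormedSpace ℝ E]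
variable {M : Type*} [TopologicalSpace M] [ChartedSpace E M]
variable {E' : Type*} [NormedAddCommGroup E'] [NormedSpace ℝ E']
variable {N : Type*} [TopologicalSpace N] [ChartedSpace E' N]
variable {k n : ℕ}

lemma pull_wedge (f : M → N) (η : DForm E' N k) (θ : DForm E' N 1) :
    pull (E := E) f (wedge η θ) = wedge (pull f η) (pull f θ) := by
  funext x
  ext u
  rw [wedge_apply]
  exact wedge_apply η θ (f x) _

lemma pull_fmul (f : M → N) (h : N → ℝ) (η : DForm E' N k) :
    pull (E := E) f (fmul h η) = fmul (h ∘ f) (pull f η) := rfl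

lemma pull_ofFun (f : M → N) (h : N → ℝ) :
    pull (E := E) f (ofFun h : DForm E' N 0) = ofFun (h ∘ f) := rfl

lemma pull_add (f : M → N) (η θ : DForm E' N k) :
    pull (E := E) f (η + θ) = pull f η + pull f θ := rfl

lemma pull_sub (f : M → N) (η θ : DForm E' N k) :
    pull (E := E) f (η - θ) = pull f η - pull f θ := rfl

lemma pull_smul (f : M → N) (c : ℝ) (η : DForm E' N k) :
    pull (E := E) f (c • η) = c • pull f η := rfl

lemma pull_sum (f : M → N) {ι : Type*} (s : Finset ι) (η : ι → DForm E' N k) :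
    pull (E := E) f (∑ i ∈ s, η i) = ∑ i ∈ s, pull f (η i) := by
  classical
  induction s using Finset.induction_on with
  | empty => rfl
  | insert a s ha ih => rw [Finset.sum_insert ha, Finset.sum_insert ha, pull_add, ih]

lemma contr_add (v : VField E M) (η θ : DForm E M (k + 1)) :
    contr v (η + θ) = contr v η + contr v θ := rfl

lemma contr_sub (v : VField E M) (η θ : DForm E M (k + 1)) :
    contr v (η - θ) = contr v η - contr v θ := rfl

lemma contr_smul (v : VField E M) (c : ℝ) (η : DForm E M (k + 1)) :
    contr v (c • η) = c • contr v η := rfl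

lemma contr_fmul (v : VField E M) (h : M → ℝ) (η : DForm E M (k + 1)) :
    contr v (fmul h η) = fmul h (contr v η) := rfl

lemma contr_zero (v : VField E M) : contr v (0 : DForm E M (k + 1)) = 0 := rfl

lemma contr_sum (v : VField E M) {ι : Type*} (s : Finset ι) (η : ι → DForm E M (k + 1)) :
    contr v (∑ i ∈ s, η i) = ∑ i ∈ s, contr v (η i) := by
  classical
  induction s using Finset.induction_on with
  | empty => rfl
  | insert a s ha ih => rw [Finset.sum_insert ha, Finset.sum_insert ha, contr_add, ih]

lemma contr_contr_swap (v w : VField E M) (η : DForm E M (k + 2)) :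
    contr v (contr w η) = -contr w (contr v η) := by
  funext x
  ext u
  have key : ∀ a b : E, η x (Matrix.vecCons a (Matrix.vecCons b u)) =
      -η x (Matrix.vecCons b (Matrix.vecCons a u)) := by
    intro a b
    have h := (η x).toAlternatingMap.map_swap (v := Matrix.vecCons b (Matrix.vecCons a u))
      (i := 0) (j := 1) (by simp)
    refine Eq.trans (congrArg (η x) ?_) h
    funext i
    refine Fin.cases ?_ (fun i ↦ Fin.cases ?_ (fun i ↦ ?_) i) i
    · simp
    · simp
    · rw [Function.comp_apply, Equiv.swap_apply_of_ne_of_ne]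
      · rfl
      · simp
      · simp [Fin.ext_iff]
  exact key (w x) (v x)

/-- Contraction of a wedge product with a `1`-form. -/
lemma contr_wedge {v : VField E M} {θ : DForm E M 1} {f : M → ℝ} (hf : contr v θ = ofFun f)
    (η : DForm E M (k + 1)) :
    contr v (wedge η θ) = wedge (contr v η) θ + ((-1) ^ (k + 1) : ℝ) • fmul f η := by
  funext x
  ext u
  have h2 : θ x (fun _ ↦ v x) = f x := by
    rw [← contr_apply_one v θ x Fin.elim0, hf]
    rfl
  have key : ∀ a : E, θ x (fun _ ↦ a) = f x → wedge η θ x (Matrix.vecCons a u) =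
      (-1) ^ k * ∑ i : Fin (k + 1), (-1) ^ (i : ℕ) *
        (θ x (fun _ ↦ u i) * η x (Matrix.vecCons a (i.removeNth u)))
      + (-1) ^ (k + 1) * (f x * η x u) := by
    intro a ha
    have h1 : ∀ i : Fin (k + 1), Fin.removeNth i.succ (Matrix.vecCons a u) =
        Matrix.vecCons a (i.removeNth u) := by
      intro i
      funext j
      refine Fin.cases ?_ (fun j ↦ ?_) j <;> simp [Fin.removeNth]
    have h0 : Fin.removeNth 0 (Matrix.vecCons a u) = u := by
      funext j
      simp [Fin.removeNth]
    rw [wedge_apply, Fin.sum_univ_succ]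
    simp only [h1, h0, Matrix.cons_val_zero, Matrix.cons_val_succ, Fin.val_zero,
      Fin.val_succ, pow_zero, one_mul, pow_succ, ha]
    rw [mul_add, add_comm]
    congr 1
    rw [Finset.mul_sum, Finset.mul_sum]
    exact Finset.sum_congr rfl fun i _ ↦ by ring
  rw [form_add_apply, wedge_apply]
  exact key (v x) h2

/-- `A₃ + A₂^I ∧ Θ_I + ½ A₁^{IJ} ∧ Θ_I ∧ Θ_J + ⅙ A₀^{IJK} Θ_I ∧ Θ_J ∧ Θ_K`. -/
def threeForm (Θ : Fin n → DForm E M 1) (A3 : DForm E M 3) (A2 : Fin n → DForm E M 2)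
    (A1 : Fin n → Fin n → DForm E M 1) (A0 : Fin n → Fin n → Fin n → M → ℝ) : DForm E M 3 :=
  A3 + ∑ i, wedge (A2 i) (Θ i) + (1 / 2 : ℝ) • ∑ i, ∑ j, wedge (wedge (A1 i j) (Θ i)) (Θ j)
    + (1 / 6 : ℝ) • ∑ i, ∑ j, ∑ k, wedge (wedge (wedge (ofFun (A0 i j k)) (Θ i)) (Θ j)) (Θ k)

/-- `B₂ + B₁^I ∧ Θ_I + ½ B₀^{IJ} Θ_I ∧ Θ_J`. -/
def twoForm (Θ : Fin n → DForm E M 1) (B2 : DForm E M 2) (B1 : Fin n → DForm E M 1)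
    (B0 : Fin n → Fin n → M → ℝ) : DForm E M 2 :=
  B2 + ∑ i, wedge (B1 i) (Θ i) + (1 / 2 : ℝ) • ∑ i, ∑ j, wedge (wedge (ofFun (B0 i j)) (Θ i)) (Θ j)

/-- `C₁ + C₀^I Θ_I`. -/
def oneForm (Θ : Fin n → DForm E M 1) (C1 : DForm E M 1) (C0 : Fin n → M → ℝ) : DForm E M 1 :=
  C1 + ∑ i, fmul (C0 i) (Θ i)

lemma contr_oneForm {Θ : Fin n → DForm E M 1} {v : VField E M} {f : Fin n → M → ℝ}
    (hf : ∀ i, contr v (Θ i) = ofFun (f i)) (C1 : DForm E M 1) (C0 : Fin n → M → ℝ) :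
    contr v (oneForm Θ C1 C0) = contr v C1 + ofFun (∑ i, C0 i * f i) := by
  rw [oneForm, contr_add, contr_sum]
  congr 1
  funext x
  ext u
  rw [form_sum_apply]
  simp only [contr_fmul, fmul_apply, hf]
  simp [ofFun, Finset.sum_apply]

lemma contr_eq_ofFun (v : VField E M) (θ : DForm E M 1) :
    contr v θ = ofFun (toFun (contr v θ)) := by
  funext x
  ext u
  exact congrArg (contr v θ x) (Subsingleton.elim _ _)

/-- Contracting either factor of `Θ_I ∧ Θ_J` gives the same sum by antisymmetry, and this doubling
cancels the `½`. -/
lemma contr_twoForm {Θ : Fin n → DForm E M 1} {v : VField E M} {f : Fin n → M → ℝ}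
    (hf : ∀ i, contr v (Θ i) = ofFun (f i)) (B2 : DForm E M 2) (B1 : Fin n → DForm E M 1)
    (B0 : Fin n → Fin n → M → ℝ) (hB0 : ∀ i j, B0 i j = -B0 j i) :
    contr v (twoForm Θ B2 B1 B0) = oneForm Θ (contr v B2 - ∑ i, fmul (f i) (B1 i))
      (fun j ↦ toFun (contr v (B1 j)) + ∑ i, f i * B0 i j) := by
  have h1 : ∀ j, wedge (contr v (B1 j)) (Θ j) = fmul (toFun (contr v (B1 j))) (Θ j) := by
    intro j
    rw [← wedge_ofFun, ← contr_eq_ofFun]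
  have hw : ∀ i (η : DForm E M 1), contr v (wedge η (Θ i)) =
      wedge (contr v η) (Θ i) + ((-1) ^ (0 + 1) : ℝ) • fmul (f i) η :=
    fun i ↦ contr_wedge (hf i)
  funext x
  ext u
  simp only [twoForm, oneForm, contr_add, contr_smul, contr_sum, contr_fmul, hw, wedge_ofFun, h1,
    hf, form_add_apply, form_sub_apply, form_sum_apply, form_smul_apply, fmul_apply, wedge_fmul]
  simp only [Pi.add_apply, Finset.sum_apply, Pi.mul_apply, add_mul, mul_add,
    Finset.sum_add_distrib, Finset.sum_mul, pow_one, zero_add]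
  have h2 : ∑ i, ∑ j, B0 i j x * (-1 * (f j x * Θ i x u)) =
      ∑ i, ∑ j, B0 i j x * (f i x * Θ j x u) := by
    rw [Finset.sum_comm]
    refine Finset.sum_congr rfl fun i _ ↦ Finset.sum_congr rfl fun j _ ↦ ?_
    rw [hB0 j i, Pi.neg_apply]
    ring
  have h3 : ∑ j, ∑ i, f i x * B0 i j x * Θ j x u = ∑ i, ∑ j, B0 i j x * (f i x * Θ j x u) := by
    rw [Finset.sum_comm]
    exact Finset.sum_congr rfl fun i _ ↦ Finset.sum_congr rfl fun j _ ↦ by ring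
  rw [h2, h3, Finset.sum_congr rfl fun i _ ↦ neg_one_mul _, Finset.sum_neg_distrib]
  ring

/-- By antisymmetry the three ways of contracting `Θ_I ∧ Θ_J ∧ Θ_K` agree, so `⅙` becomes `½`; the
two ways in the quadratic term turn its `½` into `1`. -/
lemma contr_threeForm {Θ : Fin n → DForm E M 1} {v : VField E M} {f : Fin n → M → ℝ}
    (hf : ∀ i, contr v (Θ i) = ofFun (f i)) (A3 : DForm E M 3) (A2 : Fin n → DForm E M 2)
    (A1 : Fin n → Fin n → DForm E M 1) (A0 : Fin n → Fin n → Fin n → M → ℝ)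
    (hA1 : ∀ i j, A1 i j = -A1 j i) (hA0 : ∀ i j k, A0 i j k = -A0 j i k)
    (hA0' : ∀ i j k, A0 i j k = -A0 i k j) :
    contr v (threeForm Θ A3 A2 A1 A0) = twoForm Θ (contr v A3 + ∑ i, fmul (f i) (A2 i))
      (fun j ↦ contr v (A2 j) - ∑ i, fmul (f i) (A1 i j))
      (fun j k ↦ toFun (contr v (A1 j k)) + ∑ i, f i * A0 i j k) := by
  obtain ⟨c, hc⟩ : ∃ c : Fin n → Fin n → M → ℝ, ∀ i j, contr v (A1 i j) = ofFun (c i j) :=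
    ⟨_, fun i j ↦ contr_eq_ofFun v (A1 i j)⟩
  have hc' : ∀ h : M → ℝ, toFun (E := E) (ofFun h) = h := fun h ↦ rfl
  have hw : ∀ i (η : DForm E M 1), contr v (wedge η (Θ i)) =
      wedge (contr v η) (Θ i) + ((-1) ^ (0 + 1) : ℝ) • fmul (f i) η :=
    fun i ↦ contr_wedge (hf i)
  have hw' : ∀ i (η : DForm E M 2), contr v (wedge η (Θ i)) =
      wedge (contr v η) (Θ i) + ((-1) ^ (1 + 1) : ℝ) • fmul (f i) η :=
    fun i ↦ contr_wedge (hf i)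
  funext x
  ext u
  simp only [threeForm, twoForm, contr_add, contr_smul, contr_sum, contr_fmul, hw, hw', wedge_ofFun,
    wedge_add, wedge_smul, wedge_sum, sub_eq_add_neg, wedge_neg, wedge_fmul,
    hf, hc, hc', form_add_apply, form_neg_apply, form_sum_apply, form_smul_apply, fmul_apply]
  simp only [Pi.add_apply, Finset.sum_apply, Pi.mul_apply, add_mul, mul_add,
    Finset.sum_add_distrib, Finset.sum_mul, zero_add, pow_one, one_add_one_eq_two,
    neg_one_sq, one_mul, neg_one_mul, Finset.sum_neg_distrib, mul_neg]
  have h1 : ∑ i, ∑ j, f j x * wedge (A1 i j) (Θ i) x u =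
      -∑ i, ∑ j, f i x * wedge (A1 i j) (Θ j) x u := by
    rw [Finset.sum_comm, ← Finset.sum_neg_distrib]
    refine Finset.sum_congr rfl fun i _ ↦ ?_
    rw [← Finset.sum_neg_distrib]
    refine Finset.sum_congr rfl fun j _ ↦ ?_
    rw [hA1 j i, wedge_neg, form_neg_apply, mul_neg]
  have h2 : ∑ i, ∑ j, ∑ k, A0 i j k x * (f j x * wedge (Θ i) (Θ k) x u) =
      -∑ i, ∑ j, ∑ k, A0 i j k x * (f i x * wedge (Θ j) (Θ k) x u) := by
    rw [Finset.sum_comm]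
    simp only [← Finset.sum_neg_distrib]
    refine Finset.sum_congr rfl fun i _ ↦ Finset.sum_congr rfl fun j _ ↦
      Finset.sum_congr rfl fun k _ ↦ ?_
    rw [hA0 j i k, Pi.neg_apply, neg_mul]
  -- The relabelling is cyclic, hence even: two transpositions, no sign.
  have h3 : ∑ i, ∑ j, ∑ k, A0 i j k x * (f k x * wedge (Θ i) (Θ j) x u) =
      ∑ i, ∑ j, ∑ k, A0 i j k x * (f i x * wedge (Θ j) (Θ k) x u) := by
    rw [Finset.sum_congr rfl fun i _ ↦ Finset.sum_comm, Finset.sum_comm]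
    refine Finset.sum_congr rfl fun i _ ↦ Finset.sum_congr rfl fun j _ ↦
      Finset.sum_congr rfl fun k _ ↦ ?_
    rw [hA0' j k i, hA0 j i k, neg_neg]
  have h4 : ∑ j, ∑ k, ∑ i, f i x * A0 i j k x * wedge (Θ j) (Θ k) x u =
      ∑ i, ∑ j, ∑ k, A0 i j k x * (f i x * wedge (Θ j) (Θ k) x u) := by
    rw [Finset.sum_congr rfl fun i _ ↦ Finset.sum_comm, Finset.sum_comm]
    exact Finset.sum_congr rfl fun i _ ↦ Finset.sum_congr rfl fun j _ ↦
      Finset.sum_congr rfl fun k _ ↦ by ring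
  have h5 : ∑ j, ∑ i, f i x * wedge (A1 i j) (Θ j) x u =
      ∑ i, ∑ j, f i x * wedge (A1 i j) (Θ j) x u := Finset.sum_comm
  rw [h1, h2, h3, h4, h5]
  ring

end Algebra

/-! ### Smoothness of wedge products, contractions and brackets. -/

section Smoothness

variable {E : Type*} [NormedAddCommGroup E] [NormedSpace ℝ E] [FiniteDimensional ℝ E]
variable {M : Type*} [TopologicalSpace M] [ChartedSpace E M] [IsManifold 𝓘(ℝ, E) ∞ M]
variable {k n : ℕ}

omit [IsManifold 𝓘(ℝ, E) ∞ M] in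
lemma DForm.IsSmooth.wedge {η : DForm E M k} {θ : DForm E M 1} (hη : DForm.IsSmooth η)
    (hθ : DForm.IsSmooth θ) : DForm.IsSmooth (wedge η θ) := by
  intro x z hz
  refine ContDiffAt.contDiffWithinAt (contDiffAt_alternating_iff.2 fun u ↦ ?_)
  simp only [inChart, pull_wedge, wedge_apply]
  have h1 := (hη x).contDiffAt (extChartAt_target_mem_nhds' hz)
  have h2 := (hθ x).contDiffAt (extChartAt_target_mem_nhds' hz)
  refine contDiffAt_const.mul (ContDiffAt.sum fun i _ ↦ contDiffAt_const.mul ?_)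
  exact (contDiffAt_alternating_iff.1 h2 _).mul (contDiffAt_alternating_iff.1 h1 _)

lemma DForm.IsSmooth.contr {η : DForm E M (k + 1)} {v : VField E M} (hη : DForm.IsSmooth η)
    (hv : VField.IsSmooth v) : DForm.IsSmooth (contr v η) := by
  refine DForm.isSmooth_iff.2 fun x ↦ contDiffAt_alternating_iff.2 fun u ↦ ?_
  have h1 : ContDiffAt ℝ ∞ (fun z ↦ inChart x η z
      (fun i ↦ (Matrix.vecCons (fieldInChart x v) (fun j _ ↦ u j) : Fin (k + 1) → E → E) i z))
      (extChartAt 𝓘(ℝ, E) x x) := by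
    refine contDiffAt_alternating_apply (hη.smoothAt x) fun i ↦ ?_
    refine Fin.cases ?_ (fun j ↦ contDiffAt_const) i
    exact VField.smoothAt_iff.1 (hv x)
  refine h1.congr_of_eventuallyEq ?_
  filter_upwards [extChartAt_target_mem_nhds (I := 𝓘(ℝ, E)) x] with z hz
  have h2 := tangentMapAt_symm_fieldInChart v x hz
  have h3 : ∀ a : E, tangentMapAt (E := E) (E' := E) (extChartAt 𝓘(ℝ, E) x).symm z
      (fieldInChart x v z) = a → η ((extChartAt 𝓘(ℝ, E) x).symm z) (Matrix.vecCons a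
        (tangentMapAt (E := E) (E' := E) (extChartAt 𝓘(ℝ, E) x).symm z ∘ u)) =
      inChart x η z (fun i ↦
        (Matrix.vecCons (fieldInChart x v) (fun j _ ↦ u j) : Fin (k + 1) → E → E) i z) := by
    rintro a rfl
    refine congrArg (η ((extChartAt 𝓘(ℝ, E) x).symm z)) (funext fun i ↦ ?_)
    refine Fin.cases rfl (fun j ↦ rfl) i
  exact h3 _ h2

lemma isSmoothFun_toFun {α : DForm E M 0} (hα : DForm.IsSmooth α) : IsSmoothFun E (toFun α) := by
  intro x
  refine contMDiffAt_iff_comp_symm.2 ?_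
  have h := contDiffAt_alternating_iff.1 (hα.smoothAt x) Fin.elim0
  refine h.congr_of_eventuallyEq (Filter.Eventually.of_forall fun z ↦ ?_)
  exact congrArg (α _) (Subsingleton.elim _ _)

lemma VField.IsSmooth.mlieBracket {v w : VField E M} (hv : VField.IsSmooth v)
    (hw : VField.IsSmooth w) : VField.IsSmooth (VectorField.mlieBracket 𝓘(ℝ, E) v w) := by
  have hI : IsManifold 𝓘(ℝ, E) ((⊤ : ℕ∞) + 1) M := inferInstanceAs (IsManifold 𝓘(ℝ, E) ∞ M)
  have hI' : IsManifold 𝓘(ℝ, E) (minSmoothness ℝ 2) M := IsManifold.of_le (n := ∞)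
    (by simp only [minSmoothness_of_isRCLikeNormedField]; exact WithTop.coe_le_coe.2 le_top)
  exact ContDiff.mlieBracket_vectorField (m := ⊤) (n := ⊤) hv hw (by simp)

lemma DForm.IsSmooth.lieForm {v : VField E M} {η : DForm E M (k + 1)} (hv : VField.IsSmooth v)
    (hη : DForm.IsSmooth η) : DForm.IsSmooth (lieForm v η) :=
  (hη.contr hv).d.add (hη.d.contr hv)

end Smoothness

/-! ### Naturality of the Lie bracket. -/

section Related

variable {E : Type*} [NormedAddCommGroup E] [NormedSpace ℝ E]
variable {M : Type*} [TopologicalSpace M] [ChartedSpace E M] [IsManifold 𝓘(ℝ, E) ∞ M]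
variable {E' : Type*} [NormedAddCommGroup E'] [NormedSpace ℝ E'] [FiniteDimensional ℝ E']
variable {X : Type*} [TopologicalSpace X] [ChartedSpace E' X] [IsManifold 𝓘(ℝ, E') ∞ X]
variable {k n : ℕ}

lemma DForm.SmoothAt.apply_field {η : DForm E M 1} {v : VField E M} {x : M}
    (hη : DForm.SmoothAt η x) (hv : VField.SmoothAt v x) :
    ContMDiffAt 𝓘(ℝ, E) 𝓘(ℝ, ℝ) ∞ (fun y ↦ η y (fun _ ↦ v y)) x := by
  refine contMDiffAt_iff_comp_symm.2 ?_
  refine (contDiffAt_alternating_apply hη fun _ ↦ VField.smoothAt_iff.1 hv).congr_of_eventuallyEq ?_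
  filter_upwards [extChartAt_target_mem_nhds (I := 𝓘(ℝ, E)) x] with z hz
  exact apply_field_comp_symm η v x hz

omit [IsManifold 𝓘(ℝ, E) ∞ M] [FiniteDimensional ℝ E'] [IsManifold 𝓘(ℝ, E') ∞ X] in
lemma pull_apply_one (f : X → M) (η : DForm E M 1) (x : X) (u : E') :
    pull (E := E') f η x (fun _ ↦ u) =
      η (f x) (fun _ ↦ tangentMapAt (E := E') (E' := E) f x u) := rfl

/-- The bracket of fields related by `f` is related by `f`. -/
lemma tangentMapAt_mlieBracket [FiniteDimensional ℝ E] {f : X → M} (hf : ContMDiff 𝓘(ℝ, E') 𝓘(ℝ, E) ∞ f)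
    {u₁ u₂ : VField E' X} {v₁ v₂ : VField E M} (hu₁ : VField.IsSmooth u₁)
    (hu₂ : VField.IsSmooth u₂) (hv₁ : VField.IsSmooth v₁) (hv₂ : VField.IsSmooth v₂)
    (h₁ : ∀ x, tangentMapAt (E := E') (E' := E) f x (u₁ x) = v₁ (f x))
    (h₂ : ∀ x, tangentMapAt (E := E') (E' := E) f x (u₂ x) = v₂ (f x)) (x : X) :
    tangentMapAt (E := E') (E' := E) f x (VectorField.mlieBracket 𝓘(ℝ, E') u₁ u₂ x) =
      VectorField.mlieBracket 𝓘(ℝ, E) v₁ v₂ (f x) := by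
  -- Vectors are compared through functionals. Each functional is extended to a `1`-form near `f x`
  -- by the chart, and Cartan's formula is applied to that form and to its pullback: every term but
  -- the bracket term matches by naturality.
  refine (SeparatingDual.eq_iff_forall_dual_eq (R := ℝ) (V := E)).2 fun ℓ ↦ ?_
  let lam : DForm E M 1 := pull (extChartAt 𝓘(ℝ, E) (f x))
    (fun _ ↦ ContinuousAlternatingMap.ofSubsingleton ℝ E ℝ (0 : Fin 1) ℓ : DForm E E 1)
  have hlam : DForm.SmoothAt lam (f x) := by
    refine DForm.SmoothAt.pull ?_ (extChartAt_smoothAt _ (mem_extChartAt_source _))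
    rw [DForm.SmoothAt, inChart_self]
    exact contDiffAt_const
  have hlam' : ∀ a : E, lam (f x) (fun _ ↦ a) = ℓ a := by
    intro a
    simp only [lam]
    rw [pull_apply_one, tangentMapAt_extChartAt_self]
    rfl
  have hp := hlam.pull (hf x)
  have hd := d_pull hlam (hf x)
  have c1 := d_apply_fields hp (hu₁ x) (hu₂ x)
  have c2 := d_apply_fields hlam (hv₁ (f x)) (hv₂ (f x))
  have e : ∀ (v : VField E M) (u : VField E' X), VField.IsSmooth v →
      (∀ x, tangentMapAt (E := E') (E' := E) f x (u x) = v (f x)) →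
      tangentMapAt (E := E') (E' := ℝ) (fun y ↦ pull (E := E') f lam y (fun _ ↦ u y)) x =
      (tangentMapAt (E := E) (E' := ℝ) (fun y ↦ lam y (fun _ ↦ v y)) (f x)).comp
        (tangentMapAt (E := E') (E' := E) f x) := by
    intro v u hv hvu
    have e1 : (fun y ↦ pull (E := E') f lam y (fun _ ↦ u y)) =
        (fun y ↦ lam y (fun _ ↦ v y)) ∘ f := by
      funext y
      refine (pull_apply_one (E' := E') f lam y (u y)).trans ?_
      rw [hvu]
      rfl
    rw [e1]
    exact tangentMapAt_comp ((hlam.apply_field (hv (f x))).mdifferentiableAt (by simp))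
      ((hf x).mdifferentiableAt (by simp))
  rw [hd, e v₁ u₁ hv₁ h₁, e v₂ u₂ hv₂ h₂] at c1
  have e3 : pull (E := E') f (d lam) x ![u₁ x, u₂ x] = d lam (f x) ![v₁ (f x), v₂ (f x)] := by
    refine congrArg (d lam (f x)) ?_
    funext i
    fin_cases i
    · exact h₁ x
    · exact h₂ x
  have e4 : ∀ T : E →L[ℝ] ℝ, T.comp (tangentMapAt (E := E') (E' := E) f x) (u₁ x) = T (v₁ (f x)) :=
    fun T ↦ congrArg T (h₁ x)
  have e5 : ∀ T : E →L[ℝ] ℝ, T.comp (tangentMapAt (E := E') (E' := E) f x) (u₂ x) = T (v₂ (f x)) :=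
    fun T ↦ congrArg T (h₂ x)
  rw [e4, e5] at c1
  have c3 := (e3.symm.trans c1).symm.trans c2
  have c4 := sub_right_injective c3
  exact (hlam' _).symm.trans (c4.trans (hlam' _))

end Related

/-! ### The torus action and its fundamental fields. -/

section Torus

variable {n : ℕ}
variable {E' : Type*} [NormedAddCommGroup E'] [NormedSpace ℝ E']
variable {X : Type*} [TopologicalSpace X] [ChartedSpace E' X]
variable [MulAction (Torus n) X]

/-- The one-parameter subgroup of `𝕋ⁿ` in the direction `i`, with period `1`. -/
def torusLine (n : ℕ) (i : Fin n) (s : ℝ) : Torus n :=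
  Pi.mulSingle i (Circle.exp (2 * Real.pi * s))

lemma torusLine_add (i : Fin n) (s r : ℝ) :
    torusLine n i (s + r) = torusLine n i s * torusLine n i r := by
  rw [torusLine, mul_add, Circle.exp_add, Pi.mulSingle_mul]
  rfl

lemma torusLine_zero (i : Fin n) : torusLine n i 0 = 1 := by
  simp [torusLine]

omit [TopologicalSpace X] in
lemma torusLine_zero_smul (i : Fin n) (x : X) : torusLine n i 0 • x = x := by
  rw [torusLine_zero, one_smul]

lemma contMDiff_torusLine (i : Fin n) :
    ContMDiff 𝓘(ℝ, ℝ) (torusModel n) ∞ (torusLine n i) := by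
  have h1 : ∀ j, ContMDiff 𝓘(ℝ, ℝ) (𝓡 1) ∞ fun s ↦ torusLine n i s j := by
    intro j
    by_cases hj : j = i
    · subst hj
      have : (fun s ↦ torusLine n j s j) = Circle.exp ∘ fun s ↦ 2 * Real.pi * s := by
        funext s
        simp [torusLine]
      rw [this]
      exact contMDiff_circleExp.comp (contDiff_const.mul contDiff_id).contMDiff
    · have : (fun s ↦ torusLine n i s j) = fun _ ↦ 1 := by
        funext s
        simp [torusLine, hj]
      rw [this]
      exact contMDiff_const
  intro s
  rw [contMDiffAt_iff]
  refine ⟨continuousAt_pi.2 fun j ↦ (h1 j).continuous.continuousAt, ?_⟩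
  refine contDiffWithinAt_pi.2 fun j ↦ ?_
  exact (contMDiffAt_iff.1 (h1 j s)).2

lemma contMDiff_smul_const (hact : ContMDiffSMul (torusModel n) 𝓘(ℝ, E') ∞ (Torus n) X)
    (t : Torus n) : ContMDiff 𝓘(ℝ, E') 𝓘(ℝ, E') ∞ (fun y : X ↦ t • y) :=
  ContMDiffSMul.contMDiff_const_smul (I := torusModel n) t

lemma contMDiff_torusLine_smul (hact : ContMDiffSMul (torusModel n) 𝓘(ℝ, E') ∞ (Torus n) X)
    (i : Fin n) (x : X) :
    ContMDiff 𝓘(ℝ, ℝ) 𝓘(ℝ, E') ∞ (fun s : ℝ ↦ torusLine n i s • x) :=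
  (contMDiff_torusLine i).smul contMDiff_const

/-- The torus is commutative, so translation by `t` carries the orbit curve of `x` to that of `t •
x`. -/
lemma invField_fundField (hact : ContMDiffSMul (torusModel n) 𝓘(ℝ, E') ∞ (Torus n) X)
    (i : Fin n) : InvField n (fundField n i : VField E' X) := by
  intro t x
  have h1 := tangentMapAt_comp (E := ℝ) (E' := E') (E'' := E') (g := fun y : X ↦ t • y)
    (f := fun s : ℝ ↦ torusLine n i s • x) (x := (0 : ℝ))
    ((contMDiff_smul_const hact t _).mdifferentiableAt (by simp))
    ((contMDiff_torusLine_smul hact i x 0).mdifferentiableAt (by simp))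
  have h2 : ((fun y : X ↦ t • y) ∘ fun s : ℝ ↦ torusLine n i s • x) =
      fun s : ℝ ↦ torusLine n i s • t • x := by
    funext s
    exact smul_comm _ _ _
  have h3 := DFunLike.congr_fun h1 (1 : ℝ)
  rw [h2, torusLine_zero_smul] at h3
  exact h3.symm

/-- The orbit map `(s, z) ↦ exp(s e_i) • x(z)` read in a chart of the source. -/
def orbitMap (n : ℕ) (i : Fin n) (x : X) [MulAction (Torus n) X] (q : ℝ × E') : X :=
  torusLine n i q.1 • (extChartAt 𝓘(ℝ, E') x).symm q.2

variable [IsManifold 𝓘(ℝ, E') ∞ X]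

lemma orbitMap_smoothAt (hact : ContMDiffSMul (torusModel n) 𝓘(ℝ, E') ∞ (Torus n) X)
    (i : Fin n) (x : X) {q : ℝ × E'} (hq : q.2 ∈ (extChartAt 𝓘(ℝ, E') x).target) :
    ContMDiffAt 𝓘(ℝ, ℝ × E') 𝓘(ℝ, E') ∞ (orbitMap n i x) q := by
  refine ContMDiffAt.smul (I := torusModel n) (I' := 𝓘(ℝ, E')) ?_ ?_
  · exact (contMDiff_torusLine i).contMDiffAt.comp q contDiff_fst.contMDiff.contMDiffAt
  · exact (extChartAt_symm_smoothAt x hq).comp q contDiff_snd.contMDiff.contMDiffAt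

/-- By the homomorphism law, advancing the time from `q.1` is the same as acting from time `0` on
the point already reached. -/
lemma tangentMapAt_orbitMap_fst (hact : ContMDiffSMul (torusModel n) 𝓘(ℝ, E') ∞ (Torus n) X)
    (i : Fin n) (x : X) {q : ℝ × E'} (hq : q.2 ∈ (extChartAt 𝓘(ℝ, E') x).target) :
    tangentMapAt (E := ℝ × E') (E' := E') (orbitMap n i x) q (1, 0) =
      fundField n i (orbitMap n i x q) := by
  let c : ℝ → ℝ × E' := fun s ↦ (q.1 + s, q.2)
  have hc : HasFDerivAt c ((ContinuousLinearMap.inl ℝ ℝ E')) 0 := by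
    have := ((hasFDerivAt_id (𝕜 := ℝ) (0 : ℝ)).const_add q.1).prodMk
      (hasFDerivAt_const (𝕜 := ℝ) q.2 (0 : ℝ))
    exact this
  have hc0 : c 0 = q := by simp [c]
  have h1 := tangentMapAt_comp (E := ℝ) (E' := ℝ × E') (E'' := E') (g := orbitMap n i x)
    (f := c) (x := (0 : ℝ))
    (by rw [hc0]; exact (orbitMap_smoothAt hact i x hq).mdifferentiableAt (by simp))
    hc.differentiableAt.mdifferentiableAt
  have h2 : orbitMap n i x ∘ c = fun s ↦ torusLine n i s • orbitMap n i x q := by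
    funext s
    simp only [orbitMap, c, Function.comp_apply]
    rw [add_comm, torusLine_add, mul_smul]
  have h3 := DFunLike.congr_fun h1 (1 : ℝ)
  rw [h2, hc0, ContinuousLinearMap.comp_apply, tangentMapAt_eq_fderiv (f := c), hc.fderiv] at h3
  exact h3.symm

lemma tangentMapAt_orbitMap_snd (hact : ContMDiffSMul (torusModel n) 𝓘(ℝ, E') ∞ (Torus n) X)
    (i : Fin n) (x : X) {q : ℝ × E'} (hq : q.2 ∈ (extChartAt 𝓘(ℝ, E') x).target) (b : E') :
    tangentMapAt (E := ℝ × E') (E' := E') (orbitMap n i x) q (0, b) =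
      tangentMapAt (E := E') (E' := E') (fun y : X ↦ torusLine n i q.1 • y)
        ((extChartAt 𝓘(ℝ, E') x).symm q.2)
        (tangentMapAt (E := E') (E' := E') (extChartAt 𝓘(ℝ, E') x).symm q.2 b) := by
  let c : E' → ℝ × E' := fun z ↦ (q.1, z)
  have hc : HasFDerivAt c ((ContinuousLinearMap.inr ℝ ℝ E')) q.2 :=
    (hasFDerivAt_const (𝕜 := ℝ) q.1 q.2).prodMk (hasFDerivAt_id q.2)
  have h1 := tangentMapAt_comp (E := E') (E' := ℝ × E') (E'' := E') (g := orbitMap n i x)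
    (f := c) (x := q.2)
    ((orbitMap_smoothAt hact i x hq).mdifferentiableAt (by simp))
    hc.differentiableAt.mdifferentiableAt
  have h2 := tangentMapAt_comp (E := E') (E' := E') (E'' := E')
    (g := fun y : X ↦ torusLine n i q.1 • y)
    (f := (extChartAt 𝓘(ℝ, E') x).symm) (x := q.2)
    ((contMDiff_smul_const hact _ _).mdifferentiableAt (by simp))
    ((extChartAt_symm_smoothAt x hq).mdifferentiableAt (by simp))
  have h3 := DFunLike.congr_fun (h1.symm.trans h2) b
  rw [ContinuousLinearMap.comp_apply, tangentMapAt_eq_fderiv (f := c), hc.fderiv] at h3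
  exact h3

/-- In a chart the field is the `s`-derivative at `s = 0` of the jointly smooth orbit map, and a
partial derivative of a smooth map is smooth. -/
lemma isSmooth_fundField (hact : ContMDiffSMul (torusModel n) 𝓘(ℝ, E') ∞ (Torus n) X)
    (i : Fin n) : VField.IsSmooth (fundField n i : VField E' X) := by
  intro x
  refine VField.smoothAt_iff.2 ?_
  let g : ℝ × E' → E' := extChartAt 𝓘(ℝ, E') x ∘ orbitMap n i x
  have horb : ∀ z : E', orbitMap n i x ((0 : ℝ), z) = (extChartAt 𝓘(ℝ, E') x).symm z := fun z ↦ by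
    rw [orbitMap, torusLine_zero_smul]
  have hE : ∀ z ∈ (extChartAt 𝓘(ℝ, E') x).target,
      ContMDiffAt 𝓘(ℝ, E') 𝓘(ℝ, E') ∞ (extChartAt 𝓘(ℝ, E') x) (orbitMap n i x ((0 : ℝ), z)) := by
    intro z hz
    rw [horb]
    exact extChartAt_smoothAt x ((extChartAt 𝓘(ℝ, E') x).map_target hz)
  have hg : ∀ z ∈ (extChartAt 𝓘(ℝ, E') x).target, ContDiffAt ℝ ∞ g (0, z) := fun z hz ↦
    ((hE z hz).comp _ (orbitMap_smoothAt hact i x hz)).contDiffAt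
  have h1 : ContDiffAt ℝ ∞ (fun z : E' ↦ fderiv ℝ g (0, z) (1, 0)) (extChartAt 𝓘(ℝ, E') x x) := by
    refine ContDiffAt.clm_apply ?_ contDiffAt_const
    exact ((hg _ (mem_extChartAt_target x)).fderiv_right (m := ∞) (by simp)).comp
      (extChartAt 𝓘(ℝ, E') x x) (contDiffAt_const.prodMk contDiffAt_id)
  refine h1.congr_of_eventuallyEq ?_
  filter_upwards [extChartAt_target_mem_nhds (I := 𝓘(ℝ, E')) x] with z hz
  have h2 := tangentMapAt_comp (E := ℝ × E') (E' := E') (E'' := E') (g := extChartAt 𝓘(ℝ, E') x)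
    (f := orbitMap n i x) (x := ((0 : ℝ), z)) ((hE z hz).mdifferentiableAt (by simp))
    ((orbitMap_smoothAt hact i x hz).mdifferentiableAt (by simp))
  have h3 := DFunLike.congr_fun h2 (1, 0)
  rw [ContinuousLinearMap.comp_apply, tangentMapAt_orbitMap_fst hact i x hz,
    tangentMapAt_eq_fderiv] at h3
  rw [horb] at h3
  exact h3.symm

end Torus

/-! ### Horizontality of the curvature. -/

section Connection

variable {n : ℕ}
variable {E' : Type*} [NormedAddCommGroup E'] [NormedSpace ℝ E'] [FiniteDimensional ℝ E']
variable {X : Type*} [TopologicalSpace X] [ChartedSpace E' X] [IsManifold 𝓘(ℝ, E') ∞ X]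
variable [MulAction (Torus n) X] {Θ : Fin n → DForm E' X 1}

omit [FiniteDimensional ℝ E'] [MulAction (Torus n) X] in
lemma tangentMapAt_extChartAt_symm_self (x : X) :
    tangentMapAt (E := E') (E' := E') (extChartAt 𝓘(ℝ, E') x).symm (extChartAt 𝓘(ℝ, E') x x) =
      ContinuousLinearMap.id ℝ E' := by
  ext b
  let v : VField E' X := fun _ ↦ b
  exact (congrArg _ (fieldInChart_apply_self v x).symm).trans
    (tangentMapAt_symm_fieldInChart v x (mem_extChartAt_target x))

omit [FiniteDimensional ℝ E'] in
-- The `ds` coefficient is `Θ_J(K_I) = δ_IJ`. In the remaining directions invariance of `Θ_J` undoes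
-- the translation, so nothing depends on `s`.
lemma pull_orbitMap_connection
    (hact : ContMDiffSMul (torusModel n) 𝓘(ℝ, E') ∞ (Torus n) X) (hΘ : IsConnection Θ)
    (i j : Fin n) (x : X) {q : ℝ × E'} (hq : q.2 ∈ (extChartAt 𝓘(ℝ, E') x).target) :
    pull (E := ℝ × E') (orbitMap n i x) (Θ j) q =
      ContinuousAlternatingMap.ofSubsingleton ℝ (ℝ × E') ℝ (0 : Fin 1)
        ((if i = j then (1 : ℝ) else 0) • ContinuousLinearMap.fst ℝ ℝ E')
      + pull (E := ℝ × E') Prod.snd (inChart x (Θ j)) q := by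
  ext u
  obtain ⟨a, b, rfl⟩ : ∃ (a : ℝ) (b : E'), u = fun _ ↦ (a, b) :=
    ⟨(u 0).1, (u 0).2, by funext i; fin_cases i; rfl⟩
  let L : E' →L[ℝ] ℝ :=
    (ContinuousAlternatingMap.ofSubsingleton ℝ E' ℝ (0 : Fin 1)).symm (Θ j (orbitMap n i x q))
  have h1 : pull (E := ℝ × E') (orbitMap n i x) (Θ j) q (fun _ ↦ (a, b)) =
      L (tangentMapAt (E := ℝ × E') (E' := E') (orbitMap n i x) q (a, b)) := rfl
  have h2 : ((a, b) : ℝ × E') = a • ((1 : ℝ), (0 : E')) + ((0 : ℝ), b) := by simp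
  have h3 : L (fundField n i (orbitMap n i x q)) = if i = j then 1 else 0 :=
    hΘ.vertical i j (orbitMap n i x q)
  have h4 : L (tangentMapAt (E := ℝ × E') (E' := E') (orbitMap n i x) q (0, b)) =
      inChart x (Θ j) q.2 (fun _ ↦ b) := by
    rw [tangentMapAt_orbitMap_snd hact i x hq]
    have h5 := congrFun (hΘ.invariant j (torusLine n i q.1)) ((extChartAt 𝓘(ℝ, E') x).symm q.2)
    exact congrArg (fun α ↦ α fun _ ↦
      tangentMapAt (E := E') (E' := E') (extChartAt 𝓘(ℝ, E') x).symm q.2 b) h5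
  have h6 : pull (E := ℝ × E') Prod.snd (inChart x (Θ j)) q (fun _ ↦ (a, b)) =
      inChart x (Θ j) q.2 (fun _ ↦ b) := by
    simp only [pull, tangentMapAt_eq_fderiv, fderiv_snd]
    rfl
  have h7 : L (tangentMapAt (E := ℝ × E') (E' := E') (orbitMap n i x) q (a, b)) =
      a * (if i = j then 1 else 0) + inChart x (Θ j) q.2 (fun _ ↦ b) := by
    rw [h2, map_add, map_smul, map_add, map_smul, h4, ← h3, tangentMapAt_orbitMap_fst hact i x hq]
    rfl
  rw [h1, h7, ContinuousAlternatingMap.add_apply, h6]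
  exact congrArg (· + _) (mul_comm _ _)

/-- The curvature of a connection is horizontal. -/
lemma d_connection_fundField
    (hact : ContMDiffSMul (torusModel n) 𝓘(ℝ, E') ∞ (Torus n) X) (hΘ : IsConnection Θ)
    (i j : Fin n) (x : X) (b : E') : d (Θ j) x ![fundField n i x, b] = 0 := by
  set q : ℝ × E' := (0, extChartAt 𝓘(ℝ, E') x x) with hqdef
  have hq : q.2 ∈ (extChartAt 𝓘(ℝ, E') x).target := mem_extChartAt_target x
  have hsm := orbitMap_smoothAt hact i x hq
  have hx : orbitMap n i x q = x := by
    simp only [orbitMap, hqdef]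
    rw [torusLine_zero_smul, extChartAt_to_inv]
  have h1 : d (pull (E := ℝ × E') (orbitMap n i x) (Θ j)) q =
      pull (orbitMap n i x) (d (Θ j)) q := d_pull ((hΘ.smooth j).smoothAt _) hsm
  -- This is `δ_IJ ds`, with constant coefficients and hence closed.
  let cst : DForm (ℝ × E') (ℝ × E') 1 :=
    fun _ ↦ ContinuousAlternatingMap.ofSubsingleton ℝ (ℝ × E') ℝ (0 : Fin 1)
        ((if i = j then (1 : ℝ) else 0) • ContinuousLinearMap.fst ℝ ℝ E')
  have hsnd : ContMDiffAt 𝓘(ℝ, ℝ × E') 𝓘(ℝ, E') ∞ (Prod.snd : ℝ × E' → E') q :=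
    contDiff_snd.contMDiff.contMDiffAt
  have hin : DForm.SmoothAt (inChart x (Θ j)) q.2 := by
    rw [DForm.SmoothAt, inChart_self]
    exact (hΘ.smooth j).smoothAt x
  have h2 : d (pull (E := ℝ × E') (orbitMap n i x) (Θ j)) q =
      pull (E := ℝ × E') Prod.snd (d (inChart x (Θ j))) q := by
    rw [← d_pull hin hsnd]
    have h3 : pull (E := ℝ × E') (orbitMap n i x) (Θ j) =ᶠ[nhds q]
        cst + pull (E := ℝ × E') Prod.snd (inChart x (Θ j)) := by
      have : ∀ᶠ r in nhds q, r.2 ∈ (extChartAt 𝓘(ℝ, E') x).target :=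
        (continuous_snd.continuousAt (x := q)).eventually
          (extChartAt_target_mem_nhds (I := 𝓘(ℝ, E')) x)
      filter_upwards [this] with r hr
      exact pull_orbitMap_connection hact hΘ i j x hr
    have hc : DForm.SmoothAt cst q := by
      rw [DForm.SmoothAt, inChart_self]
      exact contDiffAt_const
    rw [d_congr h3, d_add hc (hin.pull hsnd)]
    have h4 : d cst q = 0 := by
      rw [d_model, extDeriv]
      simp only [cst, fderiv_fun_const]
      exact map_zero (ContinuousAlternatingMap.alternatizeUncurryFinCLM ℝ (ℝ × E') ℝ (n := 1))
    rw [h4, zero_add]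
  -- Both expressions for the differential are evaluated on `∂_s` and `b`. The orbit map sends `∂_s`
  -- to the fundamental field, while the projection to the second factor kills it.
  have h5 := congrArg (fun ω' ↦ ω' ![((1 : ℝ), (0 : E')), ((0 : ℝ), b)]) (h1.symm.trans h2)
  have h6 : pull (orbitMap n i x) (d (Θ j)) q ![((1 : ℝ), (0 : E')), ((0 : ℝ), b)] =
      d (Θ j) x ![fundField n i x, b] := by
    have e1 : tangentMapAt (E := ℝ × E') (E' := E') (orbitMap n i x) q (1, 0) =
        fundField n i x := by
      rw [tangentMapAt_orbitMap_fst hact i x hq, hx]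
    have e2 : tangentMapAt (E := ℝ × E') (E' := E') (orbitMap n i x) q (0, b) = b := by
      rw [tangentMapAt_orbitMap_snd hact i x hq]
      simp only [hqdef]
      have e3 : (fun y : X ↦ torusLine n i 0 • y) = fun y ↦ y :=
        funext fun y ↦ torusLine_zero_smul i y
      rw [e3, tangentMapAt_id, tangentMapAt_extChartAt_symm_self]
      rfl
    let w : Fin 2 → E' := fun l ↦ tangentMapAt (E := ℝ × E') (E' := E') (orbitMap n i x) q
      (![((1 : ℝ), (0 : E')), ((0 : ℝ), b)] l)
    refine (congrArg (fun y ↦ d (Θ j) y w) hx).trans (congrArg (d (Θ j) x) ?_)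
    funext l
    fin_cases l
    · exact e1
    · exact e2
  have h7 : pull (E := ℝ × E') Prod.snd (d (inChart x (Θ j))) q
      ![((1 : ℝ), (0 : E')), ((0 : ℝ), b)] = 0 := by
    simp only [pull, tangentMapAt_eq_fderiv, fderiv_snd]
    exact ContinuousAlternatingMap.map_coord_zero (d (inChart x (Θ j)) q.2)
      (m := fun l ↦ (![((1 : ℝ), (0 : E')), ((0 : ℝ), b)] l).2) (0 : Fin 2) rfl
  exact h6.symm.trans (h5.trans h7)

end Connection

/-! ### The splitting of the tangent space. -/

section Bundle

variable {n : ℕ}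
variable {E : Type*} [NormedAddCommGroup E] [NormedSpace ℝ E]
variable {M : Type*} [TopologicalSpace M] [ChartedSpace E M]
variable {E' : Type*} [NormedAddCommGroup E'] [NormedSpace ℝ E']
variable {X : Type*} [TopologicalSpace X] [ChartedSpace E' X]
variable [MulAction (Torus n) X] {p : X → M} {Θ : Fin n → DForm E' X 1}

namespace IsPrincipalTorusBundle

lemma proj_smul (hp : IsPrincipalTorusBundle n E E' p) (t : Torus n) (x : X) :
    p (t • x) = p x := by
  obtain ⟨U, φ, hm, hs, ht, -, -, h⟩ := hp.locally_trivial (p x)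
  have hx : x ∈ φ.target := by rw [ht]; exact hm
  have hy := φ.map_target hx
  rw [hs] at hy
  obtain ⟨h1, h2⟩ := h _ hy.1 (φ.symm x).2
  have h3 := (h _ hy.1 (t * (φ.symm x).2)).1
  rwa [h2 t, Prod.mk.eta, φ.right_inv hx, ← h1, Prod.mk.eta, φ.right_inv hx] at h3

/-- In a common trivialisation the translating element is the quotient of the two torus coordinates.
-/
lemma exists_smul_eq (hp : IsPrincipalTorusBundle n E E' p) {x x' : X} (hxx : p x = p x') :
    ∃ t : Torus n, x' = t • x := by
  obtain ⟨U, φ, hm, hs, ht, -, -, h⟩ := hp.locally_trivial (p x)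
  have hx : x ∈ φ.target := by rw [ht]; exact hm
  have hx' : x' ∈ φ.target := by rw [ht, Set.mem_preimage, ← hxx]; exact hm
  have hy := φ.map_target hx
  have hy' := φ.map_target hx'
  rw [hs] at hy hy'
  have e1 := (h _ hy.1 (φ.symm x).2).1
  have e2 := (h _ hy'.1 (φ.symm x').2).1
  rw [Prod.mk.eta, φ.right_inv hx] at e1
  rw [Prod.mk.eta, φ.right_inv hx'] at e2
  refine ⟨(φ.symm x').2 * (φ.symm x).2⁻¹, ?_⟩
  have e3 := (h _ hy.1 (φ.symm x).2).2 ((φ.symm x').2 * (φ.symm x).2⁻¹)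
  have e4 : (φ.symm x).1 = (φ.symm x').1 := by rw [← e1, ← e2, hxx]
  rw [inv_mul_cancel_right, Prod.mk.eta, φ.right_inv hx, e4, Prod.mk.eta, φ.right_inv hx'] at e3
  exact e3

lemma proj_surjective (hp : IsPrincipalTorusBundle n E E' p) : Function.Surjective p := by
  intro m
  obtain ⟨U, φ, hm, -, -, -, -, h⟩ := hp.locally_trivial m
  exact ⟨φ (m, 1), (h m hm 1).1⟩

/-- Freeze the torus coordinate of `x` in a local trivialisation. -/
lemma exists_local_section (hp : IsPrincipalTorusBundle n E E' p) (x : X) :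
    ∃ σ : M → X, σ (p x) = x ∧
      ∀ᶠ y in nhds (p x), ContMDiffAt 𝓘(ℝ, E) 𝓘(ℝ, E') ∞ σ y ∧ p (σ y) = y := by
  obtain ⟨U, φ, hm, hs, ht, hφ, -, h⟩ := hp.locally_trivial (p x)
  have hx : x ∈ φ.target := by rw [ht]; exact hm
  have hy := φ.map_target hx
  rw [hs] at hy
  have e1 := (h _ hy.1 (φ.symm x).2).1
  rw [Prod.mk.eta, φ.right_inv hx] at e1
  refine ⟨fun y ↦ φ (y, (φ.symm x).2), ?_, ?_⟩
  · simp only [e1, Prod.mk.eta]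
    exact φ.right_inv hx
  · have hU : IsOpen U := by
      have : U = (fun y ↦ (y, (φ.symm x).2)) ⁻¹' φ.source := by
        rw [hs]; ext y; simp
      rw [this]
      exact φ.open_source.preimage (by fun_prop)
    filter_upwards [hU.mem_nhds hm] with y hyU
    refine ⟨?_, (h y hyU _).1⟩
    have hmem : (y, (φ.symm x).2) ∈ φ.source := by rw [hs]; exact ⟨hyU, trivial⟩
    exact (hφ.contMDiffAt (φ.open_source.mem_nhds hmem)).comp y
      (contMDiffAt_id.prodMk contMDiffAt_const)

lemma tangentMapAt_fundField (hp : IsPrincipalTorusBundle n E E' p) (i : Fin n) (x : X) :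
    tangentMapAt (E := E') (E' := E) p x (fundField n i x) = 0 := by
  have h1 := tangentMapAt_comp (E := ℝ) (E' := E') (E'' := E) (g := p)
    (f := fun s : ℝ ↦ torusLine n i s • x) (x := (0 : ℝ))
    ((hp.smooth_proj _).mdifferentiableAt (by simp))
    ((contMDiff_torusLine_smul hp.smooth_action i x 0).mdifferentiableAt (by simp))
  have h2 : (p ∘ fun s : ℝ ↦ torusLine n i s • x) = fun _ ↦ p x := by
    funext s
    exact hp.proj_smul _ _
  have h3 := DFunLike.congr_fun h1 (1 : ℝ)
  rw [h2, torusLine_zero_smul] at h3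
  refine h3.symm.trans ?_
  rw [tangentMapAt, mfderiv_const]
  rfl

variable [FiniteDimensional ℝ E]

/-- The inverse trivialisation has a left-invertible, hence injective, derivative into a space of
dimension `dim E + n`. The opposite inequality comes from surjectivity of `frame`. -/
lemma finrank_le (hp : IsPrincipalTorusBundle n E E' p) (x : X) :
    Module.finrank ℝ E' ≤ Module.finrank ℝ E + n := by
  obtain ⟨U, φ, hm, hs, ht, hφ, hφ', h⟩ := hp.locally_trivial (p x)
  have hx : x ∈ φ.target := by rw [ht]; exact hm
  have h1 := (hφ'.contMDiffAt (φ.open_target.mem_nhds hx)).mdifferentiableAt (by simp)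
  have h2 := (hφ.contMDiffAt (φ.open_source.mem_nhds (φ.map_target hx))).mdifferentiableAt
    (by simp)
  have h3 := mfderiv_comp x h2 h1
  have h4 : φ ∘ φ.symm =ᶠ[nhds x] id := by
    filter_upwards [φ.open_target.mem_nhds hx] with y hy
    exact φ.right_inv hy
  rw [h4.mfderiv_eq, mfderiv_id] at h3
  let A : E' →L[ℝ] E × (Fin n → EuclideanSpace ℝ (Fin 1)) :=
    mfderiv 𝓘(ℝ, E') (𝓘(ℝ, E).prod (torusModel n)) φ.symm x
  have hA : Function.Injective A := by
    intro a b hab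
    have ha := DFunLike.congr_fun h3 a
    have hb := DFunLike.congr_fun h3 b
    refine ha.trans (Eq.trans ?_ hb.symm)
    exact congrArg (mfderiv (𝓘(ℝ, E).prod (torusModel n)) 𝓘(ℝ, E') φ (φ.symm x)) hab
  have h5 := LinearMap.finrank_le_finrank_of_injective (f := A.toLinearMap) hA
  simpa [Module.finrank_pi_fintype] using h5

end IsPrincipalTorusBundle

/-- The map `u ↦ (Dp u, Θ u)`. -/
def frame (E : Type*) [NormedAddCommGroup E] [NormedSpace ℝ E] {M : Type*} [TopologicalSpace M]
    [ChartedSpace E M] (p : X → M) (Θ : Fin n → DForm E' X 1) (x : X) :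
    E' →L[ℝ] E × (Fin n → ℝ) :=
  (tangentMapAt (E := E') (E' := E) p x).prod (ContinuousLinearMap.pi fun i ↦
    (ContinuousAlternatingMap.ofSubsingleton ℝ E' ℝ (0 : Fin 1)).symm (Θ i x))

omit [MulAction (Torus n) X] in
lemma frame_apply (x : X) (u : E') :
    frame E p Θ x u = (tangentMapAt (E := E') (E' := E) p x u, fun i ↦ Θ i x fun _ ↦ u) := rfl

lemma frame_fundField (hp : IsPrincipalTorusBundle n E E' p) (hΘ : IsConnection Θ) (x : X)
    (i : Fin n) : frame E p Θ x (fundField n i x) = (0, Pi.single i 1) := by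
  let K : E' := fundField n i x
  change frame E p Θ x K = _
  rw [frame_apply, hp.tangentMapAt_fundField i x]
  refine Prod.ext rfl (funext fun j ↦ ?_)
  simp only [K, hΘ.vertical, Pi.single_apply, eq_comm]

lemma frame_surjective (hp : IsPrincipalTorusBundle n E E' p) (hΘ : IsConnection Θ) (x : X) :
    Function.Surjective (frame E p Θ x) := by
  rintro ⟨a, c⟩
  obtain ⟨σ, hσx, hσ⟩ := hp.exists_local_section x
  have h1 := tangentMapAt_comp (E := E) (E' := E') (E'' := E) (g := p)
    (f := σ) (x := p x) ((hp.smooth_proj _).mdifferentiableAt (by simp))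
    (hσ.self_of_nhds.1.mdifferentiableAt (by simp))
  have h2 : p ∘ σ =ᶠ[nhds (p x)] fun y ↦ y := hσ.mono fun y hy ↦ hy.2
  rw [tangentMapAt_congr h2, tangentMapAt_id, hσx] at h1
  obtain ⟨b, hb⟩ : ∃ b : E', tangentMapAt (E := E') (E' := E) p x b = a :=
    ⟨_, (DFunLike.congr_fun h1 a).symm⟩
  let K : Fin n → E' := fun i ↦ fundField n i x
  have hK : ∀ i, frame E p Θ x (K i) = (0, Pi.single i 1) := frame_fundField hp hΘ x
  let r : Fin n → ℝ := (frame E p Θ x b).2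
  -- A lift `b` of `a` has connection values `r`; vertical vectors correct them to `c` without
  -- changing the projection.
  refine ⟨b + ∑ i, (c i - r i) • K i, ?_⟩
  simp only [map_add, map_sum, map_smul, hK]
  refine Prod.ext ?_ (funext fun j ↦ ?_)
  · simp [Prod.fst_sum, frame_apply, hb]
  · simp [Prod.snd_sum, r, Finset.sum_apply, Pi.single_apply]

variable [FiniteDimensional ℝ E] [FiniteDimensional ℝ E']

lemma frame_bijective (hp : IsPrincipalTorusBundle n E E' p) (hΘ : IsConnection Θ) (x : X) :
    Function.Bijective (frame E p Θ x) := by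
  have hs := frame_surjective hp hΘ x
  refine ⟨?_, hs⟩
  have h1 : Module.finrank ℝ E' = Module.finrank ℝ (E × (Fin n → ℝ)) := by
    refine le_antisymm (by simpa using hp.finrank_le x) ?_
    exact LinearMap.finrank_le_finrank_of_surjective (f := (frame E p Θ x).toLinearMap) hs
  exact (LinearMap.injective_iff_surjective_of_finrank_eq_finrank
    (f := (frame E p Θ x).toLinearMap) h1).2 hs

end Bundle

/-! ### Alternating forms that factor through a linear map. -/

section LinearAlgebra

variable {V : Type*} [NormedAddCommGroup V] [NormedSpace ℝ V]
variable {W : Type*} [NormedAddCommGroup W] [NormedSpace ℝ W]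

/-- An alternating form killed by contraction with the kernel of `T` depends on its arguments only
through their images under `T`. -/
lemma alternating_eq_of_map_eq {k : ℕ} (T : V →L[ℝ] W) (α : V [⋀^Fin k]→L[ℝ] ℝ)
    (hα : ∀ a (u : Fin k → V) (l : Fin k), T a = 0 → u l = a → α u = 0)
    {u w : Fin k → V} (huw : ∀ l, T (u l) = T (w l)) : α u = α w := by
  induction k with
  | zero => exact congrArg α (Subsingleton.elim _ _)
  | succ k ih =>
    have h1 : ∀ (a : V) (r : Fin k → V), T a = 0 → α (Matrix.vecCons a r) = 0 :=
      fun a r ha ↦ hα a _ 0 ha rfl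
    have h2 : ∀ a b (r : Fin k → V), T a = T b →
        α (Matrix.vecCons a r) = α (Matrix.vecCons b r) := by
      intro a b r hab
      have h3 : α.curryLeft (a - b) r = 0 := h1 (a - b) r (by rw [map_sub, hab, sub_self])
      rw [map_sub, ContinuousAlternatingMap.sub_apply, sub_eq_zero] at h3
      exact h3
    have h4 := ih (α.curryLeft (w 0)) (u := fun l ↦ u l.succ) (w := fun l ↦ w l.succ)
      (fun a r l ha hl ↦ hα a _ l.succ ha hl) (fun l ↦ huw l.succ)
    have h5 : ∀ r : Fin (k + 1) → V, Matrix.vecCons (r 0) (fun l ↦ r l.succ) = r :=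
      fun r ↦ funext fun i ↦ Fin.cases rfl (fun _ ↦ rfl) i
    rw [← h5 u, ← h5 w, h2 _ _ _ (huw 0)]
    exact h4

end LinearAlgebra

/-! ### Invariant forms. -/

section Invariance

variable {n : ℕ}
variable {E' : Type*} [NormedAddCommGroup E'] [NormedSpace ℝ E']
variable {X : Type*} [TopologicalSpace X] [ChartedSpace E' X] [MulAction (Torus n) X] {k : ℕ}

/-- Invariance of a function under the torus. -/
def InvFun (n : ℕ) {X : Type*} [MulAction (Torus n) X] (f : X → ℝ) : Prop :=
  ∀ (t : Torus n) (x : X), f (t • x) = f x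

lemma InvForm.add {η θ : DForm E' X k} (hη : InvForm n η) (hθ : InvForm n θ) :
    InvForm n (η + θ) := fun t ↦ by rw [pull_add, hη t, hθ t]

lemma InvForm.sub {η θ : DForm E' X k} (hη : InvForm n η) (hθ : InvForm n θ) :
    InvForm n (η - θ) := fun t ↦ by rw [pull_sub, hη t, hθ t]

lemma InvForm.smul {η : DForm E' X k} (c : ℝ) (hη : InvForm n η) : InvForm n (c • η) :=
  fun t ↦ by rw [pull_smul, hη t]

lemma InvForm.zero : InvForm n (0 : DForm E' X k) := fun _ ↦ rfl

lemma InvForm.sum {ι : Type*} {s : Finset ι} {η : ι → DForm E' X k}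
    (h : ∀ i ∈ s, InvForm n (η i)) : InvForm n (∑ i ∈ s, η i) :=
  Finset.sum_induction _ (InvForm n) (fun _ _ ↦ InvForm.add) InvForm.zero h

lemma InvForm.wedge {η : DForm E' X k} {θ : DForm E' X 1} (hη : InvForm n η)
    (hθ : InvForm n θ) : InvForm n (wedge η θ) := fun t ↦ by rw [pull_wedge, hη t, hθ t]

lemma InvForm.fmul {f : X → ℝ} {η : DForm E' X k} (hf : InvFun n f) (hη : InvForm n η) :
    InvForm n (fmul f η) := fun t ↦ by
  rw [pull_fmul, hη t]
  exact congrArg (TorusReduction.fmul · η) (funext (hf t))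

lemma InvForm.contr {v : VField E' X} {η : DForm E' X (k + 1)} (hv : InvField n v)
    (hη : InvForm n η) : InvForm n (contr v η) := fun t ↦ by
  funext x
  ext u
  refine Eq.trans ?_ (congrArg (fun α ↦ α (Matrix.vecCons (v x : E') u)) (congrFun (hη t) x))
  refine congrArg (η (t • x)) (funext fun i ↦ ?_)
  exact Fin.cases (hv t x).symm (fun _ ↦ rfl) i

lemma InvForm.toFun {α : DForm E' X 0} (hα : InvForm n α) : InvFun n (toFun α) := fun t x ↦ by
  have h := congrArg (fun β ↦ β Fin.elim0) (congrFun (hα t) x)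
  exact (congrArg (α (t • x)) (Subsingleton.elim _ _)).trans h

lemma InvForm.d [FiniteDimensional ℝ E'] [IsManifold 𝓘(ℝ, E') ∞ X]
    (hact : ContMDiffSMul (torusModel n) 𝓘(ℝ, E') ∞ (Torus n) X) {η : DForm E' X k}
    (hs : DForm.IsSmooth η) (hη : InvForm n η) : InvForm n (d η) := fun t ↦ by
  funext x
  rw [← d_pull (hs.smoothAt _) (contMDiff_smul_const hact t x), hη t]

end Invariance

/-! ### Descent of functions and horizontal forms. -/

section Descent

variable {n : ℕ}
variable {E : Type*} [NormedAddCommGroup E] [NormedSpace ℝ E]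
variable {M : Type*} [TopologicalSpace M] [ChartedSpace E M]
variable {E' : Type*} [NormedAddCommGroup E'] [NormedSpace ℝ E']
variable {X : Type*} [TopologicalSpace X] [ChartedSpace E' X]
variable [MulAction (Torus n) X] {p : X → M} {Θ : Fin n → DForm E' X 1} {k : ℕ}

namespace IsPrincipalTorusBundle

lemma tangentMapAt_surjective (hp : IsPrincipalTorusBundle n E E' p) (x : X) :
    Function.Surjective (tangentMapAt (E := E') (E' := E) p x) := by
  intro a
  obtain ⟨σ, hσx, hσ⟩ := hp.exists_local_section x
  have h1 := tangentMapAt_comp (E := E) (E' := E') (E'' := E) (g := p)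
    (f := σ) (x := p x) ((hp.smooth_proj _).mdifferentiableAt (by simp))
    (hσ.self_of_nhds.1.mdifferentiableAt (by simp))
  have h2 : p ∘ σ =ᶠ[nhds (p x)] fun y ↦ y := hσ.mono fun y hy ↦ hy.2
  rw [tangentMapAt_congr h2, tangentMapAt_id, hσx] at h1
  exact ⟨_, (DFunLike.congr_fun h1 a).symm⟩

lemma tangentMapAt_smul (hp : IsPrincipalTorusBundle n E E' p) (t : Torus n) (x : X) (u : E') :
    tangentMapAt (E := E') (E' := E) p (t • x)
      (tangentMapAt (E := E') (E' := E') (fun y : X ↦ t • y) x u) =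
      tangentMapAt (E := E') (E' := E) p x u := by
  have h1 := tangentMapAt_comp (E := E') (E' := E') (E'' := E) (g := p)
    (f := fun y : X ↦ t • y) (x := x)
    ((hp.smooth_proj _).mdifferentiableAt (by simp))
    ((contMDiff_smul_const hp.smooth_action t x).mdifferentiableAt (by simp))
  have h2 : (p ∘ fun y : X ↦ t • y) = p := funext fun y ↦ hp.proj_smul t y
  rw [h2] at h1
  exact (DFunLike.congr_fun h1 u).symm

/-- Both `p` and its derivative are surjective, so every value of a form on `M` is seen on `X`. -/
lemma pull_injective (hp : IsPrincipalTorusBundle n E E' p) {ζ ζ' : DForm E M k}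
    (h : pull (E := E') p ζ = pull p ζ') : ζ = ζ' := by
  funext m
  obtain ⟨x, rfl⟩ := hp.proj_surjective m
  ext u
  choose w hw using fun l ↦ hp.tangentMapAt_surjective x (u l)
  have h1 := congrArg (fun α ↦ α w) (congrFun h x)
  have h2 : (fun l ↦ tangentMapAt (E := E') (E' := E) p x (w l)) = u := funext hw
  rw [← h2]
  exact h1

lemma isSmoothFun_of_comp [IsManifold 𝓘(ℝ, E) ∞ M] (hp : IsPrincipalTorusBundle n E E' p)
    {h : M → ℝ} (hh : IsSmoothFun E' (h ∘ p)) : IsSmoothFun E h := by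
  intro m
  obtain ⟨x, rfl⟩ := hp.proj_surjective m
  obtain ⟨σ, -, hσ⟩ := hp.exists_local_section x
  refine ContMDiffAt.congr_of_eventuallyEq
    ((hh (σ (p x))).comp (p x) hσ.self_of_nhds.1) ?_
  filter_upwards [hσ] with y hy
  exact (congrArg h hy.2).symm

variable [FiniteDimensional ℝ E] [IsManifold 𝓘(ℝ, E) ∞ M] [IsManifold 𝓘(ℝ, E') ∞ X]

/-- Locally `ζ = σ^* p^* ζ` for a smooth section `σ`. -/
lemma isSmooth_of_pull (hp : IsPrincipalTorusBundle n E E' p) {ζ : DForm E M k}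
    (h : DForm.IsSmooth (pull (E := E') p ζ)) : DForm.IsSmooth ζ := by
  refine DForm.isSmooth_iff.2 fun m ↦ ?_
  obtain ⟨x, rfl⟩ := hp.proj_surjective m
  obtain ⟨σ, -, hσ⟩ := hp.exists_local_section x
  refine ((h.smoothAt (σ (p x))).pull hσ.self_of_nhds.1).congr ?_
  filter_upwards [eventually_eventually_nhds.2 hσ] with y hy
  rw [pull_pull_apply ((hp.smooth_proj _).mdifferentiableAt (by simp))
    (hy.self_of_nhds.1.mdifferentiableAt (by simp))]
  exact (pull_of_eventuallyEq_id (hy.mono fun z hz ↦ hz.2) ζ).symm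

end IsPrincipalTorusBundle

/-- An arbitrary choice of point in each fibre defines the function; invariance makes the choice
immaterial, and smoothness is recovered afterwards from local sections. -/
lemma exists_fun_descent [IsManifold 𝓘(ℝ, E) ∞ M] (hp : IsPrincipalTorusBundle n E E' p)
    {f : X → ℝ} (hs : IsSmoothFun E' f) (hf : InvFun n f) :
    ∃ h : M → ℝ, IsSmoothFun E h ∧ ∀ x, h (p x) = f x := by
  let s := Function.surjInv hp.proj_surjective
  have h1 : ∀ x, f (s (p x)) = f x := by
    intro x
    obtain ⟨t, ht⟩ := hp.exists_smul_eq
      (Function.surjInv_eq hp.proj_surjective (p x) : p (s (p x)) = p x)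
    exact (hf t (s (p x))).symm.trans (congrArg f ht.symm)
  refine ⟨fun m ↦ f (s m), hp.isSmoothFun_of_comp ?_, h1⟩
  have : (fun m ↦ f (s m)) ∘ p = f := funext h1
  rwa [this]

variable [FiniteDimensional ℝ E] [FiniteDimensional ℝ E']

lemma eq_sum_fundField (hp : IsPrincipalTorusBundle n E E' p) (hΘ : IsConnection Θ) {x : X}
    {a : E'} (ha : tangentMapAt (E := E') (E' := E) p x a = 0) :
    a = ∑ i, Θ i x (fun _ ↦ a) • (fundField n i x : E') := by
  refine (frame_bijective hp hΘ x).1 ?_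
  let K : Fin n → E' := fun i ↦ fundField n i x
  have hK : ∀ i, frame E p Θ x (K i) = (0, Pi.single i 1) := frame_fundField hp hΘ x
  change _ = frame E p Θ x (∑ i, Θ i x (fun _ ↦ a) • K i)
  simp only [map_sum, map_smul, hK]
  refine Prod.ext ?_ (funext fun j ↦ ?_)
  · simp [Prod.fst_sum, frame_apply, ha]
  · simp [Prod.snd_sum, frame_apply, Finset.sum_apply, Pi.single_apply]

/-- Vertical vectors are combinations of the `K_I`, so the form vanishes as soon as one argument is
vertical and therefore sees only projections to `M`. -/
lemma horizontal_congr (hp : IsPrincipalTorusBundle n E E' p) (hΘ : IsConnection Θ)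
    {η : DForm E' X (k + 1)} (hη : ∀ i, contr (fundField n i) η = 0) {x : X}
    {u w : Fin (k + 1) → E'} (huw : ∀ l, tangentMapAt (E := E') (E' := E) p x (u l) =
      tangentMapAt (E := E') (E' := E) p x (w l)) : η x u = η x w := by
  refine alternating_eq_of_map_eq _ (η x) (fun a r l ha hl ↦ ?_) huw
  have h0 : ∀ r : Fin k → E', η x (Matrix.vecCons a r) = 0 := by
    intro r
    change (η x).curryLeft a r = 0
    have key : ∀ (c : Fin n → ℝ) (K : Fin n → E'), (∀ i, (η x).curryLeft (K i) = 0) →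
        (η x).curryLeft (∑ i, c i • K i) = 0 := by
      intro c K hK
      simp [map_sum, hK]
    have h1 := key (fun i ↦ Θ i x fun _ ↦ a) (fun i ↦ fundField n i x)
      fun i ↦ congrFun (hη i) x
    rw [eq_sum_fundField hp hΘ ha]
    exact DFunLike.congr_fun h1 r
  by_cases h : l = 0
  · subst h
    have h5 : Matrix.vecCons a (fun l ↦ r l.succ) = r :=
      funext fun i ↦ Fin.cases hl.symm (fun _ ↦ rfl) i
    rw [← h5, h0]
  -- A vertical argument in slot `l` is moved to slot `0`, at the cost of a sign.
  · have h6 := (η x).toAlternatingMap.map_swap (v := r) (i := 0) (j := l) (Ne.symm h)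
    have h7 : η x (r ∘ Equiv.swap 0 l) = 0 := by
      have h5 : Matrix.vecCons a (fun l' : Fin k ↦ (r ∘ Equiv.swap 0 l) l'.succ) =
          r ∘ Equiv.swap 0 l :=
        funext fun i ↦ Fin.cases (by simp [hl]) (fun _ ↦ rfl) i
      rw [← h5, h0]
    exact neg_eq_zero.1 (h6.symm.trans h7)

variable [IsManifold 𝓘(ℝ, E) ∞ M] [IsManifold 𝓘(ℝ, E') ∞ X]

/-- Invariant horizontal forms descend to the base. -/
lemma exists_form_descent (hp : IsPrincipalTorusBundle n E E' p) (hΘ : IsConnection Θ)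
    {η : DForm E' X (k + 1)} (hs : DForm.IsSmooth η) (hinv : InvForm n η)
    (hη : ∀ i, contr (fundField n i) η = 0) :
    ∃ ζ : DForm E M (k + 1), DForm.IsSmooth ζ ∧ pull p ζ = η := by
  let s := Function.surjInv hp.proj_surjective
  let L : (x : X) → E' ≃L[ℝ] E × (Fin n → ℝ) := fun x ↦
    (LinearEquiv.ofBijective (frame E p Θ x).toLinearMap
      (frame_bijective hp hΘ x)).toContinuousLinearEquiv
  have hL : ∀ x a, tangentMapAt (E := E') (E' := E) p x ((L x).symm (a, 0)) = a := fun x a ↦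
    congrArg Prod.fst ((L x).apply_symm_apply (a, 0))
  -- Evaluate `η` on horizontal lifts at a chosen point of the fibre. This need not be visibly
  -- smooth: once `p^* ζ = η` is known, `isSmooth_of_pull` applies.
  let ζ : DForm E M (k + 1) := fun m ↦ (η (s m)).compContinuousLinearMap
    ((L (s m)).symm.toContinuousLinearMap.comp (ContinuousLinearMap.inl ℝ E (Fin n → ℝ)))
  have h1 : pull p ζ = η := by
    funext x
    ext u
    have key : ∀ (x₀ y : X) (t : Torus n), y = t • x₀ → ∀ w : Fin (k + 1) → E',
        (∀ l, tangentMapAt (E := E') (E' := E) p x₀ (w l) =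
          tangentMapAt (E := E') (E' := E) p y (u l)) → η x₀ w = η y u := by
      rintro x₀ y t rfl w hw
      have h2 := congrArg (fun α ↦ α w) (congrFun (hinv t) x₀)
      refine h2.symm.trans (horizontal_congr hp hΘ hη fun l ↦ ?_)
      exact (hp.tangentMapAt_smul t x₀ (w l)).trans (hw l)
    obtain ⟨t, ht⟩ := hp.exists_smul_eq
      (Function.surjInv_eq hp.proj_surjective (p x) : p (s (p x)) = p x)
    exact key _ x t ht _ fun l ↦ hL _ _
  exact ⟨ζ, hp.isSmooth_of_pull (h1 ▸ hs), h1⟩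

end Descent

/-! ### Extracting horizontal coefficients by contraction. -/

section HorizontalContraction

variable {E : Type*} [NormedAddCommGroup E] [NormedSpace ℝ E]
variable {M : Type*} [TopologicalSpace M] [ChartedSpace E M]
variable {n : ℕ} {K : Fin n → VField E M} {Θ : Fin n → DForm E M 1}

lemma contr_neg {k : ℕ} (v : VField E M) (η : DForm E M (k + 1)) : contr v (-η) = -contr v η := by
  rw [← neg_one_smul ℝ η, contr_smul, neg_one_smul ℝ (contr v η)]

/-- Fundamental fields see only the `Θ` factors, so contraction reads off coefficients. The sign of
`A1` comes from moving `K_a` past a `1`-form. -/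
lemma contr_threeForm_of_horizontal
    (hK : ∀ i j, contr (K i) (Θ j) = ofFun fun _ ↦ if i = j then 1 else 0)
    {A3 : DForm E M 3} {A2 : Fin n → DForm E M 2} {A1 : Fin n → Fin n → DForm E M 1}
    {A0 : Fin n → Fin n → Fin n → M → ℝ} (h3 : ∀ i, contr (K i) A3 = 0)
    (h2 : ∀ i j, contr (K i) (A2 j) = 0) (h1 : ∀ i j k, contr (K i) (A1 j k) = 0)
    (hA1 : ∀ i j, A1 i j = -A1 j i) (hA0 : ∀ i j k, A0 i j k = -A0 j i k)
    (hA0' : ∀ i j k, A0 i j k = -A0 i k j) (a : Fin n) :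
    contr (K a) (threeForm Θ A3 A2 A1 A0) = twoForm Θ (A2 a) (-A1 a) (A0 a) := by
  rw [contr_threeForm (hK a) A3 A2 A1 A0 hA1 hA0 hA0']
  congr 1
  · funext x
    ext u
    simp only [h3, zero_add, form_sum_apply, fmul_apply]
    simp
  · funext j x
    ext u
    simp only [h2, zero_sub, form_neg_apply, form_sum_apply, fmul_apply]
    simp
  · funext j k x
    simp [h1, toFun, Finset.sum_apply]

lemma contr_twoForm_of_horizontal
    (hK : ∀ i j, contr (K i) (Θ j) = ofFun fun _ ↦ if i = j then 1 else 0)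
    {B2 : DForm E M 2} {B1 : Fin n → DForm E M 1} {B0 : Fin n → Fin n → M → ℝ}
    (h2 : ∀ i, contr (K i) B2 = 0) (h1 : ∀ i j, contr (K i) (B1 j) = 0)
    (hB0 : ∀ i j, B0 i j = -B0 j i) (b : Fin n) :
    contr (K b) (twoForm Θ B2 B1 B0) = oneForm Θ (-B1 b) (B0 b) := by
  rw [contr_twoForm (hK b) B2 B1 B0 hB0]
  congr 1
  · funext x
    ext u
    simp only [h2, zero_sub, form_neg_apply, form_sum_apply, fmul_apply]
    simp
  · funext j x
    simp [h1, toFun, Finset.sum_apply]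

lemma contr_oneForm_of_horizontal
    (hK : ∀ i j, contr (K i) (Θ j) = ofFun fun _ ↦ if i = j then 1 else 0)
    {C1 : DForm E M 1} {C0 : Fin n → M → ℝ} (h1 : ∀ i, contr (K i) C1 = 0) (c : Fin n) :
    contr (K c) (oneForm Θ C1 C0) = ofFun (C0 c) := by
  rw [contr_oneForm (hK c), h1, zero_add]
  congr 1
  funext x
  simp [Finset.sum_apply]

omit [TopologicalSpace M] [ChartedSpace E M] in
lemma threeForm_eq_add (Θ : Fin n → DForm E M 1) (A3 : DForm E M 3) (A2 : Fin n → DForm E M 2)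
    (A1 : Fin n → Fin n → DForm E M 1) (A0 : Fin n → Fin n → Fin n → M → ℝ) :
    threeForm Θ A3 A2 A1 A0 =
      A3 + threeForm Θ 0 A2 0 0 + threeForm Θ 0 0 A1 0 + threeForm Θ 0 0 0 A0 := by
  have h : (ofFun (0 : M → ℝ) : DForm E M 0) = 0 := rfl
  simp only [threeForm, Pi.zero_apply, h, wedge_zero, Finset.sum_const_zero, smul_zero, add_zero,
    zero_add]

omit [TopologicalSpace M] [ChartedSpace E M] in
lemma twoForm_zero_right (Θ : Fin n → DForm E M 1) (B2 : DForm E M 2) :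
    twoForm Θ B2 0 0 = B2 := by
  have h : (ofFun (0 : M → ℝ) : DForm E M 0) = 0 := rfl
  simp only [twoForm, Pi.zero_apply, h, wedge_zero, Finset.sum_const_zero, smul_zero, add_zero]

omit [TopologicalSpace M] [ChartedSpace E M] in
lemma oneForm_zero_right (Θ : Fin n → DForm E M 1) (C1 : DForm E M 1) :
    oneForm Θ C1 0 = C1 := by
  have h : ∀ i, fmul (0 : M → ℝ) (Θ i) = 0 := fun i ↦ funext fun x ↦ zero_smul ℝ (Θ i x)
  simp only [oneForm, Pi.zero_apply, h, Finset.sum_const_zero, add_zero]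

end HorizontalContraction

/-! ### Decomposition of invariant three-forms. -/

section Decomposition

variable {n : ℕ}
variable {E' : Type*} [NormedAddCommGroup E'] [NormedSpace ℝ E'] [FiniteDimensional ℝ E']
variable {X : Type*} [TopologicalSpace X] [ChartedSpace E' X] [IsManifold 𝓘(ℝ, E') ∞ X]
variable [MulAction (Torus n) X] {k : ℕ} {Θ : Fin n → DForm E' X 1}

/-- Smooth invariant forms. -/
def InvSmooth (n : ℕ) [MulAction (Torus n) X] {k : ℕ} (η : DForm E' X k) : Prop :=
  DForm.IsSmooth η ∧ InvForm n η

omit [FiniteDimensional ℝ E'] [IsManifold 𝓘(ℝ, E') ∞ X] in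
lemma InvSmooth.sub {η θ : DForm E' X k} (hη : InvSmooth n η) (hθ : InvSmooth n θ) :
    InvSmooth n (η - θ) := ⟨hη.1.sub hθ.1, hη.2.sub hθ.2⟩

lemma InvSmooth.contr (hact : ContMDiffSMul (torusModel n) 𝓘(ℝ, E') ∞ (Torus n) X)
    {η : DForm E' X (k + 1)} (hη : InvSmooth n η) (i : Fin n) :
    InvSmooth n (contr (fundField n i) η) :=
  ⟨hη.1.contr (isSmooth_fundField hact i), hη.2.contr (invField_fundField hact i)⟩

omit [IsManifold 𝓘(ℝ, E') ∞ X] in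
lemma InvSmooth.wedge (hΘ : IsConnection Θ) {η : DForm E' X k} (hη : InvSmooth n η) (i : Fin n) :
    InvSmooth n (wedge η (Θ i)) :=
  ⟨hη.1.wedge (hΘ.smooth i), hη.2.wedge (hΘ.invariant i)⟩

omit [FiniteDimensional ℝ E'] [IsManifold 𝓘(ℝ, E') ∞ X] in
lemma InvSmooth.sum {ι : Type*} {s : Finset ι} {η : ι → DForm E' X k}
    (h : ∀ i ∈ s, InvSmooth n (η i)) : InvSmooth n (∑ i ∈ s, η i) :=
  Finset.sum_induction _ (InvSmooth n) (fun _ _ h h' ↦ ⟨h.1.add h'.1, h.2.add h'.2⟩)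
    ⟨DForm.IsSmooth.zero, InvForm.zero⟩ h

omit [IsManifold 𝓘(ℝ, E') ∞ X] in
lemma InvSmooth.threeForm (hΘ : IsConnection Θ) {A3 : DForm E' X 3} {A2 : Fin n → DForm E' X 2}
    {A1 : Fin n → Fin n → DForm E' X 1} {A0 : Fin n → Fin n → Fin n → X → ℝ}
    (h3 : InvSmooth n A3) (h2 : ∀ i, InvSmooth n (A2 i)) (h1 : ∀ i j, InvSmooth n (A1 i j))
    (h0 : ∀ i j k, InvSmooth n (ofFun (A0 i j k) : DForm E' X 0)) :
    InvSmooth n (threeForm Θ A3 A2 A1 A0) := by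
  have hadd : ∀ {η θ : DForm E' X 3}, InvSmooth n η → InvSmooth n θ → InvSmooth n (η + θ) :=
    fun h h' ↦ ⟨h.1.add h'.1, h.2.add h'.2⟩
  have hsmul : ∀ (c : ℝ) {η : DForm E' X 3}, InvSmooth n η → InvSmooth n (c • η) :=
    fun c _ h ↦ ⟨h.1.smul c, h.2.smul c⟩
  refine hadd (hadd (hadd h3 ?_) (hsmul _ ?_)) (hsmul _ ?_)
  · exact .sum fun i _ ↦ (h2 i).wedge hΘ i
  · exact .sum fun i _ ↦ .sum fun j _ ↦ ((h1 i j).wedge hΘ i).wedge hΘ j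
  · exact .sum fun i _ ↦ .sum fun j _ ↦ .sum fun k _ ↦
      (((h0 i j k).wedge hΘ i).wedge hΘ j).wedge hΘ k

omit [FiniteDimensional ℝ E'] [IsManifold 𝓘(ℝ, E') ∞ X] in
lemma IsConnection.contr_fundField (hΘ : IsConnection Θ) (i j : Fin n) :
    contr (fundField n i) (Θ j) = ofFun fun _ ↦ if i = j then 1 else 0 := by
  rw [contr_eq_ofFun]
  congr 1
  funext x
  rw [toFun, contr_apply_one]
  exact hΘ.vertical i j x

/-- An invariant `3`-form is a polynomial in the connection with horizontal coefficients. -/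
lemma exists_threeForm_eq (hact : ContMDiffSMul (torusModel n) 𝓘(ℝ, E') ∞ (Torus n) X)
    (hΘ : IsConnection Θ) {H : DForm E' X 3} (hH : InvSmooth n H) :
    ∃ (A3 : DForm E' X 3) (A2 : Fin n → DForm E' X 2) (A1 : Fin n → Fin n → DForm E' X 1)
      (A0 : Fin n → Fin n → Fin n → X → ℝ),
      (InvSmooth n A3 ∧ ∀ i, contr (fundField n i) A3 = 0) ∧
      (∀ j, InvSmooth n (A2 j) ∧ ∀ i, contr (fundField n i) (A2 j) = 0) ∧
      (∀ j k, InvSmooth n (A1 j k) ∧ ∀ i, contr (fundField n i) (A1 j k) = 0) ∧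
      (∀ i j k, InvSmooth n (ofFun (A0 i j k) : DForm E' X 0)) ∧
      (∀ i j, A1 i j = -A1 j i) ∧ (∀ i j k, A0 i j k = -A0 j i k) ∧
      (∀ i j k, A0 i j k = -A0 i k j) ∧ H = threeForm Θ A3 A2 A1 A0 := by
  let K : Fin n → VField E' X := fundField n
  have hK : ∀ i j, contr (K i) (Θ j) = ofFun fun _ ↦ if i = j then 1 else 0 := hΘ.contr_fundField
  have hz : ∀ k, InvSmooth n (0 : DForm E' X k) := fun k ↦ ⟨DForm.IsSmooth.zero, InvForm.zero⟩
  have hz' : InvSmooth n (ofFun (0 : X → ℝ) : DForm E' X 0) := hz 0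
  have hc : ∀ {k} {η : DForm E' X (k + 1)} (i : Fin n), InvSmooth n η →
      InvSmooth n (contr (K i) η) := fun i h ↦ h.contr hact i
  have hcz : ∀ k (i : Fin n), contr (K i) (0 : DForm E' X (k + 1)) = 0 := fun k i ↦ contr_zero _
  -- Contracting with the first index innermost makes the signs cancel: it returns exactly the
  -- coefficient `A0 i j k`.
  let A0 : Fin n → Fin n → Fin n → X → ℝ := fun i j k ↦
    toFun (contr (K k) (contr (K j) (contr (K i) H)))
  have hA0 : ∀ i j k, ofFun (A0 i j k) = contr (K k) (contr (K j) (contr (K i) H)) :=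
    fun i j k ↦ (contr_eq_ofFun _ _).symm
  have hA0s : ∀ i j k, InvSmooth n (ofFun (A0 i j k) : DForm E' X 0) := fun i j k ↦ by
    rw [hA0]
    exact hc k (hc j (hc i hH))
  have hA0l : ∀ i j k, A0 i j k = -A0 j i k := fun i j k ↦ by
    simp only [A0]
    rw [contr_contr_swap (K j) (K i) H, contr_neg]
    rfl
  have hA0r : ∀ i j k, A0 i j k = -A0 i k j := fun i j k ↦ by
    simp only [A0]
    rw [contr_contr_swap (K k) (K j)]
    rfl
  -- With the cubic part removed all triple contractions vanish, so the double contractions taken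
  -- next are horizontal.
  let H1 := H - threeForm Θ 0 0 0 A0
  have hH1 : InvSmooth n H1 := hH.sub (.threeForm hΘ (hz 3) (fun _ ↦ hz 2) (fun _ _ ↦ hz 1) hA0s)
  let A1 : Fin n → Fin n → DForm E' X 1 := fun i j ↦ contr (K j) (contr (K i) H1)
  have hA1s : ∀ i j, InvSmooth n (A1 i j) := fun i j ↦ hc j (hc i hH1)
  have hA1a : ∀ i j, A1 i j = -A1 j i := fun i j ↦ contr_contr_swap _ _ _
  have hA1h : ∀ i j k, contr (K i) (A1 j k) = 0 := by
    intro i j k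
    simp only [A1, H1, contr_sub]
    rw [contr_threeForm_of_horizontal (A2 := 0) (A1 := 0) hK (hcz 2) (fun i _ ↦ hcz 1 i)
      (fun i _ _ ↦ hcz 0 i) (fun _ _ ↦ neg_zero.symm) hA0l hA0r,
      contr_twoForm_of_horizontal (B2 := (0 : Fin n → DForm E' X 2) j)
        (B1 := -(0 : Fin n → Fin n → DForm E' X 1) j) hK (hcz 1) (fun i _ ↦ by simpa using hcz 0 i) (hA0r j), contr_oneForm_of_horizontal hK
      (fun i ↦ by simpa using hcz 0 i), hA0, sub_self]
  -- Now double contractions vanish as well, which makes the single contractions horizontal.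
  let H2 := H1 - threeForm Θ 0 0 A1 0
  have hH2 : InvSmooth n H2 :=
    hH1.sub (.threeForm hΘ (hz 3) (fun _ ↦ hz 2) hA1s (fun _ _ _ ↦ hz'))
  let A2 : Fin n → DForm E' X 2 := fun i ↦ contr (K i) H2
  have hA2s : ∀ i, InvSmooth n (A2 i) := fun i ↦ hc i hH2
  have hA2h : ∀ i j, contr (K i) (A2 j) = 0 := by
    intro i j
    simp only [A2, H2, contr_sub]
    rw [contr_threeForm_of_horizontal (A2 := 0) (A0 := 0) hK (hcz 2) (fun i _ ↦ hcz 1 i) hA1h hA1a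
      (fun _ _ _ ↦ neg_zero.symm) (fun _ _ _ ↦ neg_zero.symm),
      contr_twoForm_of_horizontal (B2 := (0 : Fin n → DForm E' X 2) j) (B1 := -A1 j)
        (B0 := (0 : Fin n → Fin n → Fin n → X → ℝ) j) hK (hcz 1)
      (fun i k ↦ by rw [Pi.neg_apply, contr_neg, hA1h, neg_zero]) (fun _ _ ↦ neg_zero.symm)]
    simp only [Pi.zero_apply, Pi.neg_apply, neg_neg, A1]
    rw [oneForm_zero_right, sub_self]
  let H3 := H2 - threeForm Θ 0 A2 0 0
  have hH3 : InvSmooth n H3 :=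
    hH2.sub (.threeForm hΘ (hz 3) hA2s (fun _ _ ↦ hz 1) (fun _ _ _ ↦ hz'))
  have hH3h : ∀ i, contr (K i) H3 = 0 := by
    intro i
    simp only [H3, contr_sub]
    rw [contr_threeForm_of_horizontal (A1 := 0) (A0 := 0) hK (hcz 2) hA2h (fun i _ _ ↦ hcz 0 i)
      (fun _ _ ↦ neg_zero.symm) (fun _ _ _ ↦ neg_zero.symm) (fun _ _ _ ↦ neg_zero.symm)]
    simp only [Pi.zero_apply, neg_zero]
    rw [twoForm_zero_right, sub_self]
  refine ⟨H3, A2, A1, A0, ⟨hH3, hH3h⟩, fun j ↦ ⟨hA2s j, fun i ↦ hA2h i j⟩,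
    fun j k ↦ ⟨hA1s j k, fun i ↦ hA1h i j k⟩, hA0s, hA1a, hA0l, hA0r, ?_⟩
  rw [threeForm_eq_add]
  simp only [H3, H2, H1]
  abel

end Decomposition

/-! ### The flux components and the curvature on the base. -/

section FluxDescent

variable {n : ℕ}
variable {E : Type*} [NormedAddCommGroup E] [NormedSpace ℝ E] [FiniteDimensional ℝ E]
variable {M : Type*} [TopologicalSpace M] [ChartedSpace E M] [IsManifold 𝓘(ℝ, E) ∞ M]
variable {E' : Type*} [NormedAddCommGroup E'] [NormedSpace ℝ E'] [FiniteDimensional ℝ E']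
variable {X : Type*} [TopologicalSpace X] [ChartedSpace E' X] [IsManifold 𝓘(ℝ, E') ∞ X]
variable [MulAction (Torus n) X] {p : X → M} {Θ : Fin n → DForm E' X 1}

/-- The components of an invariant `3`-form. -/
lemma exists_flux (hp : IsPrincipalTorusBundle n E E' p) (hΘ : IsConnection Θ)
    {H : DForm E' X 3} (hs : DForm.IsSmooth H) (hinv : InvForm n H) :
    ∃ h : Flux n E M, h.IsAdmissible ∧ H = h.total p Θ := by
  obtain ⟨A3, A2, A1, A0, h3, h2, h1, h0, hA1, hA0, hA0', hH⟩ :=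
    exists_threeForm_eq hp.smooth_action hΘ ⟨hs, hinv⟩
  obtain ⟨B3, hB3s, hB3⟩ := exists_form_descent hp hΘ h3.1.1 h3.1.2 h3.2
  choose B2 hB2s hB2 using fun j ↦ exists_form_descent hp hΘ (h2 j).1.1 (h2 j).1.2 (h2 j).2
  choose B1 hB1s hB1 using
    fun j k ↦ exists_form_descent hp hΘ (h1 j k).1.1 (h1 j k).1.2 (h1 j k).2
  choose B0 hB0s hB0 using fun i j k ↦ exists_fun_descent (E := E) hp
    (f := A0 i j k) (isSmoothFun_toFun (h0 i j k).1) (h0 i j k).2.toFun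
  refine ⟨⟨B3, B2, B1, B0⟩, ⟨hB3s, hB2s, hB1s, hB0s, ?_, ?_, ?_⟩, ?_⟩
  -- The antisymmetries hold upstairs and descend because pullback by `p` is injective.
  · intro i j
    refine hp.pull_injective ?_
    exact (hB1 i j).trans ((hA1 i j).trans (congrArg Neg.neg (hB1 j i)).symm)
  · intro i j k
    funext m
    obtain ⟨x, rfl⟩ := hp.proj_surjective m
    exact (hB0 i j k x).trans ((congrFun (hA0 i j k) x).trans (congrArg Neg.neg (hB0 j i k x)).symm)
  · intro i j k
    funext m
    obtain ⟨x, rfl⟩ := hp.proj_surjective m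
    exact (hB0 i j k x).trans
      ((congrFun (hA0' i j k) x).trans (congrArg Neg.neg (hB0 i k j x)).symm)
  · have h5 : (fun i j k x ↦ B0 i j k (p x)) = A0 := by
      funext i j k x
      exact hB0 i j k x
    change H = threeForm Θ (pull p B3) (fun i ↦ pull p (B2 i)) (fun i j ↦ pull p (B1 i j))
      fun i j k x ↦ B0 i j k (p x)
    rw [h5, hB3, hH]
    simp only [hB2, hB1]

/-- The curvature of a connection. -/
lemma exists_curvature (hp : IsPrincipalTorusBundle n E E' p) (hΘ : IsConnection Θ) (i : Fin n) :
    ∃ F : DForm E M 2, DForm.IsSmooth F ∧ d (Θ i) = pull p F := by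
  obtain ⟨F, hF, h⟩ := exists_form_descent hp hΘ (hΘ.smooth i).d
    (InvForm.d hp.smooth_action (hΘ.smooth i) (hΘ.invariant i)) (η := d (Θ i)) fun j ↦ by
      funext x
      ext u
      have h1 := d_connection_fundField hp.smooth_action hΘ j i x (u 0)
      refine Eq.trans ?_ h1
      refine congrArg (d (Θ i) x) (funext fun l ↦ ?_)
      fin_cases l <;> rfl
  exact ⟨F, hF, h.symm⟩

end FluxDescent

/-! ### Fields related by a map. -/

section Related

variable {E : Type*} [NormedAddCommGroup E] [NormedSpace ℝ E]
variable {M : Type*} [TopologicalSpace M] [ChartedSpace E M]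
variable {E' : Type*} [NormedAddCommGroup E'] [NormedSpace ℝ E']
variable {X : Type*} [TopologicalSpace X] [ChartedSpace E' X]
variable {k : ℕ}

/-- Contraction commutes with pullback for related fields. -/
lemma contr_pull {f : X → M} {v : VField E' X} {w : VField E M}
    (h : ∀ x, tangentMapAt (E := E') (E' := E) f x (v x) = w (f x)) (ζ : DForm E M (k + 1)) :
    contr v (pull f ζ) = pull f (contr w ζ) := by
  funext x
  ext u
  refine congrArg (ζ (f x)) (funext fun i ↦ ?_)
  exact Fin.cases (h x) (fun _ ↦ rfl) i

variable [IsManifold 𝓘(ℝ, E) ∞ M] [IsManifold 𝓘(ℝ, E') ∞ X]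

/-- Relatedness is assumed at one point only, so the statement also applies to fields chosen just to
test a single tangent vector. -/
lemma fieldInChart_related {f : X → M} (hf : ContMDiff 𝓘(ℝ, E') 𝓘(ℝ, E) ∞ f)
    {v : VField E' X} {w : VField E M} {x₀ : X} {m₀ : M} {z : E'}
    (h : tangentMapAt (E := E') (E' := E) f ((extChartAt 𝓘(ℝ, E') x₀).symm z)
      (v ((extChartAt 𝓘(ℝ, E') x₀).symm z)) = w (f ((extChartAt 𝓘(ℝ, E') x₀).symm z)))
    (hz : z ∈ (extChartAt 𝓘(ℝ, E') x₀).target)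
    (hz' : f ((extChartAt 𝓘(ℝ, E') x₀).symm z) ∈ (extChartAt 𝓘(ℝ, E) m₀).source) :
    fderiv ℝ (extChartAt 𝓘(ℝ, E) m₀ ∘ f ∘ (extChartAt 𝓘(ℝ, E') x₀).symm) z
        (fieldInChart x₀ v z) =
      fieldInChart m₀ w (extChartAt 𝓘(ℝ, E) m₀ (f ((extChartAt 𝓘(ℝ, E') x₀).symm z))) := by
  have h1 := (extChartAt_symm_smoothAt x₀ hz).mdifferentiableAt (n := ∞) (by simp)
  have h2 := (hf ((extChartAt 𝓘(ℝ, E') x₀).symm z)).mdifferentiableAt (n := ∞) (by simp)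
  have h3 := (extChartAt_smoothAt m₀ hz').mdifferentiableAt (n := ∞) (by simp)
  have e1 := tangentMapAt_comp (E := E') (E' := E) (E'' := E) (g := extChartAt 𝓘(ℝ, E) m₀)
    (f := f ∘ (extChartAt 𝓘(ℝ, E') x₀).symm) (x := z) h3 (h2.comp z h1)
  have e2 := tangentMapAt_comp (E := E') (E' := E') (E'' := E) (g := f)
    (f := (extChartAt 𝓘(ℝ, E') x₀).symm) (x := z) h2 h1
  rw [← tangentMapAt_eq_fderiv, e1, e2]
  have e3 := tangentMapAt_symm_fieldInChart v x₀ hz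
  have e4 : fieldInChart m₀ w (extChartAt 𝓘(ℝ, E) m₀ (f ((extChartAt 𝓘(ℝ, E') x₀).symm z))) =
      tangentMapAt (E := E) (E' := E) (extChartAt 𝓘(ℝ, E) m₀)
        (f ((extChartAt 𝓘(ℝ, E') x₀).symm z)) (w (f ((extChartAt 𝓘(ℝ, E') x₀).symm z))) := by
    rw [fieldInChart, (extChartAt 𝓘(ℝ, E) m₀).left_inv hz']
  refine Eq.trans ?_ e4.symm
  refine congrArg (tangentMapAt (E := E) (E' := E) (extChartAt 𝓘(ℝ, E) m₀)
    (f ((extChartAt 𝓘(ℝ, E') x₀).symm z))) ?_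
  refine Eq.trans ?_ h
  exact congrArg (tangentMapAt (E := E') (E' := E) f ((extChartAt 𝓘(ℝ, E') x₀).symm z)) e3

end Related

/-! ### Smoothness and invariance through the frame. -/

section Frame

variable {n : ℕ}
variable {E : Type*} [NormedAddCommGroup E] [NormedSpace ℝ E] [FiniteDimensional ℝ E]
variable {M : Type*} [TopologicalSpace M] [ChartedSpace E M]
variable {E' : Type*} [NormedAddCommGroup E'] [NormedSpace ℝ E'] [FiniteDimensional ℝ E']
variable {X : Type*} [TopologicalSpace X] [ChartedSpace E' X]
variable [MulAction (Torus n) X] {p : X → M} {Θ : Fin n → DForm E' X 1} {k : ℕ}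

/-- The splitting of the tangent space at `x` given by the connection. -/
def frameEquiv (hp : IsPrincipalTorusBundle n E E' p) (hΘ : IsConnection Θ) (x : X) :
    E' ≃L[ℝ] E × (Fin n → ℝ) :=
  (LinearEquiv.ofBijective (frame E p Θ x).toLinearMap
    (frame_bijective hp hΘ x)).toContinuousLinearEquiv

lemma coe_frameEquiv (hp : IsPrincipalTorusBundle n E E' p) (hΘ : IsConnection Θ) (x : X) :
    (frameEquiv hp hΘ x : E' →L[ℝ] E × (Fin n → ℝ)) = frame E p Θ x := rfl

lemma frame_frameEquiv_symm (hp : IsPrincipalTorusBundle n E E' p) (hΘ : IsConnection Θ) (x : X)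
    (q : E × (Fin n → ℝ)) : frame E p Θ x ((frameEquiv hp hΘ x).symm q) = q :=
  (frameEquiv hp hΘ x).apply_symm_apply q

omit [FiniteDimensional ℝ E] [FiniteDimensional ℝ E'] in
-- Both `p` and `Θ` are invariant. Hence a field whose frame components are pulled back from `M` is
-- itself invariant.
lemma frame_smul (hp : IsPrincipalTorusBundle n E E' p) (hΘ : IsConnection Θ) (t : Torus n) (x : X)
    (u : E') : frame E p Θ (t • x) (tangentMapAt (E := E') (E' := E') (fun y : X ↦ t • y) x u) =
      frame E p Θ x u := by
  rw [frame_apply, frame_apply, hp.tangentMapAt_smul]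
  refine Prod.ext rfl (funext fun i ↦ ?_)
  exact congrArg (fun α ↦ α fun _ ↦ u) (congrFun (hΘ.invariant i t) x)

omit [FiniteDimensional ℝ E] [FiniteDimensional ℝ E'] in
lemma contr_fundField_pull (hp : IsPrincipalTorusBundle n E E' p) (i : Fin n)
    (ζ : DForm E M (k + 1)) : contr (fundField n i) (pull (E := E') p ζ) = 0 := by
  rw [contr_pull (w := 0) fun x ↦ hp.tangentMapAt_fundField i x]
  funext x
  ext u
  exact (ζ (p x)).toMultilinearMap.map_coord_zero 0 rfl

variable [IsManifold 𝓘(ℝ, E) ∞ M] [IsManifold 𝓘(ℝ, E') ∞ X]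

/-- A field with smooth components in the frame is smooth. -/
lemma isSmooth_of_frame (hp : IsPrincipalTorusBundle n E E' p) (hΘ : IsConnection Θ)
    {v : VField E' X} {w : VField E M} {f : Fin n → M → ℝ} (hw : VField.IsSmooth w)
    (hf : ∀ i, IsSmoothFun E (f i))
    (h : ∀ x, frame E p Θ x (v x) = (w (p x), fun i ↦ f i (p x))) : VField.IsSmooth v := by
  intro x
  refine VField.smoothAt_iff.2 ?_
  let z₀ := extChartAt 𝓘(ℝ, E') x x
  let g : E' → E := extChartAt 𝓘(ℝ, E) (p x) ∘ p ∘ (extChartAt 𝓘(ℝ, E') x).symm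
  have hx : (extChartAt 𝓘(ℝ, E') x).symm z₀ = x := extChartAt_to_inv x
  have hφ : ContMDiffAt 𝓘(ℝ, E') 𝓘(ℝ, E') ∞ (extChartAt 𝓘(ℝ, E') x).symm z₀ :=
    extChartAt_symm_smoothAt x (mem_extChartAt_target x)
  have hpφ : ContMDiffAt 𝓘(ℝ, E') 𝓘(ℝ, E) ∞ (p ∘ (extChartAt 𝓘(ℝ, E') x).symm) z₀ :=
    (hp.smooth_proj _).comp z₀ hφ
  have hg : ContDiffAt ℝ ∞ g z₀ := by
    refine ContMDiffAt.contDiffAt ((extChartAt_smoothAt (p x) ?_).comp z₀ hpφ)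
    rw [Function.comp_apply, hx]
    exact mem_extChartAt_source (p x)
  -- The frame in coordinates. The field solves `A z (v z) = r z` with `A` and `r` smooth, so it
  -- remains to invert `A` near `z₀`.
  let A : E' → E' →L[ℝ] E × (Fin n → ℝ) := fun z ↦
    (fderiv ℝ g z).prod (ContinuousLinearMap.pi fun i ↦
      (ContinuousAlternatingMap.ofSubsingleton ℝ E' ℝ (0 : Fin 1)).symm (inChart x (Θ i) z))
  have hA : ContDiffAt ℝ ∞ A z₀ := by
    refine contDiffAt_clm_of_forall_apply fun u ↦ ?_
    refine ContDiffAt.prodMk ?_ (contDiffAt_pi.2 fun i ↦ ?_)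
    · exact (hg.fderiv_right (m := ∞) le_rfl).clm_apply contDiffAt_const
    · exact contDiffAt_alternating_iff.1 ((hΘ.smooth i).smoothAt x) fun _ ↦ u
  have hev : ∀ᶠ z in nhds z₀, z ∈ (extChartAt 𝓘(ℝ, E') x).target ∧
      p ((extChartAt 𝓘(ℝ, E') x).symm z) ∈ (extChartAt 𝓘(ℝ, E) (p x)).source := by
    refine Filter.Eventually.and (extChartAt_target_mem_nhds (I := 𝓘(ℝ, E')) x)
      (hpφ.continuousAt ?_)
    refine extChartAt_source_mem_nhds' (I := 𝓘(ℝ, E)) ?_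
    rw [Function.comp_apply, hx]
    exact mem_extChartAt_source (p x)
  let r : E' → E × (Fin n → ℝ) := fun z ↦ (fieldInChart (p x) w (g z),
    fun i ↦ f i (p ((extChartAt 𝓘(ℝ, E') x).symm z)))
  have hr : ContDiffAt ℝ ∞ r z₀ := by
    refine ContDiffAt.prodMk ?_ (contDiffAt_pi.2 fun i ↦ ?_)
    · refine ContDiffAt.comp (g := fieldInChart (p x) w) z₀ ?_ hg
      have h1 : g z₀ = extChartAt 𝓘(ℝ, E) (p x) (p x) := by simp only [g, Function.comp_apply, hx]
      rw [h1]
      exact VField.smoothAt_iff.1 (hw (p x))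
    · exact ((hf i _).comp z₀ hpφ).contDiffAt
  have hAr : ∀ᶠ z in nhds z₀, A z (fieldInChart x v z) = r z := by
    filter_upwards [hev] with z hz
    refine Prod.ext ?_ (funext fun i ↦ ?_)
    · exact fieldInChart_related hp.smooth_proj (congrArg Prod.fst (h _)) hz.1 hz.2
    · exact (apply_field_comp_symm (Θ i) v x hz.1).symm.trans (congrFun (congrArg Prod.snd (h _)) i)
  have hA₀ : A z₀ = frameEquiv hp hΘ x := by
    rw [coe_frameEquiv]
    ext1 u
    let v' : VField E' X := fun _ ↦ u
    let w' : VField E M := fun _ ↦ tangentMapAt (E := E') (E' := E) p x u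
    have h1 : g z₀ = extChartAt 𝓘(ℝ, E) (p x) (p x) := by simp only [g, Function.comp_apply, hx]
    refine Prod.ext ?_ (funext fun i ↦ ?_)
    · have h2 := fieldInChart_related hp.smooth_proj (v := v') (w := w') (m₀ := p x)
        (congrArg (fun y ↦ tangentMapAt (E := E') (E' := E) p y u) hx) hev.self_of_nhds.1
        hev.self_of_nhds.2
      change fderiv ℝ g z₀ _ = fieldInChart (p x) w' (g z₀) at h2
      rw [h1, fieldInChart_apply_self, fieldInChart_apply_self] at h2
      exact h2
    · exact congrArg (fun α ↦ α fun _ ↦ u) (inChart_apply_self (Θ i) x)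
  -- Invertibility is an open condition and holds at `z₀`, where `A` is the frame itself.
  have hinv : ∀ᶠ z in nhds z₀, A z ∈ Set.range ((↑) : (E' ≃L[ℝ] E × (Fin n → ℝ)) → _) := by
    refine hA.continuousAt ?_
    rw [hA₀]
    exact ContinuousLinearEquiv.nhds _
  have hI : ContDiffAt ℝ ∞ (fun z ↦ (A z).inverse (r z)) z₀ := by
    refine ContDiffAt.clm_apply (ContDiffAt.comp (g := ContinuousLinearMap.inverse) z₀ ?_ hA) hr
    rw [hA₀]
    exact contDiffAt_map_inverse _
  refine hI.congr_of_eventuallyEq ?_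
  filter_upwards [hinv, hAr] with z hz hz'
  obtain ⟨e, he⟩ := hz
  rw [← hz', ← he, ContinuousLinearMap.inverse_equiv]
  exact (e.symm_apply_apply _).symm

omit [FiniteDimensional ℝ E] [FiniteDimensional ℝ E'] in
/-- Smooth invariant fields project to smooth fields on the base. -/
lemma exists_field_descent (hp : IsPrincipalTorusBundle n E E' p) {v : VField E' X}
    (hv : VField.IsSmooth v) (hinv : InvField n v) :
    ∃ w : VField E M, VField.IsSmooth w ∧
      ∀ x, tangentMapAt (E := E') (E' := E) p x (v x) = w (p x) := by
  let s := Function.surjInv hp.proj_surjective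
  let w : VField E M := fun m ↦ tangentMapAt (E := E') (E' := E) p (s m) (v (s m))
  have hw : ∀ x, tangentMapAt (E := E') (E' := E) p x (v x) = w (p x) := by
    intro x
    have key : ∀ (x₀ y : X) (t : Torus n), y = t • x₀ →
        tangentMapAt (E := E') (E' := E) p y (v y) =
          tangentMapAt (E := E') (E' := E) p x₀ (v x₀) := by
      rintro x₀ y t rfl
      have h1 := hp.tangentMapAt_smul t x₀ (v x₀)
      refine Eq.trans ?_ h1
      exact congrArg (tangentMapAt (E := E') (E' := E) p (t • x₀)) (hinv t x₀).symm
    obtain ⟨t, ht⟩ := hp.exists_smul_eq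
      (Function.surjInv_eq hp.proj_surjective (p x) : p (s (p x)) = p x)
    exact key _ _ t ht
  refine ⟨w, fun m ↦ ?_, hw⟩
  obtain ⟨x, rfl⟩ := hp.proj_surjective m
  obtain ⟨σ, -, hσ⟩ := hp.exists_local_section x
  -- Near `p x` the descended field is the tangent map of `p` applied to `v` along a smooth local
  -- section.
  have h1 := hp.smooth_proj.contMDiff_tangentMap (m := ∞) (n := ∞) le_rfl
  have h2 := (h1 _).comp (p x) ((hv (σ (p x))).comp (p x) hσ.self_of_nhds.1)
  refine h2.congr_of_eventuallyEq ?_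
  filter_upwards [hσ] with y hy
  have key : ∀ m, p (σ y) = m → (⟨m, w m⟩ : TangentBundle 𝓘(ℝ, E) M) = ⟨p (σ y), w (p (σ y))⟩ := by
    rintro _ rfl
    rfl
  refine (key y hy.2).trans ?_
  exact congrArg (fun a : E ↦ (⟨p (σ y), a⟩ : TangentBundle 𝓘(ℝ, E) M)) (hw (σ y)).symm

end Frame

/-! ### Linearity of one-forms in their components. -/

section OneForm

variable {n : ℕ} {E : Type*} [NormedAddCommGroup E] [NormedSpace ℝ E] {M : Type*}

lemma oneForm_apply (Θ : Fin n → DForm E M 1) (C1 : DForm E M 1) (C0 : Fin n → M → ℝ) (x : M)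
    (u : Fin 1 → E) : oneForm Θ C1 C0 x u = C1 x u + ∑ i, C0 i x * Θ i x u := by
  simp only [oneForm, form_add_apply, form_sum_apply, fmul_apply]

lemma oneForm_add (Θ : Fin n → DForm E M 1) (C1 D1 : DForm E M 1) (C0 D0 : Fin n → M → ℝ) :
    oneForm Θ (C1 + D1) (C0 + D0) = oneForm Θ C1 C0 + oneForm Θ D1 D0 := by
  funext x
  ext u
  rw [form_add_apply]
  simp only [oneForm_apply, form_add_apply]
  simp only [Pi.add_apply, add_mul, Finset.sum_add_distrib]
  ring

lemma oneForm_smul (Θ : Fin n → DForm E M 1) (c : ℝ) (C1 : DForm E M 1) (C0 : Fin n → M → ℝ) :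
    oneForm Θ (c • C1) (c • C0) = c • oneForm Θ C1 C0 := by
  funext x
  ext u
  rw [form_smul_apply]
  simp only [oneForm_apply, form_smul_apply]
  simp only [Pi.smul_apply, smul_eq_mul, mul_add, Finset.mul_sum, mul_assoc]

lemma oneForm_sub (Θ : Fin n → DForm E M 1) (C1 D1 : DForm E M 1) (C0 D0 : Fin n → M → ℝ) :
    oneForm Θ (C1 - D1) (C0 - D0) = oneForm Θ C1 C0 - oneForm Θ D1 D0 := by
  rw [eq_sub_iff_add_eq, ← oneForm_add, sub_add_cancel, sub_add_cancel]

end OneForm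

/-! ### The isomorphism of sections. -/

section Lift

variable {n : ℕ}
variable {E : Type*} [NormedAddCommGroup E] [NormedSpace ℝ E] [FiniteDimensional ℝ E]
variable {M : Type*} [TopologicalSpace M] [ChartedSpace E M]
variable {E' : Type*} [NormedAddCommGroup E'] [NormedSpace ℝ E'] [FiniteDimensional ℝ E']
variable {X : Type*} [TopologicalSpace X] [ChartedSpace E' X]
variable [MulAction (Torus n) X] {p : X → M} {Θ : Fin n → DForm E' X 1} {k : ℕ}

/-- `a` has components `s` with respect to the splittings of `TX` and `T^*X` given by `Θ`. -/
structure IsLift (p : X → M) (Θ : Fin n → DForm E' X 1) (s : RedSec n E M) (a : GenSec E' X) :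
    Prop where
  frame_fst : ∀ x, frame E p Θ x (a.1 x) = (s.1.1 (p x), fun i ↦ s.1.2 i (p x))
  snd_eq : a.2 = oneForm Θ (pull p s.2.1) fun i x ↦ s.2.2 i (p x)

/-- The horizontal lift is the vector with frame coordinates `(v_M, 0)`; adding `f_I K_I` supplies
the second coordinate, and injectivity of the frame gives equality. -/
lemma IsLift.hasComponents (hp : IsPrincipalTorusBundle n E E' p) (hΘ : IsConnection Θ)
    {s : RedSec n E M} {a : GenSec E' X} (h : IsLift p Θ s a) : HasComponents p Θ s a := by
  refine ⟨⟨fun x ↦ (frameEquiv hp hΘ x).symm (s.1.1 (p x), 0), fun x ↦ ?_, ?_⟩, h.snd_eq⟩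
  · have h1 := frame_frameEquiv_symm hp hΘ x (s.1.1 (p x), 0)
    exact ⟨congrArg Prod.fst h1, fun i ↦ congrFun (congrArg Prod.snd h1) i⟩
  · funext x
    refine (frame_bijective hp hΘ x).1 ((h.frame_fst x).trans ?_)
    let K : Fin n → E' := fun i ↦ fundField n i x
    have hK : ∀ i, frame E p Θ x (K i) = (0, Pi.single i 1) := frame_fundField hp hΘ x
    have h1 := frame_frameEquiv_symm hp hΘ x (s.1.1 (p x), 0)
    change _ = frame E p Θ x ((frameEquiv hp hΘ x).symm (s.1.1 (p x), 0) +
      ∑ i, s.1.2 i (p x) • K i)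
    rw [map_add, h1, map_sum]
    simp only [map_smul, hK]
    refine Prod.ext ?_ (funext fun j ↦ ?_)
    · simp only [Prod.fst_add, Prod.fst_sum, Prod.smul_fst, smul_zero, Finset.sum_const_zero]
      exact (add_zero _).symm
    · simp [Prod.snd_sum, Finset.sum_apply, Pi.single_apply]

lemma IsLift.unique (hp : IsPrincipalTorusBundle n E E' p) (hΘ : IsConnection Θ)
    {s : RedSec n E M} {a b : GenSec E' X} (ha : IsLift p Θ s a) (hb : IsLift p Θ s b) :
    a = b := by
  refine Prod.ext (funext fun x ↦ ?_) (ha.snd_eq.trans hb.snd_eq.symm)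
  exact (frame_bijective hp hΘ x).1 ((ha.frame_fst x).trans (hb.frame_fst x).symm)

omit [FiniteDimensional ℝ E] [FiniteDimensional ℝ E'] in
-- The frame reads off the vector components, since `p` is surjective. Contraction with `K_I`
-- isolates `φ^I`, and what is left of the covector is a pullback, hence determined.
lemma IsLift.unique_components (hp : IsPrincipalTorusBundle n E E' p) (hΘ : IsConnection Θ)
    {s t : RedSec n E M} {a : GenSec E' X} (hs : IsLift p Θ s a) (ht : IsLift p Θ t a) :
    s = t := by
  have h1 := fun x ↦ (hs.frame_fst x).symm.trans (ht.frame_fst x)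
  have h2 := hs.snd_eq.symm.trans ht.snd_eq
  have h3 : ∀ i x, s.2.2 i (p x) = t.2.2 i (p x) := by
    intro i x
    have h4 := congrArg (contr (fundField n i)) h2
    rw [contr_oneForm_of_horizontal hΘ.contr_fundField (fun i ↦ contr_fundField_pull hp i _),
      contr_oneForm_of_horizontal hΘ.contr_fundField (fun i ↦ contr_fundField_pull hp i _)] at h4
    exact congrFun (congrArg toFun h4) x
  have h5 : (fun i x ↦ s.2.2 i (p x)) = fun i x ↦ t.2.2 i (p x) := funext fun i ↦ funext (h3 i)
  rw [h5] at h2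
  refine Prod.ext (Prod.ext ?_ ?_) (Prod.ext (hp.pull_injective (add_right_cancel h2)) ?_)
  · funext m
    obtain ⟨x, rfl⟩ := hp.proj_surjective m
    exact congrArg Prod.fst (h1 x)
  · funext i m
    obtain ⟨x, rfl⟩ := hp.proj_surjective m
    exact congrFun (congrArg Prod.snd (h1 x)) i
  · funext i m
    obtain ⟨x, rfl⟩ := hp.proj_surjective m
    exact h3 i x

omit [FiniteDimensional ℝ E] [FiniteDimensional ℝ E'] [MulAction (Torus n) X] in
lemma IsLift.add {s t : RedSec n E M} {a b : GenSec E' X} (hs : IsLift p Θ s a)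
    (ht : IsLift p Θ t b) : IsLift p Θ (s + t) (a + b) where
  frame_fst x := ((frame E p Θ x).map_add _ _).trans
    (congrArg₂ (· + ·) (hs.frame_fst x) (ht.frame_fst x))
  snd_eq := (congrArg₂ (· + ·) hs.snd_eq ht.snd_eq).trans (oneForm_add Θ _ _ _ _).symm

omit [FiniteDimensional ℝ E] [FiniteDimensional ℝ E'] [MulAction (Torus n) X] in
lemma IsLift.smul (c : ℝ) {s : RedSec n E M} {a : GenSec E' X} (hs : IsLift p Θ s a) :
    IsLift p Θ (c • s) (c • a) where
  frame_fst x := ((frame E p Θ x).map_smul _ _).trans (congrArg (c • ·) (hs.frame_fst x))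
  snd_eq := (congrArg (c • ·) hs.snd_eq).trans (oneForm_smul Θ c _ _).symm

lemma IsLift.invField (hp : IsPrincipalTorusBundle n E E' p) (hΘ : IsConnection Θ)
    {s : RedSec n E M} {a : GenSec E' X} (h : IsLift p Θ s a) : InvField n a.1 := fun t x ↦ by
  refine (frame_bijective hp hΘ (t • x)).1 ((frame_smul hp hΘ t x (a.1 x)).trans ?_)
  refine (h.frame_fst x).trans (Eq.trans ?_ (h.frame_fst (t • x)).symm)
  rw [hp.proj_smul]

omit [FiniteDimensional ℝ E] [FiniteDimensional ℝ E'] in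
lemma IsLift.invForm (hp : IsPrincipalTorusBundle n E E' p) (hΘ : IsConnection Θ)
    {s : RedSec n E M} {a : GenSec E' X} (h : IsLift p Θ s a) : InvForm n a.2 := by
  rw [h.snd_eq]
  refine InvForm.add (fun t ↦ ?_) (.sum fun i _ ↦ .fmul (fun t x ↦ ?_) (hΘ.invariant i))
  · funext x
    rw [pull_pull_apply ((hp.smooth_proj _).mdifferentiableAt (by simp))
      ((contMDiff_smul_const hp.smooth_action t x).mdifferentiableAt (by simp))]
    exact congrArg (fun f ↦ pull (E := E') f s.2.1 x) (funext fun y ↦ hp.proj_smul t y)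
  · exact congrArg (s.2.2 i) (hp.proj_smul t x)

variable [IsManifold 𝓘(ℝ, E) ∞ M] [IsManifold 𝓘(ℝ, E') ∞ X]

lemma exists_lift (hp : IsPrincipalTorusBundle n E E' p) (hΘ : IsConnection Θ)
    (s : redSections n E M) : ∃ a : invSections n E' X, IsLift p Θ s.1 a.1 := by
  obtain ⟨s, hs1, hs2, hs3, hs4⟩ := s
  let v : VField E' X := fun x ↦ (frameEquiv hp hΘ x).symm (s.1.1 (p x), fun i ↦ s.1.2 i (p x))
  have hv : ∀ x, frame E p Θ x (v x) = (s.1.1 (p x), fun i ↦ s.1.2 i (p x)) :=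
    fun x ↦ frame_frameEquiv_symm hp hΘ x _
  have h : IsLift p Θ s (v, oneForm Θ (pull p s.2.1) fun i x ↦ s.2.2 i (p x)) := ⟨hv, rfl⟩
  refine ⟨⟨_, isSmooth_of_frame hp hΘ hs1 hs2 hv, h.invField hp hΘ, ?_, h.invForm hp hΘ⟩, h⟩
  refine (hs3.pull hp.smooth_proj).add (.sum fun i _ ↦ ?_)
  exact DForm.IsSmooth.fmul ((hs4 i).comp hp.smooth_proj) (hΘ.smooth i)

/-- The components are forced: `f_I = Θ_I(v)`, `φ^I = ρ(K_I)`, and `ρ - φ^I Θ_I` is then invariant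
and horizontal, so it descends. -/
lemma exists_components (hp : IsPrincipalTorusBundle n E E' p) (hΘ : IsConnection Θ)
    (a : invSections n E' X) : ∃ s : redSections n E M, IsLift p Θ s.1 a.1 := by
  obtain ⟨⟨v, ρ⟩, hv, hv', hρ, hρ'⟩ := a
  obtain ⟨w, hw, hvw⟩ := exists_field_descent (E := E) hp hv hv'
  choose f hfs hf using fun i ↦ exists_fun_descent (E := E) hp
    (isSmoothFun_toFun ((hΘ.smooth i).contr hv)) ((hΘ.invariant i).contr hv').toFun
  choose φ hφs hφ using fun i ↦ exists_fun_descent (E := E) hp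
    (isSmoothFun_toFun (hρ.contr (isSmooth_fundField hp.smooth_action i)))
    (hρ'.contr (invField_fundField hp.smooth_action i)).toFun
  let θ : DForm E' X 1 := oneForm Θ 0 fun i x ↦ φ i (p x)
  have hθ : InvSmooth n θ := by
    refine ⟨DForm.IsSmooth.zero.add (.sum fun i _ ↦ ?_),
      InvForm.zero.add (.sum fun i _ ↦ .fmul (fun t x ↦ ?_) (hΘ.invariant i))⟩
    · exact DForm.IsSmooth.fmul ((hφs i).comp hp.smooth_proj) (hΘ.smooth i)
    · exact congrArg (φ i) (hp.proj_smul t x)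
  obtain ⟨ζ, hζ, hζ'⟩ := exists_form_descent (E := E) hp hΘ (η := ρ - θ) (hρ.sub hθ.1)
    (hρ'.sub hθ.2) fun i ↦ by
      rw [contr_sub, contr_oneForm_of_horizontal hΘ.contr_fundField (fun _ ↦ contr_zero _),
        contr_eq_ofFun _ ρ, sub_eq_zero]
      exact congrArg ofFun (funext fun x ↦ (hφ i x).symm)
  refine ⟨⟨((w, f), (ζ, φ)), hw, hfs, hζ, hφs⟩, fun x ↦ ?_, ?_⟩
  · refine Prod.ext (hvw x) (funext fun i ↦ ?_)
    refine Eq.trans ?_ (hf i x).symm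
    rw [toFun, contr_apply_one]
    rfl
  · refine (sub_add_cancel ρ θ).symm.trans ?_
    rw [← hζ']
    simp only [θ, oneForm, zero_add]

/-- The isomorphism between sections on the base and invariant sections upstairs. -/
lemma exists_liftEquiv (hp : IsPrincipalTorusBundle n E E' p) (hΘ : IsConnection Θ) :
    ∃ Φ : redSections n E M ≃ₗ[ℝ] invSections n E' X, ∀ s, IsLift p Θ s.1 (Φ s).1 := by
  choose Φ hΦ using exists_lift (E := E) (M := M) hp hΘ
  refine ⟨LinearEquiv.ofBijective
    { toFun := Φ
      map_add' := fun s t ↦ Subtype.ext ((hΦ (s + t)).unique hp hΘ ((hΦ s).add (hΦ t)))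
      map_smul' := fun c s ↦ Subtype.ext ((hΦ (c • s)).unique hp hΘ ((hΦ s).smul c)) }
    ⟨fun s t h ↦ ?_, fun a ↦ ?_⟩, hΦ⟩
  · change Φ s = Φ t at h
    exact Subtype.ext ((hΦ s).unique_components hp hΘ (h ▸ hΦ t))
  · obtain ⟨s, hs⟩ := exists_components (E := E) hp hΘ a
    exact ⟨s, Subtype.ext ((hΦ s).unique hp hΘ hs)⟩

end Lift

/-! ### The Leibniz rule. -/

section Leibniz

variable {E : Type*} [NormedAddCommGroup E] [NormedSpace ℝ E]
variable {M : Type*} [TopologicalSpace M] [ChartedSpace E M] [IsManifold 𝓘(ℝ, E) ∞ M]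

lemma d_fmul {h : M → ℝ} {η : DForm E M 1} (hh : IsSmoothFun E h) (hη : DForm.IsSmooth η) :
    d (fmul h η) = fmul h (d η) + wedge (d (ofFun h)) η := by
  funext x
  ext u
  have hh' := hh.contMDiffAt (x := x).mdifferentiableAt (by simp)
  have hu : u = ![u 0, u 1] := by
    funext l
    fin_cases l <;> rfl
  have e0 : ∀ a b : E, Fin.removeNth 0 ![a, b] = fun _ ↦ b := by
    intro a b; funext i; fin_cases i; rfl
  have e1 : ∀ a b : E, Fin.removeNth 1 ![a, b] = fun _ ↦ a := by
    intro a b; funext i; fin_cases i; rfl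
  rw [hu, d_fmul_apply hh' (hη.smoothAt x), form_add_apply, fmul_apply, wedge_apply]
  simp [Fin.sum_univ_two, e0, e1, d_ofFun_apply hh']
  ring

end Leibniz

/-! ### The bracket in components. -/

section Bracket

variable {n : ℕ}
variable {E : Type*} [NormedAddCommGroup E] [NormedSpace ℝ E]
variable {M : Type*} [TopologicalSpace M] [ChartedSpace E M]
variable {E' : Type*} [NormedAddCommGroup E'] [NormedSpace ℝ E']
variable {X : Type*} [TopologicalSpace X] [ChartedSpace E' X]
variable {p : X → M} {Θ : Fin n → DForm E' X 1} {k : ℕ}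
variable {s t : RedSec n E M} {a b : GenSec E' X}

lemma toFun_pull (p : X → M) (α : DForm E M 0) (x : X) :
    toFun (pull (E := E') p α) x = toFun α (p x) :=
  congrArg (α (p x)) (Subsingleton.elim _ _)

lemma IsLift.contr_pull (ha : IsLift p Θ s a) (ζ : DForm E M (k + 1)) :
    contr a.1 (pull p ζ) = pull p (contr s.1.1 ζ) :=
  TorusReduction.contr_pull (fun x ↦ congrArg Prod.fst (ha.frame_fst x)) ζ

lemma IsLift.apply_connection (ha : IsLift p Θ s a) (i : Fin n) (x : X) :
    Θ i x (fun _ ↦ a.1 x) = s.1.2 i (p x) :=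
  congrFun (congrArg Prod.snd (ha.frame_fst x)) i

lemma IsLift.contr_connection (ha : IsLift p Θ s a) (i : Fin n) :
    contr a.1 (Θ i) = ofFun fun x ↦ s.1.2 i (p x) := by
  rw [contr_eq_ofFun]
  refine congrArg ofFun (funext fun x ↦ ?_)
  rw [toFun, contr_apply_one]
  exact ha.apply_connection i x

/-- The pairing of invariant sections. -/
lemma IsLift.contr_form (ha : IsLift p Θ s a) (hb : IsLift p Θ t b) :
    contr a.1 b.2 = pull p (redContr s.1 t.2) := by
  rw [hb.snd_eq, contr_oneForm ha.contr_connection, ha.contr_pull, redContr, pull_add, pull_ofFun]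
  congr 2
  funext x
  simp only [Function.comp_apply, Finset.sum_apply, Pi.mul_apply]

/-- Contraction of an invariant `3`-form with two invariant fields. -/
lemma IsLift.contr_contr_total (ha : IsLift p Θ s a) (hb : IsLift p Θ t b) {h : Flux n E M}
    (hh : h.IsAdmissible) : contr a.1 (contr b.1 (h.total p Θ)) =
      oneForm Θ (pull p (redContrTwo s.1 (redContrFlux t.1 h)).1)
        fun i x ↦ (redContrTwo s.1 (redContrFlux t.1 h)).2 i (p x) := by
  have h1 : contr b.1 (h.total p Θ) = twoForm Θ (pull p (redContrFlux t.1 h).1)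
      (fun j ↦ pull p ((redContrFlux t.1 h).2.1 j))
      fun j k x ↦ (redContrFlux t.1 h).2.2 j k (p x) := by
    refine (contr_threeForm hb.contr_connection (pull p h.H3) (fun i ↦ pull p (h.H2 i))
      (fun i j ↦ pull p (h.H1 i j)) (fun i j k x ↦ h.H0 i j k (p x)) (fun i j ↦ ?_)
      (fun i j k ↦ ?_) fun i j k ↦ ?_).trans ?_
    · rw [hh.antisymm1]
      rfl
    · funext x
      exact congrFun (hh.antisymm0_left i j k) (p x)
    · funext x
      exact congrFun (hh.antisymm0_right i j k) (p x)
    · simp only [hb.contr_pull, redContrFlux, pull_add, pull_sub, pull_sum, pull_fmul]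
      congr 1
      funext j k x
      simp only [Pi.add_apply, Finset.sum_apply, Pi.mul_apply, toFun_pull]
  rw [h1, contr_twoForm ha.contr_connection]
  · simp only [ha.contr_pull, redContrTwo, pull_sub, pull_sum, pull_fmul]
    congr 1
    funext j x
    simp only [Pi.add_apply, Finset.sum_apply, Pi.mul_apply, toFun_pull]
  -- The second contraction needs the `Θ ∧ Θ` coefficients antisymmetric; for fixed contracted index
  -- this is antisymmetry of `H₀` in its last two indices.
  · intro i j
    funext x
    simp only [redContrFlux, Pi.add_apply, Pi.neg_apply, Finset.sum_apply, Pi.mul_apply]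
    rw [hh.antisymm1 i j, contr_neg, neg_add, ← Finset.sum_neg_distrib]
    refine congrArg₂ (· + ·) rfl (Finset.sum_congr rfl fun l _ ↦ ?_)
    rw [hh.antisymm0_right l i j, Pi.neg_apply, mul_neg]

variable [IsManifold 𝓘(ℝ, E) ∞ M] [IsManifold 𝓘(ℝ, E') ∞ X]

lemma d_pull_eq {η : DForm E M k} (hη : DForm.IsSmooth η)
    (hp : ContMDiff 𝓘(ℝ, E') 𝓘(ℝ, E) ∞ p) : d (pull (E := E') p η) = pull p (d η) :=
  funext fun x ↦ d_pull (hη.smoothAt _) (hp x)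

variable [FiniteDimensional ℝ E] [FiniteDimensional ℝ E']

lemma isSmooth_redContr (hs : s ∈ redSections n E M) (ht : t ∈ redSections n E M) :
    DForm.IsSmooth (redContr s.1 t.2) := by
  refine (ht.2.2.1.contr hs.1).add (isSmooth_ofFun ?_)
  refine Finset.sum_induction _ (IsSmoothFun E) (fun _ _ h h' ↦ ContMDiff.add h h')
    contMDiff_const fun i _ ↦ ContMDiff.mul (ht.2.2.2 i) (hs.2.1 i)

lemma d_redContr (hs : s ∈ redSections n E M) (ht : t ∈ redSections n E M) :
    d (redContr s.1 t.2) = d (contr s.1.1 t.2.1) + ∑ i, (fmul (t.2.2 i) (d (ofFun (s.1.2 i)))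
      + fmul (s.1.2 i) (d (ofFun (t.2.2 i)))) := by
  have h1 : ∀ i, DForm.IsSmooth (ofFun (t.2.2 i * s.1.2 i) : DForm E M 0) :=
    fun i ↦ isSmooth_ofFun (ContMDiff.mul (ht.2.2.2 i) (hs.2.1 i))
  have h2 : (ofFun (∑ i, t.2.2 i * s.1.2 i) : DForm E M 0) = ∑ i, ofFun (t.2.2 i * s.1.2 i) := by
    funext x
    ext u
    rw [form_sum_apply]
    simp [ofFun, Finset.sum_apply]
  have h3 : d (redContr s.1 t.2) = d (contr s.1.1 t.2.1) + d (∑ i, ofFun (t.2.2 i * s.1.2 i)) := by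
    funext x
    rw [redContr, h2]
    exact d_add ((ht.2.2.1.contr hs.1).smoothAt x) ((DForm.IsSmooth.sum fun i _ ↦ h1 i).smoothAt x)
  rw [h3, d_sum h1]
  exact congrArg _ (Finset.sum_congr rfl fun i _ ↦ d_ofFun_mul (ht.2.2.2 i) (hs.2.1 i))

variable {F : Fin n → DForm E M 2}

/-- The differential of an invariant `1`-form. -/
lemma IsLift.d_form (hp : ContMDiff 𝓘(ℝ, E') 𝓘(ℝ, E) ∞ p) (hΘ : ∀ i, DForm.IsSmooth (Θ i))
    (hF : ∀ i, d (Θ i) = pull p (F i)) (ht : t ∈ redSections n E M) (hb : IsLift p Θ t b) :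
    d b.2 = twoForm Θ (pull p (d t.2.1 + ∑ i, fmul (t.2.2 i) (F i)))
      (fun i ↦ pull p (d (ofFun (t.2.2 i) : DForm E M 0))) 0 := by
  have hs : ∀ i, IsSmoothFun E' (M := X) fun x ↦ t.2.2 i (p x) := fun i ↦ (ht.2.2.2 i).comp hp
  have hs' : ∀ i, DForm.IsSmooth (fmul (fun x ↦ t.2.2 i (p x)) (Θ i)) :=
    fun i ↦ DForm.IsSmooth.fmul (hs i) (hΘ i)
  have h1 : d b.2 = d (pull (E := E') p t.2.1)
      + d (∑ i, fmul (fun x ↦ t.2.2 i (p x)) (Θ i)) := by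
    funext x
    rw [hb.snd_eq]
    exact d_add ((ht.2.2.1.pull hp).smoothAt x) ((DForm.IsSmooth.sum fun i _ ↦ hs' i).smoothAt x)
  have h2 : ∀ i, d (ofFun (fun x ↦ t.2.2 i (p x)) : DForm E' X 0) =
      pull p (d (ofFun (t.2.2 i) : DForm E M 0)) := fun i ↦ by
    rw [← d_pull_eq (isSmooth_ofFun (ht.2.2.2 i)) hp, pull_ofFun]
    rfl
  have h3 : (ofFun (0 : X → ℝ) : DForm E' X 0) = 0 := rfl
  rw [h1, d_pull_eq ht.2.2.1 hp, d_sum hs']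
  -- Each `d(φ^I Θ_I)` contributes `φ^I F_I` to the base part and `dφ^I` to the coefficient of
  -- `Θ_I`; there is no `Θ ∧ Θ` part.
  have h4 := fun i ↦ d_fmul (hs i) (hΘ i)
  simp only [h4, hF, h2, twoForm, pull_add, pull_sum, pull_fmul,
    Finset.sum_add_distrib, Pi.zero_apply, h3, wedge_zero, Finset.sum_const_zero, smul_zero,
    add_zero]
  exact (add_assoc _ _ _).symm

/-- The Lie derivative of an invariant `1`-form along an invariant field. -/
lemma IsLift.lieForm_eq (hp : ContMDiff 𝓘(ℝ, E') 𝓘(ℝ, E) ∞ p) (hΘ : ∀ i, DForm.IsSmooth (Θ i))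
    (hF : ∀ i, d (Θ i) = pull p (F i)) (hs : s ∈ redSections n E M) (ht : t ∈ redSections n E M)
    (ha : IsLift p Θ s a) (hb : IsLift p Θ t b) :
    lieForm a.1 b.2 = oneForm Θ (pull p (redLie F s.1 t.2).1)
      fun i x ↦ (redLie F s.1 t.2).2 i (p x) := by
  rw [lieForm, ha.contr_form hb, d_pull_eq (isSmooth_redContr hs ht) hp, d_redContr hs ht,
    hb.d_form hp hΘ hF ht, contr_twoForm ha.contr_connection _ _ 0 (fun _ _ ↦ neg_zero.symm),
    ← oneForm_zero_right Θ (pull p (d (contr s.1.1 t.2.1) + _)), ← oneForm_add]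
  congr 1
  · rw [ha.contr_pull, contr_add, contr_sum]
    have h1 : ∀ i, fmul (fun x ↦ s.1.2 i (p x)) (pull (E := E') p (d (ofFun (t.2.2 i) : DForm E M 0))) =
        pull p (fmul (s.1.2 i) (d (ofFun (t.2.2 i)))) := fun i ↦ (pull_fmul _ _ _).symm
    simp only [h1, ← pull_sum, ← pull_sub, ← pull_add]
    refine congrArg (pull p) ?_
    funext x
    ext u
    -- The terms `f_I dη^I` from differentiating the pairing cancel those from contracting `dη^I ∧
    -- Θ_I`; only `η^I df_I` survives.
    simp only [redLie, lieForm, contr_fmul, form_add_apply, form_sub_apply, form_sum_apply,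
      fmul_apply, mul_add, Finset.sum_add_distrib]
    ring
  · funext i x
    simp only [ha.contr_pull, Pi.add_apply, Pi.zero_apply, mul_zero, Finset.sum_const_zero,
      add_zero, zero_add, toFun_pull]
    change toFun (contr s.1.1 (d (ofFun (t.2.2 i)))) (p x) = lieFun s.1.1 (t.2.2 i) (p x)
    rw [toFun, contr_apply_one]
    exact d_ofFun_apply ((ht.2.2.2 i).contMDiffAt.mdifferentiableAt (by simp)) fun _ ↦ s.1.1 (p x)

/-- The bracket of invariant fields in the frame. -/
lemma IsLift.frame_mlieBracket (hp : ContMDiff 𝓘(ℝ, E') 𝓘(ℝ, E) ∞ p)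
    (hΘ : ∀ i, DForm.IsSmooth (Θ i)) (hF : ∀ i, d (Θ i) = pull p (F i))
    (hs : s ∈ redSections n E M) (ht : t ∈ redSections n E M)
    (ha : IsLift p Θ s a) (hb : IsLift p Θ t b) (has : VField.IsSmooth a.1)
    (hbs : VField.IsSmooth b.1) (x : X) :
    frame E p Θ x (VectorField.mlieBracket 𝓘(ℝ, E') a.1 b.1 x) =
      ((redLieBracket F s.1 t.1).1 (p x), fun i ↦ (redLieBracket F s.1 t.1).2 i (p x)) := by
  refine Prod.ext ?_ (funext fun i ↦ ?_)
  · exact tangentMapAt_mlieBracket hp has hbs hs.1 ht.1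
      (fun y ↦ congrArg Prod.fst (ha.frame_fst y)) (fun y ↦ congrArg Prod.fst (hb.frame_fst y)) x
  · have h1 := d_apply_fields ((hΘ i).smoothAt x) (has x) (hbs x)
    have key : ∀ {s : RedSec n E M} {a : GenSec E' X} (_ : IsLift p Θ s a) {g : M → ℝ}
        (_ : IsSmoothFun E g), tangentMapAt (E := E') (E' := ℝ) (fun y ↦ g (p y)) x (a.1 x) =
          lieFun s.1.1 g (p x) := by
      intro s a ha g hg
      have h2 := tangentMapAt_comp (E := E') (E' := E) (E'' := ℝ) (g := g) (f := p) (x := x)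
        (hg.contMDiffAt.mdifferentiableAt (by simp)) ((hp x).mdifferentiableAt (by simp))
      refine (DFunLike.congr_fun h2 (a.1 x : E')).trans ?_
      exact congrArg (tangentMapAt (E := E) (E' := ℝ) g (p x))
        (congrArg Prod.fst (ha.frame_fst x))
    rw [funext (ha.apply_connection i), funext (hb.apply_connection i), key ha (ht.2.1 i),
      key hb (hs.2.1 i), hF] at h1
    -- The sign is the convention `ι(v) ι(w) F = F(w, v)`; it turns the curvature term positive when
    -- Cartan's formula is solved for the bracket.
    have h3 : pull (E := E') p (F i) x ![a.1 x, b.1 x] =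
        -toFun (contr s.1.1 (contr t.1.1 (F i))) (p x) := by
      rw [contr_contr_swap]
      change _ = -(-(contr t.1.1 (contr s.1.1 (F i)) (p x) Fin.elim0))
      rw [neg_neg, contr_contr_apply]
      refine congrArg (F i (p x)) (funext fun l ↦ ?_)
      fin_cases l
      · exact congrArg Prod.fst (ha.frame_fst x)
      · exact congrArg Prod.fst (hb.frame_fst x)
    rw [h3] at h1
    change Θ i x (fun _ ↦ VectorField.mlieBracket 𝓘(ℝ, E') a.1 b.1 x) =
      toFun (contr s.1.1 (contr t.1.1 (F i))) (p x) + lieFun s.1.1 (t.1.2 i) (p x)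
        - lieFun t.1.1 (s.1.2 i) (p x)
    linarith

/-- The Courant bracket of invariant sections in components. -/
lemma IsLift.courantBracket (hp : ContMDiff 𝓘(ℝ, E') 𝓘(ℝ, E) ∞ p)
    (hΘ : ∀ i, DForm.IsSmooth (Θ i)) (hF : ∀ i, d (Θ i) = pull p (F i))
    {h : Flux n E M} (hh : h.IsAdmissible)
    (hs : s ∈ redSections n E M) (ht : t ∈ redSections n E M)
    (ha : IsLift p Θ s a) (hb : IsLift p Θ t b) (has : VField.IsSmooth a.1)
    (hbs : VField.IsSmooth b.1) :
    IsLift p Θ (reducedBracket F h s t) (courantBracket (h.total p Θ) a b) where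
  frame_fst := ha.frame_mlieBracket hp hΘ hF hs ht hb has hbs
  snd_eq := by
    change lieForm a.1 b.2 - lieForm b.1 a.2 - (1 / 2 : ℝ) • d (contr a.1 b.2 - contr b.1 a.2)
      + contr a.1 (contr b.1 (h.total p Θ)) = _
    -- The exact term is a pullback with zero `Θ` coefficients, which is why `redD` has vanishing
    -- second component. All terms then combine by linearity of `oneForm`.
    rw [ha.lieForm_eq hp hΘ hF hs ht hb, hb.lieForm_eq hp hΘ hF ht hs ha, ha.contr_form hb,
      hb.contr_form ha, ← pull_sub,
      d_pull_eq ((isSmooth_redContr hs ht).sub (isSmooth_redContr ht hs)) hp,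
      ha.contr_contr_total hb hh,
      ← oneForm_zero_right Θ (pull p (d (redContr s.1 t.2 - redContr t.1 s.2))), ← oneForm_smul,
      ← oneForm_sub, ← oneForm_sub, ← oneForm_add]
    rfl

end Bracket

end

end TorusReduction

/-! ### The reduction theorem. -/

open TorusReduction in
theorem mainTheorem8 {n : ℕ}
    {E : Type*} [NormedAddCommGroup E] [NormedSpace ℝ E] [FiniteDimensional ℝ E]
    {M : Type*} [TopologicalSpace M] [T2Space M] [SigmaCompactSpace M]
    [ChartedSpace E M] [IsManifold 𝓘(ℝ, E) ∞ M]
    {E' : Type*} [NormedAddCommGroup E'] [NormedSpace ℝ E'] [FiniteDimensional ℝ E']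
    {X : Type*} [TopologicalSpace X] [T2Space X] [SigmaCompactSpace X]
    [ChartedSpace E' X] [IsManifold 𝓘(ℝ, E') ∞ X]
    [MulAction (Torus n) X]
    (p : X → M) (hp : IsPrincipalTorusBundle n E E' p)
    (Θ : Fin n → DForm E' X 1) (hΘ : IsConnection Θ)
    (H : DForm E' X 3) (hH : DForm.IsSmooth H) (hHinv : InvForm n H) :
    ∃ (F : Fin n → DForm E M 2) (h : Flux n E M),
      (∀ i, DForm.IsSmooth (F i) ∧ d (Θ i) = pull p (F i)) ∧
      h.IsAdmissible ∧ H = h.total p Θ ∧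
      ∃ Φ : redSections n E M ≃ₗ[ℝ] invSections n E' X,
        (∀ s, HasComponents p Θ s.1 (Φ s).1) ∧
        ∀ s t, ∃ r : redSections n E M,
          r.1 = reducedBracket F h s.1 t.1 ∧
          (Φ r).1 = courantBracket H (Φ s).1 (Φ t).1 := by
  choose F hF using exists_curvature (E := E) hp hΘ
  obtain ⟨h, hh, rfl⟩ := exists_flux (E := E) hp hΘ hH hHinv
  obtain ⟨Φ, hΦ⟩ := exists_liftEquiv (E := E) (M := M) hp hΘ
  refine ⟨F, h, hF, hh, rfl, Φ, fun s ↦ (hΦ s).hasComponents hp hΘ, fun s t ↦ ?_⟩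
  obtain ⟨has, -, has', -⟩ := (Φ s).2
  obtain ⟨hbs, -, hbs', -⟩ := (Φ t).2
  have hl := (hΦ s).courantBracket hp.smooth_proj hΘ.smooth (fun i ↦ (hF i).2) hh s.2 t.2 (hΦ t)
    has hbs
  -- Closure of invariant sections: invariance is inherited from the computed components, smoothness
  -- from the operations in the bracket.
  have hmem : courantBracket (h.total p Θ) (Φ s).1 (Φ t).1 ∈ invSections n E' X := by
    refine ⟨has.mlieBracket hbs, hl.invField hp hΘ, ?_, hl.invForm hp hΘ⟩
    refine (((DForm.IsSmooth.lieForm has hbs').sub (DForm.IsSmooth.lieForm hbs has')).sub (.smul _ ?_)).add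
      ((hH.contr hbs).contr has)
    exact ((hbs'.contr has).sub (has'.contr hbs)).d
  -- The bracket has smooth components `r`, and uniqueness identifies them with the reduced bracket,
  -- whose smoothness thus needs no separate check.
  obtain ⟨r, hr⟩ := exists_components (E := E) hp hΘ ⟨_, hmem⟩
  exact ⟨r, hr.unique_components hp hΘ hl, (hΦ r).unique hp hΘ hr⟩
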